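/- Let $g$ be a probability density on $\mathbb R$, let $L^2(\mathbb R,g(\omega)d\omega)$ carry the inner product $(q_1,q_2)=\int q_1\overline{q_2}\,g\,d\omega$, and let $P_0\equiv 1$. Let $\mathcal M$ be multiplication by $\omega$ on its maximal domain and $\mathcal P u=(u,P_0)P_0$. For $K>0$ and $f_1\in\mathbb C$ put $T_1=i\mathcal M+iKf_1\mathcal P$ with domain $\mathsf D(\mathcal M)$. For $\operatorname{Re}\lambda\ne 0$ put $$Q(\lambda)=\int_{\mathbb R}\frac{q(\omega)g(\omega)}{\lambda-i\omega}\,d\omega,\qquad D(\lambda)=\int_{\mathbb R}\frac{g(\omega)}{\lambda-i\omega}\,d\omega .$$ If $\operatorname{Im}f_1<0$, define $K_c^{(1)}\in[0,\infty]$ as the infimum of $-\operatorname{Im}(f_1)/(\pi|f_1|^2g(y))$ over all $y\in\mathbb R$ with $$\lim_{x\to+0}\int_{\mathbb R}\frac{\omega-y}{x^2+(\omega-y)^2}\,g(\omega)\,d\omega=\frac{\pi\operatorname{Re}f_1}{\operatorname{Im}f_1}\,g(y)$$ (a value with $g(y)=0$ counts as $\infty$; the infimum of the empty set is $\infty$).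 Assume: (i) $\operatorname{Im}f_1<0$ and $0<K<K_c^{(1)}$. (ii) $g$ is real analytic on $\mathbb R$ and has a meromorphic continuation $g^*$ to the upper half-plane. (iii) $q\in L^2(\mathbb R,g\,d\omega)$ is real analytic on $\mathbb R$ and has an analytic continuation $q^*$ to the upper half-plane. Let $F_1$ be $F_1(\lambda)=\dfrac{Q(\lambda)}{1-iKf_1D(\lambda)}$ for $\operatorname{Re}\lambda>0$, which is $((\lambda-T_1)^{-1}q,P_0)$, continued meromorphically to the left half-plane by $$F_1(\lambda)=\frac{Q(\lambda)+2\pi q^*(-i\lambda)g^*(-i\lambda)}{1-iKf_1D(\lambda)-2\pi iKf_1g^*(-i\lambda)},\qquad \operatorname{Re}\lambda<0 .$$ (iv) For some $\delta>0$, $F_1(\lambda)\to0$ as $|\lambda|\to\infty$ in the sectors $|\arg\lambda-\pi/2|\le\delta$ and $|\arg\lambda-3\pi/2|\le\delta$. (v) There are constants $A,\beta>0$ and radii $r_k>0$, $r_k\to\infty$, such that $|F_1(\lambda)|\le Ae^{\beta|\lambda|}$ on the arcs $|\lambda|=r_k$, $\pi/2+\delta\le\arg\lambda\le3\pi/2-\delta$.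 Call the poles of $F_1$ in $\operatorname{Re}\lambda<0$ the resonance poles. Then: (a) The spectrum of $T_1$ lies on the imaginary axis, and $T_1$ generates a strongly continuous semigroup $e^{T_1t}$. (b) Every resonance pole is a root of $D(\lambda)+2\pi g^*(-i\lambda)=1/(iKf_1)$. Resonance poles exist unless $(e^{T_1t}q,P_0)=0$ for all $t\ge0$. (c) Every disk contains only finitely many resonance poles $\alpha$, and there are $t_0>0$ and polynomials $p_\alpha$ such that for all $t>t_0$ $$(e^{T_1t}q,P_0)=\lim_{k\to\infty}\ \sum_{|\alpha|<r_k}p_\alpha(t)\,e^{\alpha t},$$ that is, $(e^{T_1t}q,P_0)=\sum_n p_n(t)e^{\alpha_nt}$, where the poles are taken in order of increasing modulus and the series is summed in the groups cut out by the circles $|\lambda|=r_k$. (d) There are $C,\gamma>0$ with $|(e^{T_1t}q,P_0)|\le Ce^{-\gamma t}$ for all $t\ge0$. -/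

import Mathlib

open MeasureTheory Filter Topology Complex

noncomputable section

namespace Kuramoto

/-! ### The frequency density and the Hilbert space `L²(ℝ, g(ω)dω)` -/

/-- A probability density function on `ℝ`. -/
structure FrequencyDensity where
  /-- the density itself -/
  dens : ℝ → ℝ
  nonneg : ∀ ω, 0 ≤ dens ω
  integrable : Integrable dens
  integral_eq_one : ∫ ω, dens ω = 1

/-- The probability measure `g(ω)dω`. -/
def FrequencyDensity.measure (g : FrequencyDensity) : Measure ℝ :=
  volume.withDensity (fun ω => ENNReal.ofReal (g.dens ω))

instance (g : FrequencyDensity) : IsProbabilityMeasure g.measure := by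
  constructor
  rw [FrequencyDensity.measure, withDensity_apply _ MeasurableSet.univ, Measure.restrict_univ,
    ← ofReal_integral_eq_lintegral_ofReal g.integrable (Eventually.of_forall g.nonneg),
    g.integral_eq_one, ENNReal.ofReal_one]

/-- The complex Hilbert space `L²(ℝ, g(ω)dω)`. -/
abbrev FrequencyDensity.L2 (g : FrequencyDensity) : Type := Lp ℂ 2 g.measure

/-- The constant function `P₀ ≡ 1`. -/
def P0 (g : FrequencyDensity) : g.L2 := Lp.const 2 g.measure (1 : ℂ)

/-- The maximal domain `{q | ω q(ω) ∈ L²}` of the multiplication operator. -/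
def mulDomain (g : FrequencyDensity) : Submodule ℂ g.L2 where
  carrier := {u | MemLp (fun ω : ℝ => (ω : ℂ) * u ω) 2 g.measure}
  zero_mem' := by
    refine (MemLp.zero (ε := ℂ)).ae_eq ?_
    filter_upwards [Lp.coeFn_zero ℂ 2 g.measure] with ω h
    rw [h]
    simp
  add_mem' := by
    intro u v hu hv
    refine (MemLp.add hu hv).ae_eq ?_
    filter_upwards [Lp.coeFn_add u v] with ω h
    rw [h]
    simp [mul_add]
  smul_mem' := by
    intro c u hu
    refine (MemLp.const_smul hu c).ae_eq ?_
    filter_upwards [Lp.coeFn_smul c u] with ω h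
    rw [h]
    simp only [Pi.smul_apply, smul_eq_mul]
    ring

/-- The multiplication operator `q(ω) ↦ ω q(ω)` on its maximal domain. -/
def mulOp (g : FrequencyDensity) : g.L2 →ₗ.[ℂ] g.L2 where
  domain := mulDomain g
  toFun :=
    { toFun := fun u => MemLp.toLp (fun ω : ℝ => (ω : ℂ) * (u : g.L2) ω) u.2
      map_add' := by
        intro u v
        refine Eq.trans ?_ (MemLp.toLp_add u.2 v.2)
        refine (MemLp.toLp_eq_toLp_iff _ _).2 ?_
        filter_upwards [Lp.coeFn_add (u : g.L2) (v : g.L2)] with ω h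
        rw [Submodule.coe_add, h]
        simp [mul_add]
      map_smul' := by
        intro c u
        refine Eq.trans ?_ (MemLp.toLp_const_smul c u.2)
        refine (MemLp.toLp_eq_toLp_iff _ _).2 ?_
        filter_upwards [Lp.coeFn_smul c (u : g.L2)] with ω h
        rw [Submodule.coe_smul, h]
        simp only [Pi.smul_apply, smul_eq_mul]
        ring }

/-- The projection `q ↦ (q, P₀) P₀`. Mathlib's inner product is conjugate-linear in the first
argument, so `(q₁, q₂) = ∫ q₁ conj(q₂) g dω` is `inner ℂ q₂ q₁`. -/
def projOp (g : FrequencyDensity) : g.L2 →L[ℂ] g.L2 :=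
  (innerSL ℂ (P0 g)).smulRight (P0 g)

/-- The operator `T₁ = i M + i K f₁ P` with domain `D(M)`. -/
def T1 (g : FrequencyDensity) (K : ℝ) (f₁ : ℂ) : g.L2 →ₗ.[ℂ] g.L2 where
  domain := (mulOp g).domain
  toFun := I • (mulOp g).toFun +
    (I * K * f₁) • ((projOp g : g.L2 →ₗ[ℂ] g.L2) ∘ₗ (mulOp g).domain.subtype)

/-! ### Semigroups and spectra of unbounded operators -/

/-- `S` (restricted to `t ≥ 0`) is the strongly continuous semigroup with infinitesimal
generator `T`, that is `S t = e^{Tt}`. -/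
structure IsSemigroupGeneratedBy {H : Type*} [NormedAddCommGroup H] [NormedSpace ℂ H]
    (S : ℝ → H →L[ℂ] H) (T : H →ₗ.[ℂ] H) : Prop where
  map_zero : S 0 = ContinuousLinearMap.id ℂ H
  map_add : ∀ s t : ℝ, 0 ≤ s → 0 ≤ t → S (s + t) = (S s).comp (S t)
  continuousOn : ∀ u : H, ContinuousOn (fun t => S t u) (Set.Ici 0)
  generator : ∀ u v : H, (u, v) ∈ T.graph ↔
    Tendsto (fun t : ℝ => ((t⁻¹ : ℝ) : ℂ) • (S t u - u)) (𝓝[>] 0) (𝓝 v)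

/-- The resolvent set: `z - T` is a bijection from the domain of `T` onto the whole space, with
bounded inverse `R`. -/
def resolventSet {H : Type*} [NormedAddCommGroup H] [NormedSpace ℂ H] (T : H →ₗ.[ℂ] H) : Set ℂ :=
  {z | ∃ R : H →L[ℂ] H,
    (∀ u : H, ∃ h : R u ∈ T.domain, z • R u - T ⟨R u, h⟩ = u) ∧
    ∀ u : T.domain, R (z • (u : H) - T u) = u}

/-- The spectrum of an unbounded operator. -/
def opSpectrum {H : Type*} [NormedAddCommGroup H] [NormedSpace ℂ H] (T : H →ₗ.[ℂ] H) : Set ℂ :=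
  (resolventSet T)ᶜ

/-! ### The transition point -/

/-- `y` solves the equation
`lim_{x → +0} ∫ (ω - y) / (x² + (ω - y)²) g(ω) dω = π (Re f₁ / Im f₁) g(y)`. -/
def IsCriticalFrequency (g : FrequencyDensity) (f₁ : ℂ) (y : ℝ) : Prop :=
  Tendsto (fun x : ℝ => ∫ ω, (ω - y) / (x ^ 2 + (ω - y) ^ 2) * g.dens ω) (𝓝[>] 0)
    (𝓝 (Real.pi * f₁.re / f₁.im * g.dens y))

/-- The transition point: the infimum of `-Im f₁ / (π |f₁|² g(y))` over the critical frequencies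
`y`; it is `∞` if there is no `y` with `g(y) > 0` among them. -/
def transitionPoint (g : FrequencyDensity) (f₁ : ℂ) : ENNReal :=
  ⨅ (y : ℝ) (_ : IsCriticalFrequency g f₁ y),
    ENNReal.ofReal (-f₁.im) / ENNReal.ofReal (Real.pi * ‖f₁‖ ^ 2 * g.dens y)

/-! ### Continuation of the resolvent matrix element -/

/-- `((z - iM)⁻¹ q, P₀) = ∫ q(ω) g(ω) / (z - iω) dω`. -/
def resolventM (g : FrequencyDensity) (q : ℝ → ℂ) (z : ℂ) : ℂ :=
  ∫ ω : ℝ, 1 / (z - I * ω) * q ω * g.dens ω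

/-- `D(z) = ((z - iM)⁻¹ P₀, P₀)`. -/
def dispersion (g : FrequencyDensity) (z : ℂ) : ℂ := resolventM g (fun _ => 1) z

/-- `F₁`: on the right half-plane it is `((z - T₁)⁻¹ q, P₀)`, and on the left half-plane it is the
meromorphic continuation of that function through the imaginary axis, where `gs` and `qs` are the
continuations of `g` and `q` to the upper half-plane. The values on the imaginary axis and at
the singularities of `gs (-i z)` carry no meaning and are never used. -/
def F1 (g : FrequencyDensity) (gs : ℂ → ℂ) (q : ℝ → ℂ) (qs : ℂ → ℂ) (K : ℝ) (f₁ : ℂ) (z : ℂ) : ℂ :=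
  if 0 < z.re then
    resolventM g q z / (1 - I * K * f₁ * dispersion g z)
  else
    (resolventM g q z + 2 * Real.pi * qs (-I * z) * gs (-I * z)) /
      (1 - I * K * f₁ * dispersion g z - 2 * Real.pi * I * K * f₁ * gs (-I * z))

/-- The points at which the formula for `F₁` may be read literally. -/
def IsRegularPoint (gs : ℂ → ℂ) (z : ℂ) : Prop :=
  0 < z.re ∨ (z.re < 0 ∧ AnalyticAt ℂ gs (-I * z))

/-- `gs` is a meromorphic continuation of `g` from the real line to the upper half-plane. -/
structure IsMeromorphicContinuation (g : ℝ → ℝ) (gs : ℂ → ℂ) : Prop where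
  eq_on_real : ∀ x : ℝ, gs x = g x
  analyticAt_real : ∀ x : ℝ, AnalyticAt ℂ gs x
  meromorphic : MeromorphicOn gs {z | 0 < z.im}

/-- `qs` is an analytic continuation of `q` from the real line to the upper half-plane. -/
structure IsAnalyticContinuation (q : ℝ → ℂ) (qs : ℂ → ℂ) : Prop where
  eq_on_real : ∀ x : ℝ, qs x = q x
  analytic : AnalyticOnNhd ℂ qs {z | 0 ≤ z.im}

/-- `F(z) → 0` as `|z| → ∞` in the sectors of half-angle `δ` about the two imaginary half-axes. -/
def DecaysNearImaginaryAxis (F : ℂ → ℂ) (gs : ℂ → ℂ) (δ : ℝ) : Prop :=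
  ∀ ε > 0, ∃ R > 0, ∀ ρ θ : ℝ, R ≤ ρ →
    (|θ - Real.pi / 2| ≤ δ ∨ |θ - 3 * Real.pi / 2| ≤ δ) →
    IsRegularPoint gs (ρ * exp (I * θ)) → ‖F (ρ * exp (I * θ))‖ < ε

/-- `|F(z)| ≤ A e^{β|z|}` on the arcs `|z| = r k`, `π/2 + δ ≤ arg z ≤ 3π/2 - δ`. -/
def ExpBoundOnArcs (F : ℂ → ℂ) (gs : ℂ → ℂ) (δ A β : ℝ) (r : ℕ → ℝ) : Prop :=
  ∀ (k : ℕ) (θ : ℝ), Real.pi / 2 + δ ≤ θ → θ ≤ 3 * Real.pi / 2 - δ →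
    IsRegularPoint gs (r k * exp (I * θ)) →
    ‖F (r k * exp (I * θ))‖ ≤ A * Real.exp (β * r k)

/-- Resonance poles: the poles of `F₁` on the left half-plane. -/
def resonancePoles (g : FrequencyDensity) (gs : ℂ → ℂ) (q : ℝ → ℂ) (qs : ℂ → ℂ) (K : ℝ) (f₁ : ℂ) :
    Set ℂ :=
  {α | α.re < 0 ∧ meromorphicOrderAt (F1 g gs q qs K f₁) α < 0}

/-- The order parameter `(e^{T₁t} q, P₀)`, with `S t = e^{T₁t}`. -/
def orderParameter (g : FrequencyDensity) (S : ℝ → g.L2 →L[ℂ] g.L2) (u : g.L2) (t : ℝ) : ℂ :=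
  inner ℂ (P0 g) (S t u)

end Kuramoto

end

/-! Write φ(t) = (e^{T₁t}q, P₀) and w = 1/(iKf₁). Since T₁ is a rank-one perturbation of iM, its
resolvent is explicit, and the Laplace transform of φ is Q/(1 - iKf₁D) far to the right. The theorem
follows from where the continuation F of this quotient (`F1NF`) is singular and how large it is.

Continuation: a Cauchy transform ∫ n(ω)/(z - iω) dω of a density n analytic on the real line passes
through the imaginary axis, because a piece of the line can be pushed away from the pole ω = -iz. On
the left the deformation leaves the residue 2πn(-iz). Hence F is meromorphic in the plane.

No singularity with Re z ≥ 0 (`cauchyExt_ne`): suppose D takes the value w there. Among the points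
of a suitable compact rectangle where D/w is real and at least 1, take one with D/w maximal. If it
is interior, the open mapping theorem produces a larger value, a contradiction. It cannot lie on the
imaginary axis: the boundary value of Re D is πg(y), so D = τw with τ ≥ 1 makes y a critical
frequency and gives K_c ≤ K/τ ≤ K. It cannot lie on the far vertical side, where |D| ≤ 1/Re z. For
the horizontal sides no decay of g is available. There Re D is a Poisson integral, and a Vitali
covering argument shows that the heights at which it is ever large form a set of finite measure; the
sides are put at good heights (`exists_dispersion_re_lt`).

Inversion: smallness of F near the imaginary axis and |D| ≤ 1/Re z make F holomorphic and bounded to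
the right of a bent contour y ↦ -max(γ, κ|y|) + iy. Along it e^{zt} decays exponentially for t > 0,
so (2πi)⁻¹∫ e^{zt}F(z) dz converges although F is merely bounded; it is O(e^{-γt}) for t ≥ 1 and
holomorphic for t in a sector. It equals φ (`IsContourFor.eq_invLaplace`): after multiplication by 1
- e^{-t}, which tames the behaviour at t = 0, both functions have the Laplace transform F(l) - F(l +
1), and Fourier inversion gives uniqueness. This proves the decay.

Expansion: the part of the bend inside |z| = r_k is closed by a left arc, where |e^{zt}F| is at most
a constant times e^{(β - t sin η)r_k}. For t > β/sin η the arcs disappear in the limit and the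
residue theorem gives the sum over the poles (`resonance_expansion`). Without poles φ vanishes for
large t, hence by analyticity in t for every t > 0, and at t = 0 by continuity.

The semigroup comes from a Dyson series in the interaction picture (`exists_perturbed_group`), and
the spectral statement from the resolvent formula (`exists_resolvent`). A resonance pole cannot come
from a pole of g*, since this occurs in both numerator and denominator of F and cancels; so it comes
from a zero of the denominator. -/

noncomputable section

namespace Kuramoto

/-! ### Primitives on star-shaped domains -/

/-- A holomorphic function on a star-shaped open set has a primitive. -/
theorem exists_primitive_of_starConvex {U : Set ℂ} (hU : IsOpen U) {c : ℂ}
    (hs : StarConvex ℝ c U) {f : ℂ → ℂ} (hf : DifferentiableOn ℂ f U) :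
    ∃ P : ℂ → ℂ, ∀ z ∈ U, HasDerivAt P (f z) z := by
  refine ⟨fun z => ∫ s in (0 : ℝ)..1, (z - c) * f (c + s * (z - c)), fun z₀ hz₀ => ?_⟩
  have hmem : ∀ z ∈ U, ∀ s ∈ Set.Icc (0 : ℝ) 1, c + s * (z - c) ∈ U := by
    intro z hz s hs'
    have := hs hz (a := 1 - s) (b := s) (by linarith [hs'.2]) hs'.1 (by ring)
    convert this using 1
    simp only [real_smul]
    push_cast
    ring
  have hseg : IsCompact ((fun s : ℝ => c + s * (z₀ - c)) '' Set.Icc (0 : ℝ) 1) :=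
    isCompact_Icc.image (by fun_prop)
  obtain ⟨ε, hε, hεU⟩ := hseg.exists_cthickening_subset_open hU
    (by rintro _ ⟨s, hs', rfl⟩; exact hmem z₀ hz₀ s hs')
  have hin : ∀ s ∈ Set.Icc (0 : ℝ) 1, ∀ z ∈ Metric.closedBall z₀ ε, c + s * (z - c) ∈ U := by
    intro s hs' z hz
    apply hεU
    refine Metric.mem_cthickening_of_dist_le _ (c + s * (z₀ - c)) _ _ ⟨s, hs', rfl⟩ ?_
    rw [Metric.mem_closedBall, dist_eq_norm] at hz
    rw [dist_eq_norm]
    have h1 : c + s * (z - c) - (c + s * (z₀ - c)) = s * (z - z₀) := by ring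
    rw [h1, norm_mul, norm_real, Real.norm_of_nonneg hs'.1]
    calc s * ‖z - z₀‖ ≤ 1 * ‖z - z₀‖ := by gcongr; exact hs'.2
      _ ≤ ε := by linarith
  have hf' : DifferentiableOn ℂ (deriv f) U := hf.deriv hU
  have hfat : ∀ w ∈ U, HasDerivAt f (deriv f w) w := fun w hw =>
    (hf.differentiableAt (hU.mem_nhds hw)).hasDerivAt
  set F' : ℂ → ℝ → ℂ := fun z s =>
    f (c + s * (z - c)) + (z - c) * (s * deriv f (c + s * (z - c))) with hF'
  have hcont : ContinuousOn (fun p : ℂ × ℝ => F' p.1 p.2)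
      (Metric.closedBall z₀ ε ×ˢ Set.Icc (0 : ℝ) 1) := by
    have hm : Set.MapsTo (fun p : ℂ × ℝ => c + p.2 * (p.1 - c))
        (Metric.closedBall z₀ ε ×ˢ Set.Icc (0 : ℝ) 1) U := fun p hp => hin _ hp.2 _ hp.1
    have hc : ContinuousOn (fun p : ℂ × ℝ => c + p.2 * (p.1 - c))
        (Metric.closedBall z₀ ε ×ˢ Set.Icc (0 : ℝ) 1) := by fun_prop
    have h1 := hf.continuousOn.comp hc hm
    have h2 := hf'.continuousOn.comp hc hm
    refine h1.add (ContinuousOn.mul (by fun_prop) (ContinuousOn.mul (by fun_prop) h2))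
  obtain ⟨C, hC⟩ := ((isCompact_closedBall z₀ ε).prod isCompact_Icc).exists_bound_of_continuousOn
    hcont
  have hz₀b : z₀ ∈ Metric.closedBall z₀ ε := Metric.mem_closedBall_self hε.le
  have hcz : ∀ z ∈ Metric.closedBall z₀ ε,
      ContinuousOn (fun s : ℝ => (z - c) * f (c + s * (z - c))) (Set.Icc 0 1) := by
    intro z hz
    exact ContinuousOn.mul (by fun_prop) (hf.continuousOn.comp (by fun_prop) fun s hs' => hin s hs' z hz)
  have hcz' : ContinuousOn (F' z₀) (Set.Icc 0 1) :=
    hcont.comp (f := fun s : ℝ => (z₀, s)) (by fun_prop) fun s hs' => ⟨hz₀b, hs'⟩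
  have hI : Set.uIoc (0 : ℝ) 1 ⊆ Set.Icc 0 1 := by
    rw [Set.uIoc_of_le zero_le_one]; exact Set.Ioc_subset_Icc_self
  have key := intervalIntegral.hasDerivAt_integral_of_dominated_loc_of_deriv_le (μ := volume)
    (a := (0 : ℝ)) (b := 1) (F := fun z (s : ℝ) => (z - c) * f (c + s * (z - c))) (F' := F')
    (x₀ := z₀) (s := Metric.closedBall z₀ ε) (bound := fun _ => C) (Metric.closedBall_mem_nhds z₀ hε)
    (by
      filter_upwards [Metric.closedBall_mem_nhds z₀ hε] with z hz
      exact ((hcz z hz).mono hI).aestronglyMeasurable measurableSet_uIoc)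
    (by
      apply ContinuousOn.intervalIntegrable
      rw [Set.uIcc_of_le zero_le_one]; exact hcz z₀ hz₀b)
    ((hcz'.mono hI).aestronglyMeasurable measurableSet_uIoc)
    (by
      refine Eventually.of_forall fun s hs' z hz => hC (z, s) ⟨hz, hI hs'⟩)
    intervalIntegrable_const
    (by
      refine Eventually.of_forall fun s hs' z hz => ?_
      have h1 : HasDerivAt (fun z : ℂ => c + s * (z - c)) s z := by
        simpa using (((hasDerivAt_id z).sub_const c).const_mul (s : ℂ)).const_add c
      have h2 := (hfat _ (hin s (hI hs') z hz)).comp z h1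
      have h3 := ((hasDerivAt_id z).sub_const c).mul h2
      refine h3.congr_deriv ?_
      simp only [hF', id, Function.comp_def, one_mul]
      ring)
  refine key.2.congr_deriv ?_
  -- Differentiating under the integral produces exactly the s-derivative of s f(c + s(z₀ - c)), so
  -- the integral telescopes to f(z₀).
  have hd : ∀ s ∈ Set.uIcc (0 : ℝ) 1,
      HasDerivAt (fun s : ℝ => (s : ℂ) * f (c + s * (z₀ - c))) (F' z₀ s) s := by
    intro s hs'
    rw [Set.uIcc_of_le zero_le_one] at hs'
    have h1 : HasDerivAt (fun s : ℝ => c + s * (z₀ - c)) (z₀ - c) s := by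
      simpa using ((ofRealCLM.hasDerivAt (x := s)).mul_const (z₀ - c)).const_add c
    have h2 := (hfat _ (hmem z₀ hz₀ s hs')).comp_of_eq s h1 rfl
    have h3 := (ofRealCLM.hasDerivAt (x := s)).mul h2
    refine h3.congr_deriv ?_
    simp only [hF', Function.comp_def, ofRealCLM_apply, ofReal_one, one_mul]
    ring
  rw [intervalIntegral.integral_eq_sub_of_hasDerivAt hd]
  · simp
  · apply ContinuousOn.intervalIntegrable
    rwa [Set.uIcc_of_le zero_le_one]

/-- The fundamental theorem of calculus along a piecewise differentiable curve. -/
theorem integral_comp_curve {P f : ℂ → ℂ} {U : Set ℂ} (hP : ∀ z ∈ U, HasDerivAt P (f z) z)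
    {γ γ' : ℝ → ℂ} {a b : ℝ} {s : Set ℝ} (hs : s.Countable) (hγ : ContinuousOn γ (Set.uIcc a b))
    (hγU : ∀ x ∈ Set.uIcc a b, γ x ∈ U) (hγ' : ∀ x, x ∉ s → HasDerivAt γ (γ' x) x)
    (hi : IntervalIntegrable (fun x => γ' x * f (γ x)) volume a b) :
    ∫ x in a..b, γ' x * f (γ x) = P (γ b) - P (γ a) := by
  refine integral_eq_of_hasDerivAt_off_countable (fun x => P (γ x)) _ hs ?_ ?_ hi
  · intro x hx
    exact (hP _ (hγU x hx)).continuousAt.comp_continuousWithinAt (hγ x hx)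
  · intro x hx
    have h := (hP _ (hγU x (Set.Ioo_subset_Icc_self hx.1))).comp_of_eq x (hγ' x hx.2) rfl
    exact h.congr_deriv (by ring)

/-! ### A contour bent into the left half-plane -/

/-- The curve `y ↦ -max(γ, κ|y|) + iy`. -/
def bend (γ κ : ℝ) (y : ℝ) : ℂ := -((max γ (κ * |y|) : ℝ) : ℂ) + y * I

/-- The derivative of `bend γ κ` away from its corners. -/
def bendDeriv (γ κ : ℝ) (y : ℝ) : ℂ := I - if γ < κ * |y| then ((κ * SignType.sign y : ℝ) : ℂ) else 0

/-- The open region to the right of `bend γ κ`. -/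
def bendRegion (γ κ : ℝ) : Set ℂ := {z | -max γ (κ * |z.im|) < z.re}

@[simp] theorem bend_re (γ κ y : ℝ) : (bend γ κ y).re = -max γ (κ * |y|) := by
  simp [bend]

@[simp] theorem bend_im (γ κ y : ℝ) : (bend γ κ y).im = y := by
  simp [bend]

theorem continuous_bend (γ κ : ℝ) : Continuous (bend γ κ) := by
  unfold bend; fun_prop

theorem measurable_bendDeriv (γ κ : ℝ) : Measurable (bendDeriv γ κ) := by
  unfold bendDeriv
  refine measurable_const.sub (Measurable.ite ?_ ?_ measurable_const)
  · exact measurableSet_lt measurable_const (by fun_prop)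
  · have : Measurable (fun y : ℝ => ((SignType.sign y : SignType) : ℝ)) := by
      have h : (fun y : ℝ => ((SignType.sign y : SignType) : ℝ)) =
          fun y => if 0 < y then 1 else if y < 0 then -1 else 0 := by
        funext y
        rcases lt_trichotomy y 0 with h | h | h
        · simp [h, not_lt.2 h.le]
        · simp [h]
        · simp [h]
      rw [h]
      exact Measurable.ite measurableSet_Ioi measurable_const
        (Measurable.ite measurableSet_Iio measurable_const measurable_const)
    fun_prop

theorem norm_bendDeriv_le {γ κ : ℝ} (hκ : 0 ≤ κ) (y : ℝ) : ‖bendDeriv γ κ y‖ ≤ 1 + κ := by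
  unfold bendDeriv
  refine (norm_sub_le _ _).trans ?_
  rw [norm_I]
  gcongr
  split_ifs
  · rw [norm_real, norm_mul, Real.norm_of_nonneg hκ]
    have : ‖((SignType.sign y : SignType) : ℝ)‖ ≤ 1 := by
      rcases lt_trichotomy y 0 with h | h | h <;> simp [h]
    nlinarith
  · simpa using hκ

/-- The excluded points are the two corners of the bend. A countable exceptional set is harmless for
`integral_comp_curve`. -/
theorem hasDerivAt_bend {γ κ : ℝ} (hγ : 0 < γ) (hκ : 0 < κ) {y : ℝ}
    (hy : y ∉ ({γ / κ, -(γ / κ)} : Set ℝ)) : HasDerivAt (bend γ κ) (bendDeriv γ κ y) y := by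
  have hI : HasDerivAt (fun y : ℝ => (y : ℂ) * I) I y := by
    simpa using (ofRealCLM.hasDerivAt (x := y)).mul_const I
  have hne : κ * |y| ≠ γ := by
    intro h
    apply hy
    have h1 : |y| = γ / κ := by field_simp; linarith
    rcases abs_choice y with h2 | h2
    · left; linarith
    · right; rw [Set.mem_singleton_iff]; linarith
  rcases lt_or_gt_of_ne hne with h | h
  · have he : bend γ κ =ᶠ[𝓝 y] fun y => -(γ : ℂ) + y * I := by
      have : ∀ᶠ x in 𝓝 y, κ * |x| < γ :=
        (by fun_prop : Continuous fun x : ℝ => κ * |x|).continuousAt.eventually_lt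
          continuousAt_const h
      filter_upwards [this] with x hx
      rw [bend, max_eq_left hx.le]
    refine HasDerivAt.congr_of_eventuallyEq ?_ he
    rw [bendDeriv, if_neg (not_lt.2 h.le), sub_zero]
    exact hI.const_add _
  · have he : bend γ κ =ᶠ[𝓝 y] fun y => -((κ * |y| : ℝ) : ℂ) + y * I := by
      have : ∀ᶠ x in 𝓝 y, γ < κ * |x| :=
        continuousAt_const.eventually_lt
          (by fun_prop : Continuous fun x : ℝ => κ * |x|).continuousAt h
      filter_upwards [this] with x hx
      rw [bend, max_eq_right hx.le]
    refine HasDerivAt.congr_of_eventuallyEq ?_ he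
    rw [bendDeriv, if_pos h]
    have hy0 : y ≠ 0 := by rintro rfl; simp at h; linarith
    have h1 := ((hasDerivAt_abs hy0).const_mul κ).ofReal_comp
    exact (h1.neg.add hI).congr_deriv (by ring)

theorem isOpen_bendRegion (γ κ : ℝ) : IsOpen (bendRegion γ κ) :=
  isOpen_lt (by fun_prop) (by fun_prop)

/-- The region is not convex, being the complement of a convex set. But shrinking a point towards 0
scales Re z and κ|Im z| alike while γ stays fixed, so star-shapedness holds, and that is enough for
a primitive. -/
theorem starConvex_bendRegion {γ κ : ℝ} (hγ : 0 < γ) : StarConvex ℝ 0 (bendRegion γ κ) := by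
  rw [starConvex_zero_iff]
  intro z hz a ha0 ha1
  simp only [bendRegion, Set.mem_ofPred_eq, real_smul, mul_re, ofReal_re, ofReal_im, zero_mul,
    sub_zero, mul_im, add_zero, abs_mul, abs_of_nonneg ha0] at hz ⊢
  rcases ha0.eq_or_lt with rfl | ha
  · simp [hγ]
  have h1 : a * max γ (κ * |z.im|) ≤ max γ (κ * (a * |z.im|)) := by
    rw [mul_max_of_nonneg _ _ ha0]
    refine max_le_max ?_ (by linarith)
    nlinarith
  nlinarith

/-- Strictly larger parameters leave room around the closed region: the bend itself and the arcs to
its right lie inside an open set where F is holomorphic. -/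
theorem mem_bendRegion_of_le {γ κ γ' κ' : ℝ} (hγ : γ < γ') (hγ0 : 0 < γ) (hκ : κ < κ')
    {z : ℂ} (hz : -max γ (κ * |z.im|) ≤ z.re) : z ∈ bendRegion γ' κ' := by
  refine lt_of_lt_of_le ?_ hz
  rw [neg_lt_neg_iff, max_lt_iff]
  refine ⟨lt_max_of_lt_left hγ, ?_⟩
  rcases eq_or_ne z.im 0 with h | h
  · rw [h]; simp only [abs_zero, mul_zero]; exact lt_max_of_lt_left (hγ0.trans hγ)
  · exact lt_max_of_lt_right (mul_lt_mul_of_pos_right hκ (abs_pos.2 h))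

theorem bend_mem_bendRegion {γ κ γ' κ' : ℝ} (hγ : γ < γ') (hγ0 : 0 < γ) (hκ : κ < κ') (y : ℝ) :
    bend γ κ y ∈ bendRegion γ' κ' :=
  mem_bendRegion_of_le hγ hγ0 hκ (by simp)

theorem mem_bendRegion_of_re_nonneg {γ κ : ℝ} (hγ : 0 < γ) {z : ℂ} (hz : 0 ≤ z.re) :
    z ∈ bendRegion γ κ :=
  lt_of_lt_of_le (neg_lt_zero.2 (lt_max_of_lt_left hγ)) hz

/-! ### Arcs of circles about the origin -/

theorem circleMap_zero_re (R θ : ℝ) : (circleMap 0 R θ).re = R * Real.cos θ := by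
  simp [circleMap, exp_ofReal_mul_I_re, exp_ofReal_mul_I_im]

theorem circleMap_zero_im (R θ : ℝ) : (circleMap 0 R θ).im = R * Real.sin θ := by
  simp [circleMap, exp_ofReal_mul_I_re, exp_ofReal_mul_I_im]

/-- Points of the right arc, of half-angle `π/2 + η`, lie on the right of the bent contour. -/
theorem le_re_circleMap {R η θ : ℝ} (hR : 0 ≤ R) (hη : 0 < η) (hη' : η < Real.pi / 2)
    (hθ : |θ| ≤ Real.pi / 2 + η) :
    -(Real.tan η * |(circleMap 0 R θ).im|) ≤ (circleMap 0 R θ).re := by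
  rw [circleMap_zero_re, circleMap_zero_im, abs_mul, abs_of_nonneg hR]
  have hc : 0 < Real.cos η := Real.cos_pos_of_mem_Ioo ⟨by linarith, hη'⟩
  have hs : 0 < Real.sin η := Real.sin_pos_of_pos_of_lt_pi hη (by linarith)
  -- This is cos(|θ| - η) ≥ 0 expanded; |θ| - η lies in [-η, π/2].
  have key : -(Real.sin η * |Real.sin θ|) ≤ Real.cos η * Real.cos θ := by
    have h0 : Real.cos θ = Real.cos |θ| := (Real.cos_abs θ).symm
    have h1 : |Real.sin θ| = abs (Real.sin |θ|) := by
      rcases abs_choice θ with h | h <;> simp [h]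
    rw [h0, h1]
    set a := |θ| with ha
    have ha0 : 0 ≤ a := abs_nonneg θ
    have hapi : a ≤ Real.pi := by linarith
    have hsa : 0 ≤ Real.sin a := Real.sin_nonneg_of_nonneg_of_le_pi ha0 hapi
    rw [abs_of_nonneg hsa]
    have h2 : 0 ≤ Real.cos (a - η) :=
      Real.cos_nonneg_of_mem_Icc ⟨by linarith, by linarith⟩
    rw [Real.cos_sub] at h2
    linarith
  have h3 : Real.tan η * Real.cos η = Real.sin η := by
    rw [Real.tan_eq_sin_div_cos]; field_simp
  have h4 : 0 ≤ Real.cos η * (Real.cos θ + Real.tan η * |Real.sin θ|) := by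
    have : Real.cos η * (Real.cos θ + Real.tan η * |Real.sin θ|)
      = Real.cos η * Real.cos θ + (Real.tan η * Real.cos η) * |Real.sin θ| := by ring
    rw [this, h3]; linarith
  have h5 : 0 ≤ Real.cos θ + Real.tan η * |Real.sin θ| := nonneg_of_mul_nonneg_right h4 hc
  nlinarith

/-- Points of the left arc lie on the left of the bent contour. -/
theorem re_circleMap_le {R η θ : ℝ} (hR : 0 ≤ R) (hη : 0 < η) (hη' : η < Real.pi / 2)
    (hθ : Real.pi / 2 + η ≤ θ) (hθ' : θ ≤ 3 * Real.pi / 2 - η) :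
    (circleMap 0 R θ).re ≤ -(Real.tan η * |(circleMap 0 R θ).im|) ∧
      (circleMap 0 R θ).re ≤ -(R * Real.sin η) := by
  rw [circleMap_zero_re, circleMap_zero_im, abs_mul, abs_of_nonneg hR]
  have hc : 0 < Real.cos η := Real.cos_pos_of_mem_Ioo ⟨by linarith, hη'⟩
  have hpi := Real.pi_pos
  set a := θ - Real.pi with ha
  have hθa : θ = a + Real.pi := by rw [ha]; ring
  rw [hθa, Real.cos_add_pi, Real.sin_add_pi, abs_neg]
  have hal : |a| ≤ Real.pi / 2 - η := abs_le.2 ⟨by linarith, by linarith⟩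
  have h0 : Real.cos a = Real.cos |a| := (Real.cos_abs a).symm
  have h1 : |Real.sin a| = abs (Real.sin |a|) := by
    rcases abs_choice a with h | h <;> simp [h]
  rw [h0, h1]
  set b := |a| with hb
  have hb0 : 0 ≤ b := abs_nonneg a
  have hsb : 0 ≤ Real.sin b := Real.sin_nonneg_of_nonneg_of_le_pi hb0 (by linarith)
  rw [abs_of_nonneg hsb]
  have h3 : Real.tan η * Real.cos η = Real.sin η := by
    rw [Real.tan_eq_sin_div_cos]; field_simp
  constructor
  -- With b = |θ - π| ≤ π/2 - η, the first bound is cos(b + η) ≥ 0 expanded, and the second is cos b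
  -- ≥ cos(π/2 - η) = sin η.
  · have h2 : 0 ≤ Real.cos (b + η) :=
      Real.cos_nonneg_of_mem_Icc ⟨by linarith, by linarith⟩
    rw [Real.cos_add] at h2
    have h4 : 0 ≤ Real.cos η * (Real.cos b - Real.tan η * Real.sin b) := by
      have : Real.cos η * (Real.cos b - Real.tan η * Real.sin b)
        = Real.cos η * Real.cos b - (Real.tan η * Real.cos η) * Real.sin b := by ring
      rw [this, h3]; linarith
    have h5 := nonneg_of_mul_nonneg_right h4 hc
    nlinarith
  · have h2 : Real.sin η ≤ Real.cos b := by
      rw [← Real.cos_pi_div_two_sub]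
      exact Real.cos_le_cos_of_nonneg_of_le_pi hb0 (by linarith) hal
    nlinarith

/-- The end point of the part of the bent contour within the disk of radius `R`. -/
theorem bend_eq_circleMap {γ R η : ℝ} (hR : 0 < R) (hη : 0 < η) (hη' : η < Real.pi / 2)
    (hγ : γ ≤ R * Real.sin η) :
    bend γ (Real.tan η) (R * Real.cos η) = circleMap 0 R (Real.pi / 2 + η) ∧
    bend γ (Real.tan η) (-(R * Real.cos η)) = circleMap 0 R (-(Real.pi / 2 + η)) := by
  have hc : 0 < Real.cos η := Real.cos_pos_of_mem_Ioo ⟨by linarith, hη'⟩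
  have h3 : Real.tan η * (R * Real.cos η) = R * Real.sin η := by
    rw [Real.tan_eq_sin_div_cos]; field_simp
  have h4 : Real.cos (Real.pi / 2 + η) = - Real.sin η := by
    rw [add_comm]; exact Real.cos_add_pi_div_two η
  have h5 : Real.sin (Real.pi / 2 + η) = Real.cos η := by
    rw [add_comm]; exact Real.sin_add_pi_div_two η
  constructor <;> apply Complex.ext
  · rw [bend_re, circleMap_zero_re, abs_of_pos (by positivity), h3, max_eq_right hγ, h4]; ring
  · rw [bend_im, circleMap_zero_im, h5]
  · rw [bend_re, circleMap_zero_re, abs_neg, abs_of_pos (by positivity), h3, max_eq_right hγ,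
      Real.cos_neg, h4]; ring
  · rw [bend_im, circleMap_zero_im, Real.sin_neg, h5]; ring

/-! ### Integrals along the bend and along arcs, and their deformation -/

/-- The integral over the part of the bent contour inside a disk. -/
def bendIntegral (γ κ Y : ℝ) (f : ℂ → ℂ) : ℂ := ∫ y in (-Y)..Y, bendDeriv γ κ y * f (bend γ κ y)

/-- The integral over an arc of the circle of radius `R` about the origin. -/
def arcIntegral (R a b : ℝ) (f : ℂ → ℂ) : ℂ :=
  ∫ θ in a..b, deriv (circleMap 0 R) θ * f (circleMap 0 R θ)

theorem intervalIntegrable_bend {γ κ : ℝ} (hκ : 0 ≤ κ) {f : ℂ → ℂ} {a b : ℝ}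
    (hf : ContinuousOn (fun y => f (bend γ κ y)) (Set.uIcc a b)) :
    IntervalIntegrable (fun y => bendDeriv γ κ y * f (bend γ κ y)) volume a b := by
  rw [intervalIntegrable_iff]
  have h1 : IntegrableOn (fun y => f (bend γ κ y)) (Set.uIoc a b) := by
    rw [← intervalIntegrable_iff]; exact hf.intervalIntegrable
  exact Integrable.bdd_mul (c := 1 + κ) h1 (measurable_bendDeriv γ κ).aestronglyMeasurable
    (Eventually.of_forall fun y => norm_bendDeriv_le hκ y)

theorem intervalIntegrable_arc {R a b : ℝ} {f : ℂ → ℂ}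
    (hf : ContinuousOn (fun θ => f (circleMap 0 R θ)) (Set.uIcc a b)) :
    IntervalIntegrable (fun θ => deriv (circleMap 0 R) θ * f (circleMap 0 R θ)) volume a b := by
  refine ContinuousOn.intervalIntegrable (ContinuousOn.mul ?_ hf)
  rw [show deriv (circleMap 0 R) = fun θ => circleMap 0 R θ * I from
    funext fun θ => deriv_circleMap 0 R θ]
  fun_prop

theorem bendIntegral_of_hasDerivAt {γ κ Y : ℝ} (hγ : 0 < γ) (hκ : 0 < κ) {U : Set ℂ}
    {P f : ℂ → ℂ} (hP : ∀ z ∈ U, HasDerivAt P (f z) z) (hf : ContinuousOn f U)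
    (hU : ∀ y, bend γ κ y ∈ U) :
    bendIntegral γ κ Y f = P (bend γ κ Y) - P (bend γ κ (-Y)) :=
  integral_comp_curve hP (s := {γ / κ, -(γ / κ)}) (Set.toFinite _).countable
    (continuous_bend γ κ).continuousOn (fun x _ => hU x)
    (fun _ hx => hasDerivAt_bend hγ hκ hx)
    (intervalIntegrable_bend hκ.le (hf.comp (continuous_bend γ κ).continuousOn fun x _ => hU x))

theorem arcIntegral_of_hasDerivAt {R a b : ℝ} {U : Set ℂ}
    {P f : ℂ → ℂ} (hP : ∀ z ∈ U, HasDerivAt P (f z) z) (hf : ContinuousOn f U)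
    (hU : ∀ θ ∈ Set.uIcc a b, circleMap 0 R θ ∈ U) :
    arcIntegral R a b f = P (circleMap 0 R b) - P (circleMap 0 R a) :=
  integral_comp_curve hP (s := ∅) Set.countable_empty
    (continuous_circleMap 0 R).continuousOn hU
    (fun x _ => (differentiable_circleMap 0 R x).hasDerivAt)
    (intervalIntegrable_arc (hf.comp (continuous_circleMap 0 R).continuousOn hU))

/-- The two arcs together run from -(π/2 + η) to 3π/2 - η, an interval of length 2π, so periodicity
identifies them with the full circle. -/
theorem circleIntegral_eq_arcIntegral_add {R η : ℝ} {f : ℂ → ℂ}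
    (hf : ContinuousOn f (Metric.sphere 0 |R|)) :
    (∮ z in C(0, R), f z) = arcIntegral R (-(Real.pi / 2 + η)) (Real.pi / 2 + η) f +
      arcIntegral R (Real.pi / 2 + η) (3 * Real.pi / 2 - η) f := by
  have hc : ∀ a b : ℝ, ContinuousOn (fun θ => f (circleMap 0 R θ)) (Set.uIcc a b) := fun a b =>
    hf.comp (continuous_circleMap 0 R).continuousOn fun θ _ => circleMap_mem_sphere' 0 R θ
  rw [arcIntegral, arcIntegral, intervalIntegral.integral_add_adjacent_intervals
    (intervalIntegrable_arc (hc _ _)) (intervalIntegrable_arc (hc _ _))]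
  have hp : Function.Periodic (fun θ => deriv (circleMap 0 R) θ * f (circleMap 0 R θ))
      (2 * Real.pi) := by
    intro θ
    simp only [deriv_circleMap, periodic_circleMap 0 R θ]
  have h := hp.intervalIntegral_add_eq 0 (-(Real.pi / 2 + η))
  rw [zero_add] at h
  rw [circleIntegral]
  simp only [smul_eq_mul]
  rw [h]
  congr 1
  ring

/-- Deformation of the bent contour to an arc. -/
theorem bendIntegral_eq_arcIntegral {γ γ' κ' η R : ℝ} (hγ0 : 0 < γ) (hγ : γ < γ') (hη : 0 < η)
    (hη' : η < Real.pi / 2) (hκ : Real.tan η < κ') (hR : 0 < R) (hγR : γ ≤ R * Real.sin η)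
    {f : ℂ → ℂ} (hf : DifferentiableOn ℂ f (bendRegion γ' κ')) :
    bendIntegral γ (Real.tan η) (R * Real.cos η) f =
      arcIntegral R (-(Real.pi / 2 + η)) (Real.pi / 2 + η) f := by
  obtain ⟨P, hP⟩ := exists_primitive_of_starConvex (isOpen_bendRegion γ' κ')
    (starConvex_bendRegion (hγ0.trans hγ)) hf
  rw [bendIntegral_of_hasDerivAt hγ0 (Real.tan_pos_of_pos_of_lt_pi_div_two hη hη') hP
    hf.continuousOn (bend_mem_bendRegion hγ hγ0 hκ),
    arcIntegral_of_hasDerivAt hP hf.continuousOn]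
  · rw [(bend_eq_circleMap hR hη hη' hγR).1, (bend_eq_circleMap hR hη hη' hγR).2]
  · intro θ hθ
    rw [Set.uIcc_of_le (by linarith [Real.pi_pos])] at hθ
    refine mem_bendRegion_of_le hγ hγ0 hκ (le_trans ?_
      (le_re_circleMap hR.le hη hη' (abs_le.2 ⟨hθ.1, hθ.2⟩)))
    rw [neg_le_neg_iff]
    exact le_max_right _ _

theorem integrable_exp_neg_mul_abs {a : ℝ} (ha : 0 < a) :
    Integrable (fun y : ℝ => Real.exp (-(a * |y|))) := by
  have h1 : IntegrableOn (fun y : ℝ => Real.exp (-(a * |y|))) (Set.Ioi 0) := by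
    refine (integrableOn_exp_mul_Ioi (neg_lt_zero.2 ha) 0).congr_fun ?_ measurableSet_Ioi
    intro y hy
    simp only [abs_of_pos (Set.mem_Ioi.1 hy), neg_mul]
  have h2 : IntegrableOn (fun y : ℝ => Real.exp (-(a * |y|))) (Set.Iio 0) := by
    have h0 : IntegrableOn (fun y : ℝ => Real.exp (-(a * |y|))) (Set.Ioi (-(0 : ℝ))) := by
      rw [neg_zero]; exact h1
    simpa only [abs_neg] using h0.comp_neg_Iio
  have h3 : IntegrableOn (fun y : ℝ => Real.exp (-(a * |y|))) (Set.Iic 0) := by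
    rwa [integrableOn_Iic_iff_integrableOn_Iio]
  rw [← integrableOn_univ, ← Set.Iic_union_Ioi (a := (0 : ℝ))]
  exact h3.union h1

theorem integral_exp_neg_mul_abs {a : ℝ} (ha : 0 < a) :
    ∫ y : ℝ, Real.exp (-(a * |y|)) = 2 / a := by
  rw [integral_comp_abs (f := fun y => Real.exp (-(a * y)))]
  have := integral_exp_mul_Ioi (neg_lt_zero.2 ha) 0
  simp only [neg_mul, mul_zero, Real.exp_zero] at this
  rw [this]
  field_simp

/-! ### Cauchy's formula on the bent contour -/

/-- `F` is holomorphic in a neighbourhood of the closed region to the right of the bent contour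
with parameters `γ` and `tan η`, and bounded by `M` there. -/
structure IsContourFor (F : ℂ → ℂ) (γ η M : ℝ) : Prop where
  γ_pos : 0 < γ
  η_pos : 0 < η
  η_lt : η < Real.pi / 2
  diff : ∃ γ' > γ, ∃ κ' > Real.tan η, DifferentiableOn ℂ F (bendRegion γ' κ')
  bound : ∀ z : ℂ, -max γ (Real.tan η * |z.im|) ≤ z.re → ‖F z‖ ≤ M

namespace IsContourFor

variable {F : ℂ → ℂ} {γ η M : ℝ}

theorem tan_pos (h : IsContourFor F γ η M) : 0 < Real.tan η :=
  Real.tan_pos_of_pos_of_lt_pi_div_two h.η_pos h.η_lt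

theorem M_nonneg (h : IsContourFor F γ η M) : 0 ≤ M := by
  refine (norm_nonneg (F 0)).trans (h.bound 0 ?_)
  simp [h.γ_pos.le]

theorem norm_bend_le (h : IsContourFor F γ η M) (y : ℝ) : ‖F (bend γ (Real.tan η) y)‖ ≤ M :=
  h.bound _ (by simp)

theorem continuous_comp_bend (h : IsContourFor F γ η M) :
    Continuous fun y => F (bend γ (Real.tan η) y) := by
  obtain ⟨γ', hγ', κ', hκ', hd⟩ := h.diff
  exact hd.continuousOn.comp_continuous (continuous_bend _ _)
    (bend_mem_bendRegion hγ' h.γ_pos hκ')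

end IsContourFor

/-- The bent contour sees the points of the right half-plane with winding number one. -/
theorem bendIntegral_inv_sub {γ η R : ℝ} {l : ℂ} (hγ0 : 0 < γ) (hη : 0 < η)
    (hη' : η < Real.pi / 2) (hR : ‖l‖ < R) (hγR : γ ≤ R * Real.sin η) (hl : 0 ≤ l.re) :
    bendIntegral γ (Real.tan η) (R * Real.cos η) (fun z => (z - l)⁻¹) =
      arcIntegral R (-(Real.pi / 2 + η)) (Real.pi / 2 + η) (fun z => (z - l)⁻¹) -
        2 * Real.pi * I := by
  have hR0 : 0 < R := (norm_nonneg l).trans_lt hR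
  have hs : 0 < Real.sin η := Real.sin_pos_of_pos_of_lt_pi hη (by linarith [Real.pi_pos])
  have hne : ∀ z : ℂ, z.re < 0 → z - l ≠ 0 := by
    intro z hz h0
    rw [sub_eq_zero.1 h0] at hz
    linarith
  -- For Re z < 0 ≤ Re l the point l - z avoids the cut of the logarithm. The bend and the left arc
  -- both lie there, so their integrals cancel, and the winding number comes from the full circle.
  have hP : ∀ z ∈ {z : ℂ | z.re < 0}, HasDerivAt (fun z => log (l - z)) ((z - l)⁻¹) z := by
    intro z hz
    have h1 : HasDerivAt (fun z => l - z) (-1) z := by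
      simpa using (hasDerivAt_id z).const_sub l
    have h2 : l - z ∈ slitPlane := by
      left
      have : z.re < 0 := hz
      simp only [sub_re]; linarith
    refine (h1.clog h2).congr_deriv ?_
    have := hne z hz
    have h3 : l - z ≠ 0 := slitPlane_ne_zero h2
    field_simp
    ring
  have hc : ContinuousOn (fun z : ℂ => (z - l)⁻¹) {z : ℂ | z.re < 0} :=
    ContinuousOn.inv₀ (by fun_prop) hne
  have h1 := bendIntegral_of_hasDerivAt (Y := R * Real.cos η) hγ0
    (Real.tan_pos_of_pos_of_lt_pi_div_two hη hη') hP hc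
    (fun y => by
      change (bend γ (Real.tan η) y).re < 0
      rw [bend_re, neg_lt_zero]; exact lt_max_of_lt_left hγ0)
  have h2 := arcIntegral_of_hasDerivAt (R := R) (a := Real.pi / 2 + η)
    (b := 3 * Real.pi / 2 - η) hP hc (by
      intro θ hθ
      rw [Set.uIcc_of_le (by linarith)] at hθ
      refine (re_circleMap_le hR0.le hη hη' hθ.1 hθ.2).2.trans_lt ?_
      rw [neg_lt_zero]; positivity)
  have h3 := circleIntegral_eq_arcIntegral_add (R := R) (η := η) (f := fun z => (z - l)⁻¹) (by
    refine ContinuousOn.inv₀ (by fun_prop) fun z hz h0 => ?_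
    rw [sub_eq_zero.1 h0, mem_sphere_zero_iff_norm, abs_of_pos hR0] at hz
    linarith)
  rw [circleIntegral.integral_sub_inv_of_mem_ball (by simpa using hR)] at h3
  have he := bend_eq_circleMap hR0 hη hη' hγR
  have h4 : circleMap 0 R (3 * Real.pi / 2 - η) = circleMap 0 R (-(Real.pi / 2 + η)) := by
    rw [← periodic_circleMap 0 R (-(Real.pi / 2 + η))]
    congr 1; ring
  rw [h1, h3, h2, he.1, he.2, h4]
  ring

/-- Cauchy's formula on the bent contour for a difference of two values. -/
theorem IsContourFor.integral_cauchy {F : ℂ → ℂ} {γ η M : ℝ} (h : IsContourFor F γ η M) {l : ℂ}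
    (hl : 0 < l.re) :
    Integrable (fun y => bendDeriv γ (Real.tan η) y * (F (bend γ (Real.tan η) y) *
      ((bend γ (Real.tan η) y - l)⁻¹ - (bend γ (Real.tan η) y - (l + 1))⁻¹))) ∧
    ∫ y, bendDeriv γ (Real.tan η) y * (F (bend γ (Real.tan η) y) *
      ((bend γ (Real.tan η) y - l)⁻¹ - (bend γ (Real.tan η) y - (l + 1))⁻¹)) =
      -(2 * Real.pi * I) * (F l - F (l + 1)) := by
  have hγ0 := h.γ_pos
  have hη := h.η_pos
  have hη' := h.η_lt
  have hκ := h.tan_pos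
  have hM := h.M_nonneg
  have hl1 : 0 < (l + 1).re := by simp; linarith
  have hs : 0 < Real.sin η := Real.sin_pos_of_pos_of_lt_pi hη (by linarith [Real.pi_pos])
  have hcos : 0 < Real.cos η := Real.cos_pos_of_mem_Ioo ⟨by linarith, hη'⟩
  set κ := Real.tan η with hκd
  set k : ℂ → ℂ := fun z => (z - l)⁻¹ - (z - (l + 1))⁻¹ with hk
  have hbl : ∀ a : ℂ, 0 < a.re → ∀ y, bend γ κ y - a ≠ 0 := by
    intro a ha y h0
    have : (bend γ κ y).re = a.re := by rw [sub_eq_zero.1 h0]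
    rw [bend_re] at this
    have := le_max_left γ (κ * |y|)
    linarith
  -- The difference of two Cauchy kernels is a product and decays quadratically. Since F is only
  -- bounded, a single kernel would not give absolute convergence.
  have hkform : ∀ z : ℂ, z - l ≠ 0 → z - (l + 1) ≠ 0 →
      k z = -((z - l)⁻¹ * (z - (l + 1))⁻¹) := by
    intro z h1 h2
    simp only [hk]
    field_simp
    ring
  have hcontbl : ∀ a : ℂ, 0 < a.re → Continuous fun y => (bend γ κ y - a)⁻¹ := fun a ha =>
    ((continuous_bend γ κ).sub continuous_const).inv₀ (hbl a ha)
  -- integrability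
  have hInt : Integrable (fun y => bendDeriv γ κ y * (F (bend γ κ y) * k (bend γ κ y))) := by
    have hb : Integrable (fun y : ℝ => (1 + κ) * (M * ((γ ^ 2)⁻¹ * (1 + (γ⁻¹ * (y - l.im)) ^ 2)⁻¹))) := by
      have h1 := ((integrable_inv_one_add_sq.comp_mul_left' (inv_ne_zero hγ0.ne')).comp_sub_right l.im)
      exact ((h1.const_mul _).const_mul _).const_mul _
    refine hb.mono' ?_ (Eventually.of_forall fun y => ?_)
    · refine (measurable_bendDeriv γ κ).aestronglyMeasurable.mul
        (h.continuous_comp_bend.mul ?_).aestronglyMeasurable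
      exact (hcontbl l hl).sub (hcontbl (l + 1) hl1)
    · rw [norm_mul, norm_mul]
      gcongr
      · exact norm_bendDeriv_le hκ.le y
      · exact h.norm_bend_le y
      · rw [hkform _ (hbl l hl y) (hbl _ hl1 y), norm_neg, norm_mul, norm_inv, norm_inv]
        have hsq : ∀ a : ℂ, 0 < a.re → a.im = l.im →
            Real.sqrt (γ ^ 2 * (1 + (γ⁻¹ * (y - l.im)) ^ 2)) ≤ ‖bend γ κ y - a‖ := by
          intro a ha hai
          apply Real.sqrt_le_iff.2 ⟨norm_nonneg _, ?_⟩
          rw [← normSq_eq_norm_sq, normSq_apply]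
          simp only [sub_re, bend_re, sub_im, bend_im, hai]
          have h1 := le_max_left γ (κ * |y|)
          have h2 : γ ^ 2 * (1 + (γ⁻¹ * (y - l.im)) ^ 2) = γ ^ 2 + (y - l.im) ^ 2 := by
            field_simp
          rw [h2]
          nlinarith
        have h0 : 0 < γ ^ 2 * (1 + (γ⁻¹ * (y - l.im)) ^ 2) := by positivity
        have h1 := hsq l hl rfl
        have h2 := hsq (l + 1) hl1 (by simp)
        have h3 : 0 < Real.sqrt (γ ^ 2 * (1 + (γ⁻¹ * (y - l.im)) ^ 2)) := Real.sqrt_pos.2 h0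
        rw [← mul_inv, ← mul_inv]
        apply inv_anti₀ h0
        calc _ = Real.sqrt (γ ^ 2 * (1 + (γ⁻¹ * (y - l.im)) ^ 2)) *
              Real.sqrt (γ ^ 2 * (1 + (γ⁻¹ * (y - l.im)) ^ 2)) := (Real.mul_self_sqrt h0.le).symm
          _ ≤ _ := by gcongr
  refine ⟨hInt, ?_⟩
  -- the deformation for large radius
  obtain ⟨γ', hγ', κ', hκ', hd⟩ := h.diff
  have hγ'0 := hγ0.trans hγ'
  -- The divided difference (F z - F a)/(z - a) has no pole, so the deformation to the arc applies
  -- to it; the rest, F a/(z - a), is covered by `bendIntegral_inv_sub`.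
  have hds : ∀ a : ℂ, 0 < a.re → DifferentiableOn ℂ (dslope F a) (bendRegion γ' κ') := fun a ha =>
    (differentiableOn_dslope ((isOpen_bendRegion γ' κ').mem_nhds
      (mem_bendRegion_of_re_nonneg hγ'0 ha.le))).2 hd
  have hdsv : ∀ a z : ℂ, z - a ≠ 0 → dslope F a z = F z * (z - a)⁻¹ - F a * (z - a)⁻¹ := by
    intro a z hz
    rw [dslope_of_ne _ (sub_ne_zero.1 hz), slope_def_field]
    field_simp
  have hdef : ∀ R : ℝ, ‖l‖ + 2 < R → γ ≤ R * Real.sin η →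
      bendIntegral γ κ (R * Real.cos η) (fun z => F z * k z) =
        arcIntegral R (-(Real.pi / 2 + η)) (Real.pi / 2 + η) (fun z => F z * k z) -
          2 * Real.pi * I * (F l - F (l + 1)) := by
    intro R hR hγR
    have hR0 : 0 < R := by linarith [norm_nonneg l]
    have hn1 : ‖l + 1‖ < R := by
      have := norm_add_le l 1
      rw [norm_one] at this; linarith
    have harc : ∀ a : ℂ, ‖a‖ < R → ∀ θ, circleMap 0 R θ - a ≠ 0 := by
      intro a ha θ h0
      have h1 := circleMap_mem_sphere 0 hR0.le θ
      rw [sub_eq_zero.1 h0, mem_sphere_zero_iff_norm] at h1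
      linarith
    have hca : ∀ a : ℂ, ‖a‖ < R → ∀ s, ContinuousOn (fun θ => (circleMap 0 R θ - a)⁻¹) s :=
      fun a ha s => ContinuousOn.inv₀ (by fun_prop) fun θ _ => harc a ha θ
    have hFc : ContinuousOn (fun θ => F (circleMap 0 R θ))
        (Set.uIcc (-(Real.pi / 2 + η)) (Real.pi / 2 + η)) := by
      refine hd.continuousOn.comp (continuous_circleMap 0 R).continuousOn fun θ hθ => ?_
      rw [Set.uIcc_of_le (by linarith [Real.pi_pos])] at hθ
      refine mem_bendRegion_of_le hγ' hγ0 hκ' (le_trans ?_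
        (le_re_circleMap hR0.le hη hη' (abs_le.2 ⟨hθ.1, hθ.2⟩)))
      rw [neg_le_neg_iff]
      exact le_max_right _ _
    have hone : ∀ a : ℂ, 0 < a.re → ‖a‖ < R →
        bendIntegral γ κ (R * Real.cos η) (fun z => F z * (z - a)⁻¹) =
        arcIntegral R (-(Real.pi / 2 + η)) (Real.pi / 2 + η) (fun z => F z * (z - a)⁻¹) -
          2 * Real.pi * I * F a := by
      intro a ha haR
      have e1 := bendIntegral_eq_arcIntegral hγ0 hγ' hη hη' hκ' hR0 hγR (hds a ha)
      have e2 := bendIntegral_inv_sub hγ0 hη hη' haR hγR ha.le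
      have e3 : bendIntegral γ κ (R * Real.cos η) (dslope F a) =
          bendIntegral γ κ (R * Real.cos η) (fun z => F z * (z - a)⁻¹) -
          F a * bendIntegral γ κ (R * Real.cos η) (fun z => (z - a)⁻¹) := by
        rw [bendIntegral, bendIntegral, bendIntegral, ← intervalIntegral.integral_const_mul,
          ← intervalIntegral.integral_sub]
        · refine intervalIntegral.integral_congr fun y _ => ?_
          simp only [hdsv a _ (hbl a ha y)]
          ring
        · exact intervalIntegrable_bend (f := fun z => F z * (z - a)⁻¹) hκ.le
            (h.continuous_comp_bend.mul (hcontbl a ha)).continuousOn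
        · exact (intervalIntegrable_bend (f := fun z => (z - a)⁻¹) hκ.le
            (hcontbl a ha).continuousOn).const_mul _
      have e4 : arcIntegral R (-(Real.pi / 2 + η)) (Real.pi / 2 + η) (dslope F a) =
          arcIntegral R (-(Real.pi / 2 + η)) (Real.pi / 2 + η) (fun z => F z * (z - a)⁻¹) -
          F a * arcIntegral R (-(Real.pi / 2 + η)) (Real.pi / 2 + η) (fun z => (z - a)⁻¹) := by
        rw [arcIntegral, arcIntegral, arcIntegral, ← intervalIntegral.integral_const_mul,
          ← intervalIntegral.integral_sub]
        · refine intervalIntegral.integral_congr fun θ _ => ?_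
          simp only [hdsv a _ (harc a haR θ)]
          ring
        · exact intervalIntegrable_arc (f := fun z => F z * (z - a)⁻¹) (hFc.mul (hca a haR _))
        · exact (intervalIntegrable_arc (f := fun z => (z - a)⁻¹) (hca a haR _)).const_mul _
      rw [← hκd] at e1 e2
      rw [e3, e4, e2] at e1
      linear_combination e1
    have e1 := hone l hl (by linarith)
    have e2 := hone (l + 1) hl1 hn1
    have e3 : bendIntegral γ κ (R * Real.cos η) (fun z => F z * k z) =
        bendIntegral γ κ (R * Real.cos η) (fun z => F z * (z - l)⁻¹) -
        bendIntegral γ κ (R * Real.cos η) (fun z => F z * (z - (l + 1))⁻¹) := by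
      rw [bendIntegral, bendIntegral, bendIntegral, ← intervalIntegral.integral_sub]
      · refine intervalIntegral.integral_congr fun y _ => ?_
        simp only [hk]; ring
      · exact intervalIntegrable_bend (f := fun z => F z * (z - l)⁻¹) hκ.le
          (h.continuous_comp_bend.mul (hcontbl _ hl)).continuousOn
      · exact intervalIntegrable_bend (f := fun z => F z * (z - (l + 1))⁻¹) hκ.le
          (h.continuous_comp_bend.mul (hcontbl _ hl1)).continuousOn
    have e4 : arcIntegral R (-(Real.pi / 2 + η)) (Real.pi / 2 + η) (fun z => F z * k z) =
        arcIntegral R (-(Real.pi / 2 + η)) (Real.pi / 2 + η) (fun z => F z * (z - l)⁻¹) -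
        arcIntegral R (-(Real.pi / 2 + η)) (Real.pi / 2 + η) (fun z => F z * (z - (l + 1))⁻¹) := by
      rw [arcIntegral, arcIntegral, arcIntegral, ← intervalIntegral.integral_sub]
      · refine intervalIntegral.integral_congr fun y _ => ?_
        simp only [hk]; ring
      · exact intervalIntegrable_arc (f := fun z => F z * (z - l)⁻¹)
          (hFc.mul (hca _ (by linarith) _))
      · exact intervalIntegrable_arc (f := fun z => F z * (z - (l + 1))⁻¹) (hFc.mul (hca _ hn1 _))
    rw [e3, e4, e1, e2]
    ring
  -- the limit of large radius
  have hRc : Tendsto (fun R : ℝ => R * Real.cos η) atTop atTop :=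
    tendsto_id.atTop_mul_const hcos
  have hlim1 : Tendsto (fun R : ℝ => bendIntegral γ κ (R * Real.cos η) (fun z => F z * k z)) atTop
      (𝓝 (∫ y, bendDeriv γ κ y * (F (bend γ κ y) * k (bend γ κ y)))) :=
    intervalIntegral_tendsto_integral hInt (tendsto_neg_atTop_atBot.comp hRc) hRc
  have hlim2 : Tendsto (fun R : ℝ => arcIntegral R (-(Real.pi / 2 + η)) (Real.pi / 2 + η)
      (fun z => F z * k z)) atTop (𝓝 0) := by
    -- Length of order R, |F| ≤ M, and a kernel of size at most 4/R² once both poles lie within R/2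
    -- of the origin.
    have hb : ∀ᶠ R : ℝ in atTop, ‖arcIntegral R (-(Real.pi / 2 + η)) (Real.pi / 2 + η)
        (fun z => F z * k z)‖ ≤ (M * 4 * (Real.pi + 2 * η)) * R⁻¹ := by
      filter_upwards [eventually_gt_atTop (2 * (‖l‖ + 1))] with R hR
      have hR0 : 0 < R := by linarith [norm_nonneg l]
      have hn1 : ‖l + 1‖ ≤ R / 2 := by
        have := norm_add_le l 1
        rw [norm_one] at this; linarith
      have hdist : ∀ a : ℂ, ‖a‖ ≤ R / 2 → ∀ θ, R / 2 ≤ ‖circleMap 0 R θ - a‖ := by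
        intro a ha θ
        have h1 := norm_sub_norm_le (circleMap 0 R θ) a
        rw [norm_circleMap_zero, abs_of_pos hR0] at h1
        linarith
      have := intervalIntegral.norm_integral_le_of_norm_le_const (a := -(Real.pi / 2 + η))
        (b := Real.pi / 2 + η) (C := R * (M * (4 / R ^ 2)))
        (f := fun θ => deriv (circleMap 0 R) θ * (F (circleMap 0 R θ) * k (circleMap 0 R θ))) (by
          intro θ hθ
          rw [Set.uIoc_of_le (by linarith [Real.pi_pos])] at hθ
          have d1 := hdist l (by linarith) θ
          have d2 := hdist (l + 1) hn1 θ
          have n1 : circleMap 0 R θ - l ≠ 0 := norm_pos_iff.1 (by linarith)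
          have n2 : circleMap 0 R θ - (l + 1) ≠ 0 := norm_pos_iff.1 (by linarith)
          rw [norm_mul, norm_mul, deriv_circleMap, norm_mul, norm_I, mul_one, norm_circleMap_zero,
            abs_of_pos hR0]
          gcongr
          · refine h.bound _ (le_trans ?_ (le_re_circleMap hR0.le hη hη'
              (abs_le.2 ⟨hθ.1.le, hθ.2⟩)))
            rw [neg_le_neg_iff]
            exact le_max_right _ _
          · rw [hkform _ n1 n2, norm_neg, norm_mul, norm_inv, norm_inv]
            calc _ ≤ (R / 2)⁻¹ * (R / 2)⁻¹ := by gcongr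
              _ = 4 / R ^ 2 := by field_simp; norm_num)
      refine this.trans (le_of_eq ?_)
      rw [abs_of_pos (by linarith [Real.pi_pos])]
      field_simp
      ring
    refine squeeze_zero_norm' hb ?_
    simpa using tendsto_inv_atTop_zero.const_mul (M * 4 * (Real.pi + 2 * η))
  have hev : ∀ᶠ R : ℝ in atTop, bendIntegral γ κ (R * Real.cos η) (fun z => F z * k z) =
        arcIntegral R (-(Real.pi / 2 + η)) (Real.pi / 2 + η) (fun z => F z * k z) -
          2 * Real.pi * I * (F l - F (l + 1)) := by
    filter_upwards [eventually_gt_atTop (‖l‖ + 2), eventually_ge_atTop (γ / Real.sin η)]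
      with R h1 h2
    exact hdef R h1 ((div_le_iff₀ hs).1 h2)
  have := tendsto_nhds_unique (hlim1.congr' hev) (hlim2.sub_const _)
  rw [this]
  ring

/-! ### Inversion of the Laplace transform along the bent contour -/

/-- The integral `(2πi)⁻¹ ∫ e^{zτ} F(z) dz` over the bent contour. -/
def invLaplace (F : ℂ → ℂ) (γ κ : ℝ) (τ : ℂ) : ℂ :=
  (2 * Real.pi * I)⁻¹ * ∫ y, bendDeriv γ κ y * (exp (bend γ κ y * τ) * F (bend γ κ y))

theorem norm_exp_bend (γ κ y : ℝ) (τ : ℂ) :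
    ‖exp (bend γ κ y * τ)‖ = Real.exp (-(max γ (κ * |y|) * τ.re) - y * τ.im) := by
  rw [norm_exp, mul_re, bend_re, bend_im]
  ring_nf

/-- On the slanted branches the decay κ|y| Re τ beats the growth |y||Im τ| as long as |Im τ| < κ Re
τ. This sector is the domain of the inverse transform. -/
theorem norm_exp_bend_le {γ κ y : ℝ} {τ : ℂ} (hτ : 0 ≤ τ.re) :
    ‖exp (bend γ κ y * τ)‖ ≤ Real.exp (-((κ * τ.re - |τ.im|) * |y|)) := by
  rw [norm_exp_bend]
  apply Real.exp_le_exp.2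
  have h1 := le_max_right γ (κ * |y|)
  have h2 : -(y * τ.im) ≤ |τ.im| * |y| := by
    rw [mul_comm, ← abs_mul]; exact neg_le_abs _
  nlinarith

namespace IsContourFor

variable {F : ℂ → ℂ} {γ η M : ℝ}

theorem aestronglyMeasurable_exp_mul (h : IsContourFor F γ η M) (τ : ℂ) :
    AEStronglyMeasurable (fun y => bendDeriv γ (Real.tan η) y *
      (exp (bend γ (Real.tan η) y * τ) * F (bend γ (Real.tan η) y))) := by
  refine (measurable_bendDeriv γ _).aestronglyMeasurable.mul
    (Continuous.mul ?_ h.continuous_comp_bend).aestronglyMeasurable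
  have := continuous_bend γ (Real.tan η)
  fun_prop

theorem norm_integrand_le (h : IsContourFor F γ η M) (y : ℝ) (τ : ℂ) :
    ‖bendDeriv γ (Real.tan η) y * (exp (bend γ (Real.tan η) y * τ) * F (bend γ (Real.tan η) y))‖ ≤
      (1 + Real.tan η) * (‖exp (bend γ (Real.tan η) y * τ)‖ * M) := by
  have := h.tan_pos
  rw [norm_mul, norm_mul]
  gcongr
  · exact norm_bendDeriv_le h.tan_pos.le y
  · exact h.norm_bend_le y

theorem integrable_exp_mul (h : IsContourFor F γ η M) {τ : ℂ} (hτ0 : 0 ≤ τ.re)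
    (hτ : |τ.im| < Real.tan η * τ.re) :
    Integrable (fun y => bendDeriv γ (Real.tan η) y *
      (exp (bend γ (Real.tan η) y * τ) * F (bend γ (Real.tan η) y))) := by
  have hM := h.M_nonneg
  have hκ := h.tan_pos
  refine (((integrable_exp_neg_mul_abs (sub_pos.2 hτ)).mul_const M).const_mul
    (1 + Real.tan η)).mono' (h.aestronglyMeasurable_exp_mul τ) (Eventually.of_forall fun y => ?_)
  refine (h.norm_integrand_le y τ).trans ?_
  gcongr
  exact norm_exp_bend_le hτ0

/-- Complex differentiability in the sector, rather than smoothness on the half-line, is what lets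
vanishing for large times spread to all positive times. -/
theorem differentiableAt_invLaplace (h : IsContourFor F γ η M) {τ₀ : ℂ} (hτ0 : 0 < τ₀.re)
    (hτ : |τ₀.im| < Real.tan η * τ₀.re) :
    DifferentiableAt ℂ (invLaplace F γ (Real.tan η)) τ₀ := by
  have hM := h.M_nonneg
  have hκ := h.tan_pos
  have hγ0 := h.γ_pos
  set κ := Real.tan η with hκd
  obtain ⟨a, ha, haτ⟩ : ∃ a, 0 < a ∧ a < κ * τ₀.re - |τ₀.im| := exists_between (sub_pos.2 hτ)
  set s : Set ℂ := {τ | 0 < τ.re ∧ a < κ * τ.re - |τ.im|} with hs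
  have hsn : s ∈ 𝓝 τ₀ := by
    refine IsOpen.mem_nhds ?_ ⟨hτ0, haτ⟩
    have hc : Continuous fun τ : ℂ => κ * τ.re - |τ.im| := by fun_prop
    exact (isOpen_lt continuous_const continuous_re).inter (isOpen_lt continuous_const hc)
  -- Differentiation in τ brings down a factor linear in |y|; half of the exponential decay absorbs
  -- it.
  have hlin : ∀ y : ℝ, ‖bend γ κ y‖ ≤ (γ + (κ + 1) * (2 / a)) * Real.exp (a / 2 * |y|) := by
    intro y
    have h1 : ‖bend γ κ y‖ ≤ γ + (κ + 1) * |y| := by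
      refine (norm_le_abs_re_add_abs_im _).trans ?_
      rw [bend_re, bend_im, abs_neg, abs_of_nonneg (hγ0.le.trans (le_max_left _ _))]
      have : max γ (κ * |y|) ≤ γ + κ * |y| := by
        rw [max_le_iff]; constructor <;> nlinarith [abs_nonneg y]
      linarith
    have h2 : |y| ≤ (2 / a) * Real.exp (a / 2 * |y|) := by
      have := Real.add_one_le_exp (a / 2 * |y|)
      calc |y| = (2 / a) * (a / 2 * |y|) := by field_simp
        _ ≤ _ := by gcongr; linarith
    have h3 : 1 ≤ Real.exp (a / 2 * |y|) := Real.one_le_exp (by positivity)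
    calc _ ≤ γ + (κ + 1) * |y| := h1
      _ ≤ γ * Real.exp (a / 2 * |y|) + (κ + 1) * ((2 / a) * Real.exp (a / 2 * |y|)) := by
        gcongr
        nlinarith
      _ = _ := by ring
  have key := hasDerivAt_integral_of_dominated_loc_of_deriv_le (μ := volume) (𝕜 := ℂ)
    (F := fun τ y => bendDeriv γ κ y * (exp (bend γ κ y * τ) * F (bend γ κ y)))
    (F' := fun τ y => bend γ κ y *
      (bendDeriv γ κ y * (exp (bend γ κ y * τ) * F (bend γ κ y))))
    (bound := fun y => (γ + (κ + 1) * (2 / a)) * ((1 + κ) * (Real.exp (-(a / 2 * |y|)) * M)))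
    hsn (Eventually.of_forall h.aestronglyMeasurable_exp_mul) (h.integrable_exp_mul hτ0.le hτ)
    ((continuous_bend γ κ).aestronglyMeasurable.mul (h.aestronglyMeasurable_exp_mul τ₀))
    (Eventually.of_forall fun y τ hτs => by
      rw [norm_mul]
      have h1 := h.norm_integrand_le y τ
      have h2 : ‖exp (bend γ κ y * τ)‖ ≤ Real.exp (-(a * |y|)) := by
        refine (norm_exp_bend_le hτs.1.le).trans (Real.exp_le_exp.2 ?_)
        have := mul_le_mul_of_nonneg_right hτs.2.le (abs_nonneg y)
        linarith
      have h3 : Real.exp (-(a / 2 * |y|)) = Real.exp (a / 2 * |y|) * Real.exp (-(a * |y|)) := by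
        rw [← Real.exp_add]; ring_nf
      calc _ ≤ ((γ + (κ + 1) * (2 / a)) * Real.exp (a / 2 * |y|)) *
            ((1 + κ) * (Real.exp (-(a * |y|)) * M)) := by
              refine mul_le_mul (hlin y) (h1.trans ?_) (norm_nonneg _) (by positivity)
              gcongr
        _ = _ := by rw [h3]; ring)
    (((integrable_exp_neg_mul_abs (half_pos ha)).mul_const M).const_mul _ |>.const_mul _)
    (Eventually.of_forall fun y τ _ => by
      have h1 : HasDerivAt (fun τ => bend γ κ y * τ) (bend γ κ y) τ := by
        simpa using (hasDerivAt_id τ).const_mul (bend γ κ y)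
      have h2 := (h1.cexp.mul_const (F (bend γ κ y))).const_mul (bendDeriv γ κ y)
      exact h2.congr_deriv (by ring))
  exact (key.2.differentiableAt.const_mul _)

/-- Exponential decay of the inverse transform. -/
theorem norm_invLaplace_le (h : IsContourFor F γ η M) :
    ∃ C : ℝ, ∀ t : ℝ, 1 ≤ t → ‖invLaplace F γ (Real.tan η) t‖ ≤ C * Real.exp (-γ * t) := by
  have hM := h.M_nonneg
  have hκ := h.tan_pos
  set κ := Real.tan η with hκd
  refine ⟨‖(2 * Real.pi * I : ℂ)⁻¹‖ * ((1 + κ) * (2 / κ * M) * Real.exp γ), fun t ht => ?_⟩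
  rw [invLaplace, norm_mul, mul_assoc ‖(2 * Real.pi * I : ℂ)⁻¹‖]
  gcongr
  have h1 : ∀ y, ‖bendDeriv γ κ y * (exp (bend γ κ y * (t : ℂ)) * F (bend γ κ y))‖ ≤
      (Real.exp (-(κ * |y|))) * ((1 + κ) * M * Real.exp (-(γ * (t - 1)))) := by
    intro y
    refine (h.norm_integrand_le y t).trans ?_
    -- Split t = 1 + (t - 1): one unit of time is spent on κ|y|, which makes the integral converge,
    -- and the remaining t - 1 on γ. This accounts for the factor e^γ in the constant.
    have : ‖exp (bend γ κ y * (t : ℂ))‖ ≤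
        Real.exp (-(κ * |y|)) * Real.exp (-(γ * (t - 1))) := by
      rw [norm_exp_bend, ← Real.exp_add]
      apply Real.exp_le_exp.2
      simp only [ofReal_re, ofReal_im, mul_zero, sub_zero]
      nlinarith [le_max_left γ (κ * |y|), le_max_right γ (κ * |y|)]
    calc _ ≤ (1 + κ) * ((Real.exp (-(κ * |y|)) * Real.exp (-(γ * (t - 1)))) * M) := by gcongr
      _ = _ := by ring
  refine (norm_integral_le_of_norm_le ((integrable_exp_neg_mul_abs hκ).mul_const _)
    (Eventually.of_forall h1)).trans (le_of_eq ?_)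
  rw [integral_mul_const, integral_exp_neg_mul_abs hκ, mul_assoc ((1 + κ) * (2 / κ * M)),
    ← Real.exp_add]
  ring_nf

/-- The Laplace transform of `(1 - e^{-t})` times the inverse transform. -/
theorem laplace_invLaplace (h : IsContourFor F γ η M) {l : ℂ} (hl : 0 < l.re) :
    IntegrableOn (fun t : ℝ => exp (-l * t) * (1 - exp (-t)) * invLaplace F γ (Real.tan η) t)
      (Set.Ioi 0) ∧
    ∫ t in Set.Ioi (0 : ℝ), exp (-l * t) * (1 - exp (-t)) * invLaplace F γ (Real.tan η) t =
      F l - F (l + 1) := by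
  have hM := h.M_nonneg
  have hκ := h.tan_pos
  have hγ0 := h.γ_pos
  obtain ⟨-, hcauchy⟩ := h.integral_cauchy hl
  set κ := Real.tan η with hκd
  set Φ : ℝ × ℝ → ℂ := fun p => (exp (-l * p.1) * (1 - exp (-p.1))) *
    (bendDeriv γ κ p.2 * (exp (bend γ κ p.2 * p.1) * F (bend γ κ p.2))) with hΦ
  have hΦm : AEStronglyMeasurable Φ ((volume.restrict (Set.Ioi (0 : ℝ))).prod volume) := by
    have h1 : Continuous fun p : ℝ × ℝ => exp (-l * p.1) * (1 - exp (-(p.1 : ℂ))) := by fun_prop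
    have h2 : Measurable fun p : ℝ × ℝ => bendDeriv γ κ p.2 :=
      (measurable_bendDeriv γ κ).comp measurable_snd
    have h3 : Continuous fun p : ℝ × ℝ => exp (bend γ κ p.2 * p.1) * F (bend γ κ p.2) := by
      have := continuous_bend γ κ
      exact Continuous.mul (by fun_prop) (h.continuous_comp_bend.comp continuous_snd)
    exact h1.aestronglyMeasurable.mul (h2.aestronglyMeasurable.mul h3.aestronglyMeasurable)
  have hbd : ∀ t : ℝ, 0 < t → ∀ y, ‖Φ (t, y)‖ ≤
      (Real.exp (-l.re * t) * t * ((1 + κ) * M)) * Real.exp (-(κ * t * |y|)) := by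
    intro t ht y
    have h1 : ‖exp (-l * (t : ℂ))‖ = Real.exp (-l.re * t) := by
      rw [norm_exp]; simp
    -- The reason for the weight 1 - e^{-t}: the y-integral of e^{-κt|y|} is 2/(κt), and the factor
    -- t compensates this singularity at t = 0, which makes Fubini applicable.
    have h2 : ‖(1 : ℂ) - exp (-(t : ℂ))‖ ≤ t := by
      have e : (1 : ℂ) - exp (-(t : ℂ)) = ((1 - Real.exp (-t) : ℝ) : ℂ) := by push_cast; rfl
      rw [e, norm_real, Real.norm_of_nonneg]
      · linarith [Real.add_one_le_exp (-t)]
      · have : Real.exp (-t) ≤ 1 := Real.exp_le_one_iff.2 (by linarith)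
        linarith
    have h3 : ‖exp (bend γ κ y * (t : ℂ))‖ ≤ Real.exp (-(κ * t * |y|)) := by
      have := norm_exp_bend_le (γ := γ) (κ := κ) (y := y) (τ := t) (by simpa using ht.le)
      simpa using this
    calc ‖Φ (t, y)‖ = ‖exp (-l * (t : ℂ))‖ * ‖(1 : ℂ) - exp (-(t : ℂ))‖ *
          ‖bendDeriv γ κ y * (exp (bend γ κ y * (t : ℂ)) * F (bend γ κ y))‖ := by
            rw [hΦ]; simp only [norm_mul]
      _ ≤ Real.exp (-l.re * t) * t * ((1 + κ) * (Real.exp (-(κ * t * |y|)) * M)) := by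
        rw [h1]
        gcongr
        refine (h.norm_integrand_le y t).trans ?_
        gcongr
      _ = _ := by ring
  have hy_int : ∀ t : ℝ, 0 < t → Integrable (fun y => Φ (t, y)) := by
    intro t ht
    exact (h.integrable_exp_mul (τ := t) (by simpa using ht.le)
      (by simpa using mul_pos hκ ht)).const_mul (exp (-l * t) * (1 - exp (-t)))
  have hΦint : Integrable Φ ((volume.restrict (Set.Ioi (0 : ℝ))).prod volume) := by
    rw [integrable_prod_iff hΦm]
    refine ⟨(ae_restrict_iff' measurableSet_Ioi).2 (Eventually.of_forall fun t ht => hy_int t ht),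
      ?_⟩
    have hb : IntegrableOn (fun t : ℝ => Real.exp (-l.re * t) * ((1 + κ) * M * (2 / κ)))
        (Set.Ioi 0) := (integrableOn_exp_mul_Ioi (neg_lt_zero.2 hl) 0).mul_const _
    refine Integrable.mono' hb hΦm.norm.integral_prod_right' ?_
    refine (ae_restrict_iff' measurableSet_Ioi).2 (Eventually.of_forall fun t ht => ?_)
    have ht : 0 < t := ht
    have hκt : 0 < κ * t := mul_pos hκ ht
    rw [Real.norm_of_nonneg (integral_nonneg fun _ => norm_nonneg _)]
    calc ∫ y, ‖Φ (t, y)‖ ≤ ∫ y, (Real.exp (-l.re * t) * t * ((1 + κ) * M)) *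
          Real.exp (-(κ * t * |y|)) := by
            refine integral_mono (hy_int t ht).norm
              ((integrable_exp_neg_mul_abs hκt).const_mul _) (hbd t ht)
      _ = Real.exp (-l.re * t) * ((1 + κ) * M * (2 / κ)) := by
        rw [integral_const_mul, integral_exp_neg_mul_abs hκt]
        field_simp
  have hswap := integral_integral_swap (f := fun t y => Φ (t, y)) hΦint
  have hleft : ∀ t : ℝ, ∫ y, Φ (t, y) =
      (2 * Real.pi * I) * (exp (-l * t) * (1 - exp (-t)) * invLaplace F γ κ t) := by
    intro t
    simp only [hΦ]
    rw [integral_const_mul, invLaplace]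
    have : (2 * Real.pi * I : ℂ) ≠ 0 := two_pi_I_ne_zero
    field_simp
  -- Integrating in t first turns the exponentials into the two Cauchy kernels at l and l + 1, which
  -- is where `integral_cauchy` enters.
  have hright : ∀ y : ℝ, ∫ t in Set.Ioi (0 : ℝ), Φ (t, y) =
      -(bendDeriv γ κ y * (F (bend γ κ y) *
      ((bend γ κ y - l)⁻¹ - (bend γ κ y - (l + 1))⁻¹))) := by
    intro y
    have hre : (bend γ κ y - l).re < 0 := by
      rw [sub_re, bend_re]; linarith [le_max_left γ (κ * |y|)]
    have hre' : (bend γ κ y - (l + 1)).re < 0 := by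
      rw [sub_re, bend_re, add_re, one_re]; linarith [le_max_left γ (κ * |y|)]
    have e1 : ∀ t : ℝ, Φ (t, y) = (bendDeriv γ κ y * F (bend γ κ y)) *
        (exp ((bend γ κ y - l) * t) - exp ((bend γ κ y - (l + 1)) * t)) := by
      intro t
      have e2 : exp ((bend γ κ y - l) * t) = exp (-l * t) * exp (bend γ κ y * t) := by
        rw [← exp_add]; ring_nf
      have e3 : exp ((bend γ κ y - (l + 1)) * t) =
          exp (-l * t) * exp (bend γ κ y * t) * exp (-(t : ℂ)) := by
        rw [← exp_add, ← exp_add]; ring_nf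
      rw [e2, e3]
      simp only [hΦ]
      ring
    simp only [e1]
    rw [integral_const_mul, integral_sub (integrableOn_exp_mul_complex_Ioi hre 0)
      (integrableOn_exp_mul_complex_Ioi hre' 0), integral_exp_mul_complex_Ioi hre,
      integral_exp_mul_complex_Ioi hre']
    simp only [ofReal_zero, mul_zero, exp_zero]
    rw [div_eq_mul_inv, div_eq_mul_inv]
    ring
  have hpi : (2 * Real.pi * I : ℂ) ≠ 0 := two_pi_I_ne_zero
  simp only [hleft, hright] at hswap
  constructor
  · have h1 := hΦint.integral_prod_left
    simp only [hleft] at h1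
    have h2 := h1.const_mul ((2 * Real.pi * I : ℂ)⁻¹)
    refine h2.congr (Eventually.of_forall fun t => ?_)
    simp only
    rw [inv_mul_cancel_left₀ hpi]
  · rw [integral_const_mul, integral_neg, hcauchy] at hswap
    apply mul_left_cancel₀ hpi
    rw [hswap]
    ring

end IsContourFor

namespace IsContourFor

variable {F : ℂ → ℂ} {γ η M : ℝ}

/-- A function whose Laplace transform is `F` is the inverse transform of `F`. -/
theorem eq_invLaplace (h : IsContourFor F γ η M) {φ : ℝ → ℂ} (hφ : ContinuousOn φ (Set.Ici 0))
    {c₀ : ℝ} (hL : ∀ l : ℂ, c₀ < l.re → IntegrableOn (fun t : ℝ => exp (-l * t) * φ t) (Set.Ioi 0) ∧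
      ∫ t in Set.Ioi (0 : ℝ), exp (-l * t) * φ t = F l) {t : ℝ} (ht : 0 < t) :
    φ t = invLaplace F γ (Real.tan η) t := by
  set κ := Real.tan η with hκd
  have hκ : 0 < κ := h.tan_pos
  set c : ℝ := max c₀ 0 + 1 with hc
  have hc0 : 0 < c := by linarith [le_max_right c₀ 0]
  have hcc : c₀ < c := by linarith [le_max_left c₀ 0]
  -- The weighted difference of the two candidates. The abscissa c exceeds both c₀ and 0, so the
  -- Laplace formulas for φ and for the contour integral hold on the line Re l = c.
  set f : ℝ → ℂ := fun s => exp (-(c : ℂ) * s) * (1 - exp (-s)) * (invLaplace F γ κ s - φ s) with hf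
  set hh : ℝ → ℂ := (Set.Ioi (0 : ℝ)).indicator f with hhd
  have hφ1 : ∀ l : ℂ, c₀ < l.re → 0 < l.re →
      IntegrableOn (fun s : ℝ => exp (-l * s) * (1 - exp (-s)) * (invLaplace F γ κ s - φ s))
        (Set.Ioi 0) ∧
      ∫ s in Set.Ioi (0 : ℝ), exp (-l * s) * (1 - exp (-s)) * (invLaplace F γ κ s - φ s) = 0 := by
    intro l hl hl0
    obtain ⟨i1, e1⟩ := h.laplace_invLaplace hl0
    obtain ⟨i2, e2⟩ := hL l hl
    obtain ⟨i3, e3⟩ := hL (l + 1) (by simp; linarith)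
    have e : ∀ s : ℝ, exp (-l * s) * (1 - exp (-s)) * (invLaplace F γ κ s - φ s) =
        exp (-l * s) * (1 - exp (-s)) * invLaplace F γ κ s -
        (exp (-l * s) * φ s - exp (-(l + 1) * s) * φ s) := by
      intro s
      have : exp (-(l + 1) * s) = exp (-l * s) * exp (-s) := by rw [← exp_add]; ring_nf
      rw [this]; ring
    simp only [e]
    refine ⟨i1.sub (i2.sub i3), ?_⟩
    refine (integral_sub i1 (i2.sub i3)).trans ?_
    rw [e1]
    refine sub_eq_zero.2 (Eq.symm ?_)
    refine (integral_sub i2 i3).trans ?_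
    rw [e2, e3]
  have hhint : Integrable hh := by
    rw [hhd, integrable_indicator_iff measurableSet_Ioi]
    exact (hφ1 c (by simpa using hcc) (by simpa using hc0)).1
  -- The Fourier transform at ξ is the Laplace integral at l = c + 2πiξ, where both terms contribute
  -- F(l) - F(l + 1). Inversion at a point of continuity then forces the function to vanish there.
  have hfour : FourierTransform.fourier hh = fun _ : ℝ => (0 : ℂ) := by
    funext ξ
    rw [Real.fourier_real_eq_integral_exp_smul]
    have h1 := (hφ1 (c + 2 * Real.pi * ξ * I) (by simpa using hcc) (by simpa using hc0)).2
    rw [← integral_indicator measurableSet_Ioi] at h1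
    rw [← h1]
    refine integral_congr_ae (Eventually.of_forall fun s => ?_)
    simp only [hhd, Set.indicator, smul_eq_mul, mul_ite, mul_zero]
    split_ifs
    · have : exp (-(c + 2 * Real.pi * ξ * I) * s) =
          exp (((-2 * Real.pi * s * ξ : ℝ) : ℂ) * I) * exp (-(c : ℂ) * s) := by
        rw [← exp_add]; push_cast; ring_nf
      rw [this, hf]
      push_cast
      ring
    · rfl
  have hcont : ContinuousAt hh t := by
    have he : hh =ᶠ[𝓝 t] f := by
      filter_upwards [Ioi_mem_nhds ht] with s hs
      rw [hhd, Set.indicator_of_mem hs]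
    refine ContinuousAt.congr ?_ he.symm
    have h1 : ContinuousAt (fun s : ℝ => invLaplace F γ κ s) t := by
      have := (h.differentiableAt_invLaplace (τ₀ := t) (by simpa using ht)
        (by simpa using mul_pos hκ ht)).continuousAt
      exact ContinuousAt.comp (f := fun s : ℝ => (s : ℂ)) this continuous_ofReal.continuousAt
    have h2 : ContinuousAt φ t := hφ.continuousAt (Ici_mem_nhds ht)
    have h3 : Continuous fun s : ℝ => exp (-(c : ℂ) * s) * (1 - exp (-(s : ℂ))) := by fun_prop
    exact h3.continuousAt.mul (h1.sub h2)
  have hinv := hhint.fourierInv_fourier_eq (by rw [hfour]; exact integrable_zero _ _ _) hcont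
  rw [hfour, Real.fourierInv_eq'] at hinv
  simp only [smul_zero, integral_zero] at hinv
  rw [hhd, Set.indicator_of_mem (Set.mem_Ioi.2 ht), hf] at hinv
  have hne : exp (-(c : ℂ) * t) * (1 - exp (-(t : ℂ))) ≠ 0 := by
    refine mul_ne_zero (exp_ne_zero _) ?_
    have e : (1 : ℂ) - exp (-(t : ℂ)) = ((1 - Real.exp (-t) : ℝ) : ℂ) := by push_cast; rfl
    rw [e, ofReal_ne_zero, sub_ne_zero]
    exact (Real.exp_lt_one_iff.2 (by linarith)).ne'
  have := (mul_eq_zero.1 hinv.symm).resolve_left hne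
  exact (sub_eq_zero.1 this).symm

/-- If the inverse transform vanishes for large times, it vanishes for all positive times. -/
theorem invLaplace_eq_zero (h : IsContourFor F γ η M) {t₀ : ℝ}
    (h0 : ∀ t : ℝ, t₀ < t → invLaplace F γ (Real.tan η) t = 0) {t : ℝ} (ht : 0 < t) :
    invLaplace F γ (Real.tan η) t = 0 := by
  set κ := Real.tan η with hκd
  have hκ : 0 < κ := h.tan_pos
  -- The sector of holomorphy is convex, so the identity theorem applies: the zeros to the right of
  -- t₁ accumulate at t₁.
  set Ω : Set ℂ := {τ | 0 < τ.re ∧ |τ.im| < κ * τ.re} with hΩ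
  have hΩo : IsOpen Ω :=
    (isOpen_lt continuous_const continuous_re).inter
      (isOpen_lt (f := fun τ : ℂ => |τ.im|) (g := fun τ => κ * τ.re) (by fun_prop) (by fun_prop))
  have hΩc : Convex ℝ Ω := by
    intro x hx y hy a b ha hb hab
    rcases ha.eq_or_lt with rfl | ha
    · simp only [zero_add] at hab
      simpa [hab] using hy
    have hre : (a • x + b • y).re = a * x.re + b * y.re := by simp
    have him : (a • x + b • y).im = a * x.im + b * y.im := by simp
    constructor
    · rw [hre]; nlinarith [hx.1, hy.1, mul_pos ha hx.1, mul_nonneg hb hy.1.le]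
    · rw [hre, him]
      have h1 := abs_add_le (a * x.im) (b * y.im)
      rw [abs_mul, abs_mul, abs_of_pos ha, abs_of_nonneg hb] at h1
      have h2 := mul_lt_mul_of_pos_left hx.2 ha
      have h3 := mul_le_mul_of_nonneg_left hy.2.le hb
      nlinarith
  have hd : DifferentiableOn ℂ (invLaplace F γ κ) Ω := fun τ hτ =>
    (h.differentiableAt_invLaplace hτ.1 hτ.2).differentiableWithinAt
  have han : AnalyticOnNhd ℂ (invLaplace F γ κ) Ω := hd.analyticOnNhd hΩo
  have hmem : ∀ s : ℝ, 0 < s → (s : ℂ) ∈ Ω := fun s hs =>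
    ⟨by simpa using hs, by simpa using mul_pos hκ hs⟩
  set t₁ : ℝ := max t₀ 0 + 1 with ht₁
  have ht₁0 : 0 < t₁ := by linarith [le_max_right t₀ 0]
  have htt : t₀ < t₁ := by linarith [le_max_left t₀ 0]
  refine han.eqOn_zero_of_preconnected_of_frequently_eq_zero hΩc.isPreconnected
    (hmem t₁ ht₁0) ?_ (hmem t ht)
  have htend : Tendsto (fun s : ℝ => (s : ℂ)) (𝓝[>] t₁) (𝓝[≠] (t₁ : ℂ)) := by
    refine tendsto_nhdsWithin_iff.2 ⟨continuous_ofReal.continuousAt.mono_left nhdsWithin_le_nhds, ?_⟩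
    filter_upwards [self_mem_nhdsWithin] with s hs
    simpa using (Set.mem_Ioi.1 hs).ne'
  refine htend.frequently (Eventually.frequently ?_)
  filter_upwards [self_mem_nhdsWithin] with s hs
  exact h0 s (htt.trans hs)

/-- The inverse transform is the limit of integrals over circles. -/
theorem tendsto_circleIntegral (h : IsContourFor F γ η M) {r : ℕ → ℝ} (hr : Tendsto r atTop atTop)
    {A β : ℝ}
    (hF : ∀ᶠ k in atTop, ContinuousOn F (Metric.sphere 0 (r k)) ∧
      ∀ θ, Real.pi / 2 + η ≤ θ → θ ≤ 3 * Real.pi / 2 - η →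
        ‖F (circleMap 0 (r k) θ)‖ ≤ A * Real.exp (β * r k))
    {t : ℝ} (ht : 0 < t) (htβ : β < t * Real.sin η) :
    Tendsto (fun k => (2 * Real.pi * I)⁻¹ * ∮ z in C(0, r k), exp (z * t) * F z) atTop
      (𝓝 (invLaplace F γ (Real.tan η) t)) := by
  have hγ0 := h.γ_pos
  have hη := h.η_pos
  have hη' := h.η_lt
  have hs : 0 < Real.sin η := Real.sin_pos_of_pos_of_lt_pi hη (by linarith [Real.pi_pos])
  have hcos : 0 < Real.cos η := Real.cos_pos_of_mem_Ioo ⟨by linarith, hη'⟩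
  have hκ := h.tan_pos
  obtain ⟨γ', hγ', κ', hκ', hd⟩ := h.diff
  set f : ℂ → ℂ := fun z => exp (z * t) * F z with hf
  have hdf : DifferentiableOn ℂ f (bendRegion γ' κ') := DifferentiableOn.mul (by fun_prop) hd
  have hInt := h.integrable_exp_mul (τ := t) (by simpa using ht.le) (by simpa using mul_pos hκ ht)
  have hRc : Tendsto (fun k => r k * Real.cos η) atTop atTop := hr.atTop_mul_const hcos
  have hlim1 : Tendsto (fun k => bendIntegral γ (Real.tan η) (r k * Real.cos η) f) atTop
      (𝓝 (∫ y, bendDeriv γ (Real.tan η) y * f (bend γ (Real.tan η) y))) :=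
    intervalIntegral_tendsto_integral hInt (tendsto_neg_atTop_atBot.comp hRc) hRc
  have hlim2 : Tendsto (fun k => arcIntegral (r k) (Real.pi / 2 + η) (3 * Real.pi / 2 - η) f)
      atTop (𝓝 0) := by
    -- On the left arc Re z ≤ -r_k sin η, hence |e^{zt}F| ≤ A e^{-b r_k}. Positivity of b absorbs
    -- the arc length, of order r_k.
    set b := t * Real.sin η - β with hb
    have hb0 : 0 < b := sub_pos.2 htβ
    have hbd : ∀ᶠ k in atTop, ‖arcIntegral (r k) (Real.pi / 2 + η) (3 * Real.pi / 2 - η) f‖ ≤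
        (|3 * Real.pi / 2 - η - (Real.pi / 2 + η)| * A) * (r k * Real.exp (-(b * r k))) := by
      filter_upwards [hF, hr.eventually_gt_atTop 0] with k hk hk0
      have := intervalIntegral.norm_integral_le_of_norm_le_const (a := Real.pi / 2 + η)
        (b := 3 * Real.pi / 2 - η)
        (C := r k * (Real.exp (-(r k * Real.sin η * t)) * (A * Real.exp (β * r k))))
        (f := fun θ => deriv (circleMap 0 (r k)) θ * f (circleMap 0 (r k) θ)) (by
          intro θ hθ
          rw [Set.uIoc_of_le (by linarith)] at hθ
          rw [norm_mul, deriv_circleMap, norm_mul, norm_I, mul_one, norm_circleMap_zero,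
            abs_of_pos hk0, hf]
          simp only [norm_mul]
          gcongr
          · rw [norm_exp, mul_re, ofReal_re, ofReal_im, mul_zero, sub_zero]
            apply Real.exp_le_exp.2
            have := (re_circleMap_le hk0.le hη hη' hθ.1.le hθ.2).2
            nlinarith
          · exact hk.2 θ hθ.1.le hθ.2)
      refine this.trans (le_of_eq ?_)
      have e : Real.exp (-(b * r k)) = Real.exp (-(r k * Real.sin η * t)) * Real.exp (β * r k) := by
        rw [← Real.exp_add, hb]; ring_nf
      rw [e]
      ring
    refine squeeze_zero_norm' hbd ?_
    have h1 : Tendsto (fun x : ℝ => x * Real.exp (-(b * x))) atTop (𝓝 0) := by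
      have := tendsto_rpow_mul_exp_neg_mul_atTop_nhds_zero 1 b hb0
      simpa using this
    simpa using (h1.comp hr).const_mul (|3 * Real.pi / 2 - η - (Real.pi / 2 + η)| * A)
  have hev : ∀ᶠ k in atTop, (∮ z in C(0, r k), f z) =
      bendIntegral γ (Real.tan η) (r k * Real.cos η) f +
        arcIntegral (r k) (Real.pi / 2 + η) (3 * Real.pi / 2 - η) f := by
    filter_upwards [hF, hr.eventually_gt_atTop 0, hr.eventually_ge_atTop (γ / Real.sin η)]
      with k hk hk0 hkγ
    rw [bendIntegral_eq_arcIntegral hγ0 hγ' hη hη' hκ' hk0 ((div_le_iff₀ hs).1 hkγ) hdf]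
    apply circleIntegral_eq_arcIntegral_add
    rw [abs_of_pos hk0]
    exact ContinuousOn.mul (by fun_prop) hk.1
  have := (hlim1.add hlim2).congr' (hev.mono fun _ h => h.symm)
  rw [add_zero] at this
  exact this.const_mul _

end IsContourFor

/-! ### Principal parts and residues -/

/-- Induction on the order of the pole: after subtracting G(α)(z - α)^{-(n+1)}, multiplication by (z
- α)^n already gives an analytic function, the divided difference of G at α. -/
theorem exists_principalPart_of_pow (α : ℂ) (n : ℕ) : ∀ (f G : ℂ → ℂ), AnalyticAt ℂ G α →
    (∀ᶠ z in 𝓝[≠] α, (z - α) ^ n * f z = G z) →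
    ∃ (q : Polynomial ℂ) (g : ℂ → ℂ), AnalyticAt ℂ g α ∧
      ∀ᶠ z in 𝓝[≠] α, f z = g z + q.eval ((z - α)⁻¹) := by
  induction n with
  | zero =>
    intro f G hG h
    exact ⟨0, G, hG, h.mono fun z hz => by simpa using hz⟩
  | succ n ih =>
    intro f G hG h
    have hdG : AnalyticAt ℂ (dslope G α) α := by
      obtain ⟨p, hp⟩ := hG
      exact ⟨_, hp.has_fpower_series_dslope_fslope⟩
    obtain ⟨q, g, hg, hq⟩ := ih (fun z => f z - G α * ((z - α)⁻¹) ^ (n + 1)) (dslope G α) hdG (by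
      filter_upwards [h, self_mem_nhdsWithin] with z hz hne
      have hne' : z - α ≠ 0 := sub_ne_zero.2 hne
      rw [dslope_of_ne _ hne, slope_def_field, ← hz, inv_pow, eq_div_iff hne', pow_succ]
      field_simp)
    refine ⟨q + Polynomial.monomial (n + 1) (G α), g, hg, ?_⟩
    filter_upwards [hq] with z hz
    rw [Polynomial.eval_add, Polynomial.eval_monomial]
    linear_combination hz

/-- The principal part of a meromorphic function, as a polynomial in `(z - α)⁻¹`. -/
theorem exists_principalPart {f : ℂ → ℂ} {α : ℂ} (hf : MeromorphicAt f α) :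
    ∃ (q : Polynomial ℂ) (g : ℂ → ℂ), AnalyticAt ℂ g α ∧
      ∀ᶠ z in 𝓝[≠] α, f z = g z + q.eval ((z - α)⁻¹) := by
  obtain ⟨n, hn⟩ := hf
  exact exists_principalPart_of_pow α n f _ hn (Eventually.of_forall fun z => rfl)

/-- The derivative of e^{zt}(z - α)^{-(n+1)} integrates to zero over the circle, which expresses a
pole of order n + 2 through one of order n + 1. The base case is Cauchy's formula. -/
theorem circleIntegral_exp_mul_inv_pow {R t : ℝ} {α : ℂ} (hα : ‖α‖ < R) (n : ℕ) :
    (∮ z in C(0, R), exp (z * t) * ((z - α)⁻¹) ^ (n + 1)) =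
      2 * Real.pi * I * ((t : ℂ) ^ n / n.factorial * exp (α * t)) := by
  have hR : 0 < R := (norm_nonneg α).trans_lt hα
  have hne : ∀ z ∈ Metric.sphere (0 : ℂ) R, z - α ≠ 0 := by
    intro z hz h0
    rw [sub_eq_zero.1 h0, mem_sphere_zero_iff_norm] at hz
    linarith
  induction n with
  | zero =>
    have := circleIntegral_sub_inv_smul_of_differentiable_on_off_countable (R := R) (c := 0)
      (w := α) (f := fun z => exp (z * t)) Set.countable_empty (by simpa using hα)
      (by fun_prop) (fun z _ => by fun_prop)
    simp only [smul_eq_mul] at this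
    simp only [zero_add, pow_one, pow_zero, Nat.factorial_zero, Nat.cast_one, div_one, one_mul]
    rw [← this]
    exact circleIntegral.integral_congr hR.le fun z _ => mul_comm _ _
  | succ n ih =>
    have hci : ∀ m : ℕ, CircleIntegrable (fun z => exp (z * t) * ((z - α)⁻¹) ^ m) 0 R := by
      intro m
      refine ContinuousOn.circleIntegrable hR.le (ContinuousOn.mul (by fun_prop) ?_)
      exact (ContinuousOn.inv₀ (by fun_prop) hne).pow m
    have h0 : (∮ z in C(0, R), (t * (exp (z * t) * ((z - α)⁻¹) ^ (n + 1)) -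
        (n + 1) * (exp (z * t) * ((z - α)⁻¹) ^ (n + 2)))) = 0 := by
      refine circleIntegral.integral_eq_zero_of_hasDerivWithinAt hR.le
        (f := fun z => exp (z * t) * ((z - α)⁻¹) ^ (n + 1)) fun z hz => ?_
      have h1 : HasDerivAt (fun z : ℂ => exp (z * t)) (exp (z * t) * t) z := by
        simpa using ((hasDerivAt_id z).mul_const (t : ℂ)).cexp
      have h2 : HasDerivAt (fun z : ℂ => (z - α)⁻¹) (-((z - α)⁻¹) ^ 2) z := by
        have := ((hasDerivAt_id z).sub_const α).inv (hne z hz)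
        refine this.congr_deriv ?_
        simp [div_eq_mul_inv]
      refine ((h1.mul (h2.pow (n + 1))).congr_deriv ?_).hasDerivWithinAt
      rw [Nat.add_sub_cancel]
      push_cast [Pi.pow_apply]
      ring
    have h1 := circleIntegral.integral_sub
      (show CircleIntegrable (fun z => (t : ℂ) * (exp (z * t) * ((z - α)⁻¹) ^ (n + 1))) 0 R from
        (hci (n + 1)).const_fun_smul (a := (t : ℂ)))
      (show CircleIntegrable (fun z => ((n : ℂ) + 1) * (exp (z * t) * ((z - α)⁻¹) ^ (n + 2))) 0 R
        from (hci (n + 2)).const_fun_smul (a := ((n : ℂ) + 1)))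
    rw [h0, circleIntegral.integral_const_mul, circleIntegral.integral_const_mul, ih] at h1
    have hn : ((n : ℂ) + 1) ≠ 0 := by exact_mod_cast Nat.succ_ne_zero n
    have hn' : (n.factorial : ℂ) ≠ 0 := by exact_mod_cast n.factorial_ne_zero
    rw [Nat.factorial_succ]
    push_cast
    apply mul_left_cancel₀ hn
    have h2 := sub_eq_zero.1 h1.symm
    rw [show n + 1 + 1 = n + 2 from rfl, ← h2]
    field_simp
    ring

/-- The polynomial `p` such that the residue of `e^{zt} q((z - α)⁻¹)` at `α` is `p(t) e^{αt}`. -/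
def residuePoly (q : Polynomial ℂ) : Polynomial ℂ :=
  -- The truncated `n - 1` at `n = 0` is harmless: the constant term has no residue and its
  -- coefficient is set to `0`.
  q.sum fun n c => Polynomial.monomial (n - 1) (if n = 0 then 0 else c / (n - 1).factorial)

theorem circleIntegral_exp_mul_eval {R t : ℝ} {α : ℂ} (hα : ‖α‖ < R) (q : Polynomial ℂ) :
    (∮ z in C(0, R), exp (z * t) * q.eval ((z - α)⁻¹)) =
      2 * Real.pi * I * ((residuePoly q).eval (t : ℂ) * exp (α * t)) := by
  have hR : 0 < R := (norm_nonneg α).trans_lt hα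
  have hne : ∀ z ∈ Metric.sphere (0 : ℂ) R, z - α ≠ 0 := by
    intro z hz h0
    rw [sub_eq_zero.1 h0, mem_sphere_zero_iff_norm] at hz
    linarith
  have hci : ∀ m : ℕ, CircleIntegrable (fun z => exp (z * t) * ((z - α)⁻¹) ^ m) 0 R := by
    intro m
    refine ContinuousOn.circleIntegrable hR.le (ContinuousOn.mul (by fun_prop) ?_)
    exact (ContinuousOn.inv₀ (by fun_prop) hne).pow m
  have e1 : ∀ z, exp (z * t) * q.eval ((z - α)⁻¹) =
      ∑ n ∈ q.support, q.coeff n * (exp (z * t) * ((z - α)⁻¹) ^ n) := by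
    intro z
    rw [Polynomial.eval_eq_sum, Polynomial.sum_def, Finset.mul_sum]
    exact Finset.sum_congr rfl fun n _ => by ring
  have hci' : ∀ n : ℕ, CircleIntegrable
      (fun z => q.coeff n * (exp (z * t) * ((z - α)⁻¹) ^ n)) 0 R := fun n =>
    (hci n).const_fun_smul (a := q.coeff n)
  simp only [e1]
  rw [circleIntegral.integral_fun_sum
    (fun n _ => hci' n), residuePoly, Polynomial.sum_def,
    Polynomial.eval_finsetSum, Finset.sum_mul, Finset.mul_sum]
  refine Finset.sum_congr rfl fun n _ => ?_
  rw [circleIntegral.integral_const_mul, Polynomial.eval_monomial]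
  rcases n with _ | n
  · have : (∮ z in C(0, R), exp (z * t) * ((z - α)⁻¹) ^ 0) = 0 := by
      refine circleIntegral_eq_zero_of_differentiable_on_off_countable hR.le Set.countable_empty
        ?_ fun z _ => ?_
      · simp only [pow_zero]; fun_prop
      · simp only [pow_zero]; fun_prop
    rw [this]; simp
  · rw [circleIntegral_exp_mul_inv_pow hα]
    simp only [Nat.add_eq_zero_iff, one_ne_zero, and_false, if_false, Nat.add_sub_cancel]
    ring

theorem analyticAt_eval_inv_sub {α z : ℂ} (hz : z ≠ α) (q : Polynomial ℂ) :
    AnalyticAt ℂ (fun z => q.eval ((z - α)⁻¹)) z := by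
  have h1 : AnalyticAt ℂ (fun z => (z - α)⁻¹) z :=
    (analyticAt_id.sub analyticAt_const).inv (sub_ne_zero.2 hz)
  exact h1.aeval_polynomial q

theorem meromorphicAt_eval_inv_sub (α z : ℂ) (q : Polynomial ℂ) :
    MeromorphicAt (fun z => q.eval ((z - α)⁻¹)) z := by
  simp only [Polynomial.eval_eq_sum, Polynomial.sum_def]
  refine MeromorphicAt.fun_sum fun n _ => ?_
  exact (MeromorphicAt.const _ _).mul
    (((MeromorphicAt.id z).sub (MeromorphicAt.const α z)).inv.pow n)

/-- The residue theorem for `e^{zt} F(z)` on a circle about the origin. -/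
theorem circleIntegral_exp_mul_eq_sum {F : ℂ → ℂ} (hF : ∀ z, MeromorphicAt F z) {R t : ℝ}
    (hR : 0 < R) {S : Finset ℂ} (hS : ∀ α ∈ S, ‖α‖ < R)
    (hFS : ∀ z, ‖z‖ ≤ R → z ∉ S → AnalyticAt ℂ F z) {q : ℂ → Polynomial ℂ} {g : ℂ → ℂ → ℂ}
    (hg : ∀ α, AnalyticAt ℂ (g α) α)
    (hq : ∀ α, ∀ᶠ z in 𝓝[≠] α, F z = g α z + (q α).eval ((z - α)⁻¹)) :
    (∮ z in C(0, R), exp (z * t) * F z) =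
      2 * Real.pi * I * ∑ α ∈ S, (residuePoly (q α)).eval (t : ℂ) * exp (α * t) := by
  -- Without its principal parts F has only removable singularities in the closed disk. The normal
  -- form H' repairs the values at the points of S, so it is analytic there and Cauchy's theorem
  -- applies to it.
  set H : ℂ → ℂ := fun z => F z - ∑ α ∈ S, (q α).eval ((z - α)⁻¹) with hH
  have hHm : MeromorphicOn H Set.univ := fun z _ =>
    (hF z).sub (MeromorphicAt.fun_sum fun α _ => meromorphicAt_eval_inv_sub α z (q α))
  have hHan : ∀ z, ‖z‖ ≤ R → z ∉ S → AnalyticAt ℂ H z := fun z hz hzS =>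
    (hFS z hz hzS).sub (Finset.analyticAt_fun_sum S fun α hα =>
      analyticAt_eval_inv_sub (fun h : z = α => hzS (by rw [h]; exact hα)) (q α))
  set H' := toMeromorphicNFOn H Set.univ with hH'
  have hNF : ∀ z, MeromorphicNFAt H' z := fun z =>
    meromorphicNFOn_toMeromorphicNFOn H Set.univ (Set.mem_univ z)
  have hord : ∀ z, meromorphicOrderAt H' z = meromorphicOrderAt H z := fun z =>
    meromorphicOrderAt_toMeromorphicNFOn hHm (Set.mem_univ z)
  have hH'an : ∀ z, ‖z‖ ≤ R → AnalyticAt ℂ H' z := by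
    intro z hz
    rw [← (hNF z).meromorphicOrderAt_nonneg_iff_analyticAt, hord]
    by_cases hzS : z ∈ S
    · have hG : AnalyticAt ℂ (fun w => g z w - ∑ α ∈ S.erase z, (q α).eval ((w - α)⁻¹)) z :=
        (hg z).sub (Finset.analyticAt_fun_sum _ fun α hα =>
          analyticAt_eval_inv_sub (Finset.ne_of_mem_erase hα).symm (q α))
      rw [meromorphicOrderAt_congr (f₂ := fun w => g z w - ∑ α ∈ S.erase z,
        (q α).eval ((w - α)⁻¹))]
      · exact hG.meromorphicOrderAt_nonneg
      · filter_upwards [hq z] with w hw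
        rw [hH]
        simp only
        rw [hw, ← Finset.add_sum_erase S _ hzS]
        ring
    · exact (hHan z hz hzS).meromorphicOrderAt_nonneg
  have heq : ∀ z ∈ Metric.sphere (0 : ℂ) R, H' z = H z := by
    intro z hz
    rw [mem_sphere_zero_iff_norm] at hz
    have h1 := hHan z hz.le (fun h => by linarith [hS z h])
    rw [hH', toMeromorphicNFOn_eq_toMeromorphicNFAt hHm (Set.mem_univ z),
      toMeromorphicNFAt_eq_self.2 h1.meromorphicNFAt]
  have hzero : (∮ z in C(0, R), exp (z * t) * H' z) = 0 := by
    have hd : ∀ z, ‖z‖ ≤ R → DifferentiableAt ℂ (fun z => exp (z * t) * H' z) z := fun z hz =>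
      DifferentiableAt.mul (by fun_prop) (hH'an z hz).differentiableAt
    refine circleIntegral_eq_zero_of_differentiable_on_off_countable hR.le Set.countable_empty
      (fun z hz => (hd z (by simpa using hz)).continuousAt.continuousWithinAt) fun z hz => hd z ?_
    simpa using (Metric.ball_subset_closedBall hz.1)
  have hcS : ∀ α ∈ S, CircleIntegrable (fun z => exp (z * t) * (q α).eval ((z - α)⁻¹)) 0 R := by
    intro α hα
    refine ContinuousOn.circleIntegrable hR.le (ContinuousOn.mul (by fun_prop) fun z hz => ?_)
    rw [mem_sphere_zero_iff_norm] at hz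
    exact (analyticAt_eval_inv_sub (fun h => by rw [h] at hz; linarith [hS α hα])
      (q α)).continuousAt.continuousWithinAt
  have hcH : CircleIntegrable (fun z => exp (z * t) * H' z) 0 R := by
    refine ContinuousOn.circleIntegrable hR.le (ContinuousOn.mul (by fun_prop) fun z hz => ?_)
    rw [mem_sphere_zero_iff_norm] at hz
    exact (hH'an z hz.le).continuousAt.continuousWithinAt
  have hsplit : (∮ z in C(0, R), exp (z * t) * F z) = ∮ z in C(0, R), (exp (z * t) * H' z +
      ∑ α ∈ S, exp (z * t) * (q α).eval ((z - α)⁻¹)) := by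
    refine circleIntegral.integral_congr hR.le fun z hz => ?_
    rw [heq z hz, hH, ← Finset.mul_sum]
    ring
  rw [hsplit, circleIntegral.integral_add hcH (CircleIntegrable.fun_sum S hcS), hzero, zero_add,
    circleIntegral.integral_fun_sum hcS, Finset.mul_sum]
  exact Finset.sum_congr rfl fun α hα => circleIntegral_exp_mul_eval (hS α hα) (q α)

/-! ### Expansion of a function whose Laplace transform is meromorphic -/

/-- A function that is analytic in the closed right half-plane, and analytic and bounded near
infinity in a sector slightly larger than it, admits a bent contour. -/
theorem exists_isContourFor {F : ℂ → ℂ} (hright : ∀ z : ℂ, 0 ≤ z.re → AnalyticAt ℂ F z)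
    {κ R₀ M : ℝ} (hκ : 0 < κ) (hR₀ : 0 < R₀)
    (hsec : ∀ z : ℂ, R₀ ≤ ‖z‖ → -(κ * |z.im|) ≤ z.re → AnalyticAt ℂ F z ∧ ‖F z‖ ≤ M) :
    ∃ γ η M' : ℝ, IsContourFor F γ η M' := by
  obtain ⟨γ₁, hγ₁, hγ₁'⟩ : ∃ γ₁ : ℝ, 0 < γ₁ ∧
      ∀ z ∈ Metric.closedBall (0 : ℂ) R₀, -γ₁ < z.re → AnalyticAt ℂ F z := by
    -- The singular points in the disk form a compact set in Re z < 0; its rightmost point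
    -- determines a strip to the left of the axis free of singularities.
    set K : Set ℂ := Metric.closedBall (0 : ℂ) R₀ ∩ {z | AnalyticAt ℂ F z}ᶜ with hK
    have hKc : IsCompact K :=
      (isCompact_closedBall 0 R₀).inter_right (isOpen_analyticAt ℂ F).isClosed_compl
    rcases K.eq_empty_or_nonempty with hE | hne
    · refine ⟨1, one_pos, fun z hz _ => ?_⟩
      by_contra hn
      have : z ∈ K := ⟨hz, hn⟩
      rw [hE] at this
      exact this
    · obtain ⟨w, hwK, hw⟩ := hKc.exists_isMaxOn hne continuous_re.continuousOn
      have hw0 : w.re < 0 := by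
        by_contra hn
        exact hwK.2 (hright w (not_lt.1 hn))
      refine ⟨-w.re, neg_pos.2 hw0, fun z hz hzre => ?_⟩
      by_contra hn
      have : z.re ≤ w.re := hw ⟨hz, hn⟩
      linarith
  -- Inside the disk κ'|Im z| ≤ κ'R₀ ≤ γ' ≤ γ₁ keeps the region within the strip. Outside, the
  -- slanted part has slope κ' ≤ κ; on the vertical part |Re z| ≤ R₀/2, hence |Im z| ≥ R₀/2 and κ|Im
  -- z| ≥ γ', so the sector hypothesis applies in both cases.
  set γ' := min γ₁ (min (κ * R₀ / 2) (R₀ / 2)) with hγ'd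
  have hγ'0 : 0 < γ' := by positivity
  have hγ'1 : γ' ≤ γ₁ := min_le_left _ _
  have hγ'2 : γ' ≤ κ * R₀ / 2 := (min_le_right _ _).trans (min_le_left _ _)
  have hγ'3 : γ' ≤ R₀ / 2 := (min_le_right _ _).trans (min_le_right _ _)
  set κ' := min κ (γ' / R₀) with hκ'd
  have hκ'0 : 0 < κ' := by positivity
  have hκ'1 : κ' ≤ κ := min_le_left _ _
  have hκ'2 : κ' * R₀ ≤ γ' := by
    calc κ' * R₀ ≤ γ' / R₀ * R₀ := by gcongr; exact min_le_right _ _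
      _ = γ' := by field_simp
  have hin : ∀ z ∈ bendRegion γ' κ', ‖z‖ ≤ R₀ → -γ₁ < z.re := by
    intro z hz hzR
    refine lt_of_le_of_lt ?_ (show -max γ' (κ' * |z.im|) < z.re from hz)
    rw [neg_le_neg_iff, max_le_iff]
    refine ⟨hγ'1, le_trans ?_ (hκ'2.trans hγ'1)⟩
    gcongr
    exact (abs_im_le_norm z).trans hzR
  have hout : ∀ z ∈ bendRegion γ' κ', R₀ ≤ ‖z‖ → -(κ * |z.im|) ≤ z.re := by
    intro z hz hzR
    have hz : -max γ' (κ' * |z.im|) < z.re := hz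
    rcases le_or_gt 0 z.re with h0 | h0
    · exact le_trans (by rw [neg_le, neg_zero]; positivity) h0
    rcases le_total γ' (κ' * |z.im|) with h1 | h1
    · rw [max_eq_right h1] at hz
      refine le_trans ?_ hz.le
      rw [neg_le_neg_iff]
      gcongr
    · rw [max_eq_left h1] at hz
      have h2 := norm_le_abs_re_add_abs_im z
      rw [abs_of_neg h0] at h2
      have h3 : R₀ / 2 ≤ |z.im| := by linarith
      nlinarith
  -- Halving both parameters provides the strict room that `IsContourFor.diff` asks for.
  have hreg : ∀ z : ℂ, -max (γ' / 2) (κ' / 2 * |z.im|) ≤ z.re → z ∈ bendRegion γ' κ' := fun z hz =>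
    mem_bendRegion_of_le (half_lt_self hγ'0) (half_pos hγ'0) (half_lt_self hκ'0) hz
  have hanreg : ∀ z ∈ bendRegion γ' κ', AnalyticAt ℂ F z := by
    intro z hz
    rcases le_total ‖z‖ R₀ with h | h
    · exact hγ₁' z (by simpa using h) (hin z hz h)
    · exact (hsec z h (hout z hz h)).1
  have hcpt : IsCompact (Metric.closedBall (0 : ℂ) R₀ ∩
      {z | -max (γ' / 2) (κ' / 2 * |z.im|) ≤ z.re}) :=
    (isCompact_closedBall 0 R₀).inter_right
      (isClosed_le (f := fun z : ℂ => -max (γ' / 2) (κ' / 2 * |z.im|)) (g := fun z => z.re)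
        (by fun_prop) (by fun_prop))
  obtain ⟨C, hC⟩ := hcpt.exists_bound_of_continuousOn (f := F)
    (fun z hz => (hanreg z (hreg z hz.2)).continuousAt.continuousWithinAt)
  have htan : Real.tan (Real.arctan (κ' / 2)) = κ' / 2 := Real.tan_arctan _
  refine ⟨γ' / 2, Real.arctan (κ' / 2), max C M, half_pos hγ'0,
    Real.arctan_pos.2 (half_pos hκ'0), Real.arctan_lt_pi_div_two _,
    ⟨γ', half_lt_self hγ'0, κ', by rw [htan]; exact half_lt_self hκ'0,
      fun z hz => (hanreg z hz).differentiableAt.differentiableWithinAt⟩, fun z hz => ?_⟩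
  rw [htan] at hz
  rcases le_total ‖z‖ R₀ with h | h
  · exact (hC z ⟨by simpa using h, hz⟩).trans (le_max_left _ _)
  · exact (hsec z h (hout z (hreg z hz) h)).2.trans (le_max_right _ _)

/-- The poles of a meromorphic function in a bounded region are finite in number. -/
theorem finite_not_analyticAt {F : ℂ → ℂ} (hF : ∀ z, MeromorphicAt F z) (R : ℝ) :
    ({z | ¬AnalyticAt ℂ F z} ∩ Metric.closedBall 0 R).Finite := by
  by_contra hinf
  obtain ⟨z, -, hz⟩ := Set.Infinite.exists_accPt_of_subset_isCompact hinf
    (isCompact_closedBall 0 R) Set.inter_subset_right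
  rw [accPt_iff_frequently_nhdsNE] at hz
  refine hz ?_
  filter_upwards [(hF z).eventually_analyticAt] with w hw hn
  exact hn.1 hw

/-- Expansion into resonance poles, and exponential decay, of a function whose Laplace transform is
meromorphic in the plane. -/
theorem resonance_expansion {F : ℂ → ℂ} (hNF : ∀ z, MeromorphicNFAt F z)
    (hright : ∀ z : ℂ, 0 ≤ z.re → AnalyticAt ℂ F z) {κ R₀ M : ℝ} (hκ : 0 < κ) (hR₀ : 0 < R₀)
    (hsec : ∀ z : ℂ, R₀ ≤ ‖z‖ → -(κ * |z.im|) ≤ z.re → AnalyticAt ℂ F z ∧ ‖F z‖ ≤ M)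
    {r : ℕ → ℝ} (hr : Tendsto r atTop atTop) {A β : ℝ} (hβ : 0 < β)
    (harc : ∀ᶠ k in atTop, ∀ z : ℂ, ‖z‖ = r k → z.re ≤ -(κ * |z.im|) →
      AnalyticAt ℂ F z ∧ ‖F z‖ ≤ A * Real.exp (β * r k))
    {φ : ℝ → ℂ} (hφ : ContinuousOn φ (Set.Ici 0)) {c₀ : ℝ}
    (hL : ∀ l : ℂ, c₀ < l.re → IntegrableOn (fun t : ℝ => exp (-l * t) * φ t) (Set.Ioi 0) ∧
      ∫ t in Set.Ioi (0 : ℝ), exp (-l * t) * φ t = F l)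
    {poles : Set ℂ} (hpoles : poles = {α | α.re < 0 ∧ meromorphicOrderAt F α < 0}) :
    ((∃ t : ℝ, 0 ≤ t ∧ φ t ≠ 0) → poles.Nonempty) ∧
    (∃ hfin : ∀ R : ℝ, (poles ∩ {α | ‖α‖ < R}).Finite,
      ∃ t₀ : ℝ, 0 < t₀ ∧ ∃ p : ℂ → Polynomial ℂ, ∀ t : ℝ, t₀ < t →
        Tendsto (fun k => ∑ α ∈ (hfin (r k)).toFinset, (p α).eval (t : ℂ) * exp (α * t)) atTop
          (𝓝 (φ t))) ∧
    (∃ C γ : ℝ, 0 < γ ∧ ∀ t : ℝ, 0 ≤ t → ‖φ t‖ ≤ C * Real.exp (-γ * t)) := by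
  obtain ⟨γ, η, M', hcon⟩ := exists_isContourFor hright hκ hR₀ hsec
  have hs : 0 < Real.sin η :=
    Real.sin_pos_of_pos_of_lt_pi hcon.η_pos (by linarith [Real.pi_pos, hcon.η_lt])
  have hmero : ∀ z, MeromorphicAt F z := fun z => (hNF z).meromorphicAt
  -- In normal form a point is a pole exactly when F is not analytic there, so the negative-order
  -- condition can be traded for non-analyticity.
  have hpole : ∀ z, z ∈ poles ↔ ¬AnalyticAt ℂ F z := by
    intro z
    rw [hpoles, ← (hNF z).meromorphicOrderAt_nonneg_iff_analyticAt, not_le]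
    refine ⟨fun h => h.2, fun h => ⟨?_, h⟩⟩
    by_contra hn
    exact absurd (hright z (not_lt.1 hn)).meromorphicOrderAt_nonneg (not_le.2 h)
  have hfin : ∀ R : ℝ, (poles ∩ {α | ‖α‖ < R}).Finite := fun R =>
    (finite_not_analyticAt hmero R).subset fun z hz =>
      ⟨(hpole z).1 hz.1, by simpa using (show ‖z‖ < R from hz.2).le⟩
  have hφΨ : ∀ t : ℝ, 0 < t → φ t = invLaplace F γ (Real.tan η) t := fun t ht =>
    hcon.eq_invLaplace hφ hL ht
  -- the expansion
  choose q g hg hq using fun α => exists_principalPart (hmero α)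
  -- The time beyond which e^{zt} beats e^{β|z|} on the left arcs.
  set t₀ : ℝ := β / Real.sin η with ht₀
  have ht₀0 : 0 < t₀ := by positivity
  have hM0 : 0 ≤ M := by
    refine (norm_nonneg _).trans (hsec (R₀ : ℂ) ?_ ?_).2
    · rw [norm_real]; exact le_abs_self _
    · simpa using hR₀.le
  have hcirc : ∀ᶠ k in atTop, ∀ z : ℂ, ‖z‖ = r k → AnalyticAt ℂ F z := by
    filter_upwards [harc, hr.eventually_ge_atTop R₀] with k hk hkR z hz
    rcases le_total z.re (-(κ * |z.im|)) with h | h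
    · exact (hk z hz h).1
    · exact (hsec z (hz ▸ hkR) h).1
  have hexp : ∀ t : ℝ, t₀ < t →
      Tendsto (fun k => ∑ α ∈ (hfin (r k)).toFinset,
        (residuePoly (q α)).eval (t : ℂ) * exp (α * t)) atTop (𝓝 (φ t)) := by
    intro t ht
    have ht0 : 0 < t := ht₀0.trans ht
    rw [hφΨ t ht0]
    refine (hcon.tendsto_circleIntegral hr (A := max A M) (β := β) ?_ ht0
      ((div_lt_iff₀ hs).1 ht)).congr' ?_
    · filter_upwards [harc, hcirc, hr.eventually_ge_atTop R₀] with k hk hkc hkR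
      have hk0 : 0 < r k := hR₀.trans_le hkR
      refine ⟨fun z hz => (hkc z (by simpa using hz)).continuousAt.continuousWithinAt,
        fun θ _ _ => ?_⟩
      have hn : ‖circleMap 0 (r k) θ‖ = r k := by rw [norm_circleMap_zero, abs_of_pos hk0]
      have hE : 1 ≤ Real.exp (β * r k) := Real.one_le_exp (by positivity)
      rcases le_total (circleMap 0 (r k) θ).re (-(κ * |(circleMap 0 (r k) θ).im|)) with h | h
      · refine (hk _ hn h).2.trans ?_
        gcongr
        exact le_max_left _ _
      · refine (hsec _ (by rw [hn]; exact hkR) h).2.trans ?_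
        have := le_max_right A M
        nlinarith
    · filter_upwards [hcirc, hr.eventually_gt_atTop 0] with k hkc hk0
      rw [circleIntegral_exp_mul_eq_sum hmero hk0 (S := (hfin (r k)).toFinset) ?_ ?_ hg hq]
      · rw [inv_mul_cancel_left₀ two_pi_I_ne_zero]
      · intro α hα
        rw [Set.Finite.mem_toFinset] at hα
        exact hα.2
      · intro z hz hzS
        rcases hz.eq_or_lt with h | h
        · exact hkc z h
        · by_contra hn
          exact hzS ((Set.Finite.mem_toFinset _).2 ⟨(hpole z).2 hn, h⟩)
  refine ⟨?_, ⟨hfin, t₀, ht₀0, fun α => residuePoly (q α), hexp⟩, ?_⟩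
  · rintro ⟨t, ht, hne⟩
    by_contra hemp
    rw [Set.not_nonempty_iff_eq_empty] at hemp
    -- Without poles every partial sum in the expansion is empty, so the limit is 0 for s > t₀.
    -- Analyticity in time extends this to s > 0, and continuity of φ to 0.
    have hzero : ∀ s : ℝ, t₀ < s → invLaplace F γ (Real.tan η) s = 0 := by
      intro s hs'
      rw [← hφΨ s (ht₀0.trans hs')]
      refine tendsto_nhds_unique (hexp s hs') ?_
      have : ∀ k, (hfin (r k)).toFinset = ∅ := by
        intro k
        rw [Set.Finite.toFinset_eq_empty, hemp, Set.empty_inter]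
      simp [this]
    have hpos : ∀ s : ℝ, 0 < s → φ s = 0 := fun s hs' => by
      rw [hφΨ s hs', hcon.invLaplace_eq_zero hzero hs']
    rcases ht.eq_or_lt with rfl | ht
    · apply hne
      have h1 : Tendsto φ (𝓝[>] 0) (𝓝 (φ 0)) :=
        (hφ 0 Set.self_mem_Ici).mono_left (nhdsWithin_mono 0 Set.Ioi_subset_Ici_self)
      refine tendsto_nhds_unique h1 (tendsto_const_nhds.congr' ?_)
      filter_upwards [self_mem_nhdsWithin] with s hs'
      exact (hpos s hs').symm
    · exact hne (hpos t ht)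
  · obtain ⟨C, hC⟩ := hcon.norm_invLaplace_le
    obtain ⟨B, hB⟩ := isCompact_Icc.exists_bound_of_continuousOn
      (hφ.mono (Set.Icc_subset_Ici_self : Set.Icc (0 : ℝ) 1 ⊆ Set.Ici 0))
    have hB0 : 0 ≤ B := (norm_nonneg _).trans (hB 0 (by simp))
    refine ⟨max C (B * Real.exp γ), γ, hcon.γ_pos, fun t ht => ?_⟩
    rcases le_total 1 t with h1 | h1
    · rw [hφΨ t (by linarith)]
      refine (hC t h1).trans ?_
      gcongr
      exact le_max_left _ _
    · calc ‖φ t‖ ≤ B := hB t ⟨ht, h1⟩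
        _ ≤ B * (Real.exp γ * Real.exp (-γ * t)) := by
          refine le_mul_of_one_le_right hB0 ?_
          rw [← Real.exp_add]
          apply Real.one_le_exp
          nlinarith [hcon.γ_pos]
        _ = B * Real.exp γ * Real.exp (-γ * t) := by ring
        _ ≤ _ := by gcongr; exact le_max_right _ _

/-! ### Cauchy transforms and their continuation -/

/-- A Cauchy-type integral is analytic off the closure of the values of `c`. -/
theorem analyticAt_integral_inv_sub {X : Type*} [MeasurableSpace X] {μ : Measure X} {k c : X → ℂ}
    (hk : Integrable k μ) (hc : AEStronglyMeasurable c μ) {z₀ : ℂ} {d : ℝ} (hd : 0 < d)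
    (hdist : ∀ᵐ a ∂μ, d ≤ ‖z₀ - c a‖) :
    AnalyticAt ℂ (fun z => ∫ a, (z - c a)⁻¹ * k a ∂μ) z₀ := by
  rw [analyticAt_iff_eventually_differentiableAt]
  filter_upwards [Metric.ball_mem_nhds z₀ (half_pos hd)] with z₁ hz₁
  have hdist' : ∀ᵐ a ∂μ, ∀ z ∈ Metric.ball z₀ (d / 2), d / 2 ≤ ‖z - c a‖ := by
    filter_upwards [hdist] with a ha z hz
    rw [Metric.mem_ball, dist_eq_norm] at hz
    have h1 := norm_sub_norm_le (z₀ - c a) (z₀ - z)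
    have h2 : z₀ - c a - (z₀ - z) = z - c a := by ring
    rw [h2, norm_sub_rev z₀ z] at h1
    linarith
  have hmeas : ∀ z, AEStronglyMeasurable (fun a => (z - c a)⁻¹ * k a) μ := fun z =>
    ((aestronglyMeasurable_const.sub hc).aemeasurable.inv.aestronglyMeasurable).mul
      hk.aestronglyMeasurable
  have hinv : ∀ z a, d / 2 ≤ ‖z - c a‖ → ‖(z - c a)⁻¹‖ ≤ (d / 2)⁻¹ := by
    intro z a h
    rw [norm_inv]
    exact inv_anti₀ (half_pos hd) h
  have key := hasDerivAt_integral_of_dominated_loc_of_deriv_le (μ := μ) (𝕜 := ℂ)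
    (F := fun z a => (z - c a)⁻¹ * k a) (F' := fun z a => -((z - c a)⁻¹) ^ 2 * k a)
    (bound := fun a => ((d / 2)⁻¹) ^ 2 * ‖k a‖) (x₀ := z₁)
    (Metric.isOpen_ball.mem_nhds hz₁) (Eventually.of_forall hmeas)
    (by
      refine (hk.norm.const_mul ((d / 2)⁻¹)).mono' (hmeas z₁) ?_
      filter_upwards [hdist'] with a ha
      rw [norm_mul]
      gcongr
      exact hinv _ _ (ha z₁ hz₁))
    (((aestronglyMeasurable_const.sub hc).aemeasurable.inv.pow_const 2).neg.aestronglyMeasurable.mul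
      hk.aestronglyMeasurable)
    (by
      filter_upwards [hdist'] with a ha z hz
      rw [norm_mul, norm_neg, norm_pow]
      gcongr
      exact hinv _ _ (ha z hz))
    (hk.norm.const_mul _)
    (by
      filter_upwards [hdist'] with a ha z hz
      have hne : z - c a ≠ 0 := norm_pos_iff.1 ((half_pos hd).trans_le (ha z hz))
      have h1 := (((hasDerivAt_id z).sub_const (c a)).inv hne).mul_const (k a)
      refine h1.congr_deriv ?_
      simp [div_eq_mul_inv])
  exact key.2.differentiableAt

/-- The Cauchy transform `∫ n(ω) / (z - iω) dω`. -/
def cauchyTransform (n : ℂ → ℂ) (z : ℂ) : ℂ := ∫ ω : ℝ, (z - I * ω)⁻¹ * n ω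

theorem abs_re_le_norm_sub_I_mul (z : ℂ) (ω : ℝ) : |z.re| ≤ ‖z - I * ω‖ := by
  have := abs_re_le_norm (z - I * ω)
  simpa using this

theorem analyticAt_cauchyTransform {n : ℂ → ℂ} (hn : Integrable fun ω : ℝ => n ω) {z : ℂ}
    (hz : z.re ≠ 0) : AnalyticAt ℂ (cauchyTransform n) z :=
  analyticAt_integral_inv_sub hn (by fun_prop) (abs_pos.2 hz)
    (Eventually.of_forall fun ω => abs_re_le_norm_sub_I_mul z ω)

/-- As a function of ω the integrand has its pole at -iz, with imaginary part -Re z. For Re z > 0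
the pole is below the real line and the segment may be pushed onto the upper semicircle. For Re z <
0 it may be pushed onto the lower one, and changing to the upper costs the residue at -iz. The minus
sign reflects that the upper semicircle runs from y₀ + ρ to y₀ - ρ. The common right-hand side is
analytic in z near iy₀ and is the continuation. -/
theorem cauchyTransform_local_aux {n : ℂ → ℂ} {y₀ ρ : ℝ} (hρ : 0 < ρ)
    (hn : ∀ ζ ∈ Metric.ball (y₀ : ℂ) (2 * ρ), AnalyticAt ℂ n ζ) {z : ℂ}
    (hz : ‖z - I * y₀‖ < ρ) :
    (0 < z.re → ∫ ω in (y₀ - ρ)..(y₀ + ρ), (z - I * ω)⁻¹ * n ω =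
      -∫ θ in (0 : ℝ)..Real.pi, (z - I * circleMap y₀ ρ θ)⁻¹ *
        (deriv (circleMap y₀ ρ) θ * n (circleMap y₀ ρ θ))) ∧
    (z.re < 0 → (∫ ω in (y₀ - ρ)..(y₀ + ρ), (z - I * ω)⁻¹ * n ω) + 2 * Real.pi * n (-I * z) =
      -∫ θ in (0 : ℝ)..Real.pi, (z - I * circleMap y₀ ρ θ)⁻¹ *
        (deriv (circleMap y₀ ρ) θ * n (circleMap y₀ ρ θ))) := by
  set f : ℂ → ℂ := fun ζ => (z - I * ζ)⁻¹ * n ζ with hf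
  have hnd : DifferentiableOn ℂ n (Metric.ball (y₀ : ℂ) (2 * ρ)) := fun ζ hζ =>
    (hn ζ hζ).differentiableAt.differentiableWithinAt
  have hpi := Real.pi_pos
  have hsub : Metric.closedBall (y₀ : ℂ) ρ ⊆ Metric.ball (y₀ : ℂ) (2 * ρ) :=
    Metric.closedBall_subset_ball (by linarith)
  have hcirc : ∀ θ, circleMap (y₀ : ℂ) ρ θ ∈ Metric.ball (y₀ : ℂ) (2 * ρ) := fun θ =>
    hsub (Metric.sphere_subset_closedBall (circleMap_mem_sphere _ hρ.le θ))
  have hseg : ∀ ω ∈ Set.uIcc (y₀ - ρ) (y₀ + ρ), (ω : ℂ) ∈ Metric.ball (y₀ : ℂ) (2 * ρ) := by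
    intro ω hω
    rw [Set.uIcc_of_le (by linarith)] at hω
    apply hsub
    rw [Metric.mem_closedBall, dist_eq_norm, ← ofReal_sub, norm_real, Real.norm_eq_abs, abs_le]
    exact ⟨by linarith [hω.1], by linarith [hω.2]⟩
  have him : ∀ θ, (circleMap (y₀ : ℂ) ρ θ).im = ρ * Real.sin θ := by
    intro θ
    simp [circleMap, exp_ofReal_mul_I_re, exp_ofReal_mul_I_im]
  have hofderiv : ∀ x : ℝ, HasDerivAt (fun x : ℝ => (x : ℂ)) 1 x := fun x =>
    ofRealCLM.hasDerivAt (x := x)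
  have e0 : circleMap (y₀ : ℂ) ρ 0 = ((y₀ + ρ : ℝ) : ℂ) := by simp [circleMap]
  have e1 : circleMap (y₀ : ℂ) ρ Real.pi = ((y₀ - ρ : ℝ) : ℂ) := by
    simp [circleMap, sub_eq_add_neg]
  have e2 : circleMap (y₀ : ℂ) ρ (2 * Real.pi) = ((y₀ + ρ : ℝ) : ℂ) := by
    have := periodic_circleMap (y₀ : ℂ) ρ 0
    rw [zero_add] at this
    rw [this, e0]
  -- path independence on convex subsets
  have hpath : ∀ (U : Set ℂ), IsOpen U → StarConvex ℝ (y₀ : ℂ) U →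
      U ⊆ Metric.ball (y₀ : ℂ) (2 * ρ) → (∀ ζ ∈ U, z - I * ζ ≠ 0) →
      (∀ ω ∈ Set.uIcc (y₀ - ρ) (y₀ + ρ), (ω : ℂ) ∈ U) → ∀ a b : ℝ,
      (∀ θ ∈ Set.uIcc a b, circleMap (y₀ : ℂ) ρ θ ∈ U) →
      ∃ P : ℂ → ℂ, (∫ ω in (y₀ - ρ)..(y₀ + ρ), (z - I * ω)⁻¹ * n ω =
          P ((y₀ + ρ : ℝ) : ℂ) - P ((y₀ - ρ : ℝ) : ℂ)) ∧
        ∫ θ in a..b, deriv (circleMap (y₀ : ℂ) ρ) θ * f (circleMap (y₀ : ℂ) ρ θ) =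
          P (circleMap y₀ ρ b) - P (circleMap y₀ ρ a) := by
    intro U hU hstar hUb hne hω a b hθ
    have hfd : DifferentiableOn ℂ f U :=
      DifferentiableOn.mul (DifferentiableOn.inv (by fun_prop) hne) (hnd.mono hUb)
    obtain ⟨P, hP⟩ := exists_primitive_of_starConvex hU hstar hfd
    refine ⟨P, ?_, ?_⟩
    · have := integral_comp_curve hP (γ := fun x : ℝ => (x : ℂ)) (γ' := fun _ => 1)
        (a := y₀ - ρ) (b := y₀ + ρ) Set.countable_empty (by fun_prop) hω
        (fun x _ => hofderiv x) (by
          simp only [one_mul]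
          exact (hfd.continuousOn.comp (by fun_prop) hω).intervalIntegrable)
      simpa only [one_mul] using this
    · refine integral_comp_curve hP (s := ∅) Set.countable_empty
        (continuous_circleMap _ ρ).continuousOn hθ
        (fun x _ => (differentiable_circleMap _ ρ x).hasDerivAt) ?_
      refine ContinuousOn.intervalIntegrable (ContinuousOn.mul ?_
        (hfd.continuousOn.comp (continuous_circleMap _ ρ).continuousOn hθ))
      rw [show deriv (circleMap (y₀ : ℂ) ρ) = fun θ => circleMap 0 ρ θ * I from
        funext fun θ => deriv_circleMap _ ρ θ]
      fun_prop
  have hcomm : ∀ θ : ℝ, (z - I * circleMap y₀ ρ θ)⁻¹ *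
        (deriv (circleMap y₀ ρ) θ * n (circleMap y₀ ρ θ)) =
        deriv (circleMap y₀ ρ) θ * f (circleMap y₀ ρ θ) := fun θ => by rw [hf]; ring
  simp only [hcomm]
  constructor
  · intro hre
    obtain ⟨P, h1, h2⟩ := hpath (Metric.ball (y₀ : ℂ) (2 * ρ) ∩ {ζ | -z.re < ζ.im})
      (Metric.isOpen_ball.inter (isOpen_lt continuous_const continuous_im))
      (((convex_ball _ _).inter (convex_halfSpace_im_gt _)).starConvex
        ⟨Metric.mem_ball_self (by linarith), by simpa using hre⟩) Set.inter_subset_left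
      (fun ζ hζ h0 => by
        have h3 := congrArg re h0
        simp at h3
        have h4 : -z.re < ζ.im := hζ.2
        linarith)
      (fun ω hω => ⟨hseg ω hω, by simpa using hre⟩) 0 Real.pi
      (fun θ hθ => by
        rw [Set.uIcc_of_le hpi.le] at hθ
        refine ⟨hcirc θ, ?_⟩
        change -z.re < _
        rw [him]
        have := Real.sin_nonneg_of_nonneg_of_le_pi hθ.1 hθ.2
        nlinarith)
    rw [h1, h2, e0, e1]
    ring
  · intro hre
    obtain ⟨P, h1, h2⟩ := hpath (Metric.ball (y₀ : ℂ) (2 * ρ) ∩ {ζ | ζ.im < -z.re})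
      (Metric.isOpen_ball.inter (isOpen_lt continuous_im continuous_const))
      (((convex_ball _ _).inter (convex_halfSpace_im_lt _)).starConvex
        ⟨Metric.mem_ball_self (by linarith), by simpa using hre⟩) Set.inter_subset_left
      (fun ζ hζ h0 => by
        have h3 := congrArg re h0
        simp at h3
        have h4 : ζ.im < -z.re := hζ.2
        linarith)
      (fun ω hω => ⟨hseg ω hω, by simpa using hre⟩) Real.pi (2 * Real.pi)
      (fun θ hθ => by
        rw [Set.uIcc_of_le (by linarith)] at hθ
        refine ⟨hcirc θ, ?_⟩
        change _ < -z.re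
        rw [him]
        have h3 := Real.sin_nonneg_of_nonneg_of_le_pi (x := θ - Real.pi) (by linarith [hθ.1])
          (by linarith [hθ.2])
        rw [Real.sin_sub_pi] at h3
        nlinarith)
    rw [e1, e2, ← h1] at h2
    have hw : ‖-I * z - y₀‖ < ρ := by
      have : -I * z - y₀ = -I * (z - I * y₀) := by
        linear_combination (-(y₀ : ℂ)) * I_sq
      rw [this, norm_mul, norm_neg, norm_I, one_mul]
      exact hz
    have hzf : ∀ ζ, z - I * ζ = -I * (ζ - (-I * z)) := fun ζ => by
      linear_combination z * I_sq
    have hne : ∀ θ, z - I * circleMap y₀ ρ θ ≠ 0 := by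
      intro θ h0
      rw [hzf, mul_eq_zero, or_iff_right (neg_ne_zero.2 I_ne_zero)] at h0
      have h3 := circleMap_mem_sphere (y₀ : ℂ) hρ.le θ
      rw [sub_eq_zero.1 h0, mem_sphere_iff_norm] at h3
      linarith
    have hInt : ∀ a b : ℝ, IntervalIntegrable
        (fun θ => deriv (circleMap y₀ ρ) θ * f (circleMap y₀ ρ θ)) volume a b := by
      intro a b
      apply ContinuousOn.intervalIntegrable
      rw [show deriv (circleMap (y₀ : ℂ) ρ) = fun θ => circleMap 0 ρ θ * I from
        funext fun θ => deriv_circleMap _ ρ θ]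
      refine ContinuousOn.mul (by fun_prop) (ContinuousOn.mul
        (ContinuousOn.inv₀ (by fun_prop) fun θ _ => hne θ) ?_)
      exact hnd.continuousOn.comp (continuous_circleMap _ ρ).continuousOn fun θ _ => hcirc θ
    have hsplit := intervalIntegral.integral_add_adjacent_intervals (hInt 0 Real.pi)
      (hInt Real.pi (2 * Real.pi))
    have hcauchy := circleIntegral_sub_inv_smul_of_differentiable_on_off_countable (R := ρ)
      (c := y₀) (w := -I * z) (f := n) Set.countable_empty
      (by rwa [Metric.mem_ball, dist_eq_norm]) (hnd.continuousOn.mono hsub)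
      (fun ζ hζ => (hn ζ (hsub (Metric.ball_subset_closedBall hζ.1))).differentiableAt)
    -- Since (z - iζ)⁻¹ = i(ζ + iz)⁻¹, the residue contributes i · 2πi = -2π.
    have hfull : ∫ θ in (0 : ℝ)..2 * Real.pi, deriv (circleMap y₀ ρ) θ * f (circleMap y₀ ρ θ) =
        -2 * Real.pi * n (-I * z) := by
      have h3 : ∫ θ in (0 : ℝ)..2 * Real.pi, deriv (circleMap y₀ ρ) θ * f (circleMap y₀ ρ θ) =
          I * ∮ ζ in C(y₀, ρ), (ζ - -I * z)⁻¹ • n ζ := by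
        rw [circleIntegral, ← intervalIntegral.integral_const_mul]
        refine intervalIntegral.integral_congr fun θ _ => ?_
        simp only [smul_eq_mul, hf]
        rw [hzf, mul_inv, inv_neg, inv_I, neg_neg]
        ring
      rw [h3, hcauchy, smul_eq_mul]
      linear_combination (2 * Real.pi * n (-I * z)) * I_sq
    rw [hfull, h2] at hsplit
    linear_combination hsplit

/-- The Cauchy transform continues analytically from the right half-plane through every point of
the imaginary axis near which the density is analytic. -/
theorem exists_cauchyTransform_continuation {n : ℂ → ℂ} (hInt : Integrable fun ω : ℝ => n ω)
    {y₀ : ℝ} (hn : AnalyticAt ℂ n y₀) :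
    ∃ E : ℂ → ℂ, AnalyticAt ℂ E (I * y₀) ∧ ∀ᶠ z in 𝓝 (I * (y₀ : ℂ)),
      (0 < z.re → E z = cauchyTransform n z) ∧
      (z.re < 0 → E z = cauchyTransform n z + 2 * Real.pi * n (-I * z)) := by
  obtain ⟨ε, hε, hball⟩ := Metric.eventually_nhds_iff_ball.1 hn.eventually_analyticAt
  set ρ := ε / 2 with hρd
  have hρ : 0 < ρ := half_pos hε
  have hball' : ∀ ζ ∈ Metric.ball (y₀ : ℂ) (2 * ρ), AnalyticAt ℂ n ζ := by
    intro ζ hζ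
    apply hball
    rwa [hρd, mul_div_cancel₀ _ two_ne_zero] at hζ
  have hnc : ContinuousOn n (Metric.ball (y₀ : ℂ) (2 * ρ)) := fun ζ hζ =>
    (hball' ζ hζ).continuousAt.continuousWithinAt
  set s : Set ℝ := Set.Ioc (y₀ - ρ) (y₀ + ρ) with hs
  refine ⟨fun z => (∫ ω in sᶜ, (z - I * (ω : ℝ))⁻¹ * n ω) -
    ∫ θ in Set.Ioc (0 : ℝ) Real.pi, (z - I * circleMap y₀ ρ θ)⁻¹ *
        (deriv (circleMap y₀ ρ) θ * n (circleMap y₀ ρ θ)), ?_, ?_⟩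
  · refine AnalyticAt.sub ?_ ?_
    · refine analyticAt_integral_inv_sub hInt.integrableOn (by fun_prop) hρ ?_
      refine (ae_restrict_iff' measurableSet_Ioc.compl).2 (Eventually.of_forall fun ω hω => ?_)
      rw [← mul_sub, norm_mul, norm_I, one_mul, ← ofReal_sub, norm_real, Real.norm_eq_abs]
      by_contra hlt
      rw [not_le, abs_lt] at hlt
      exact hω ⟨by linarith, by linarith⟩
    · refine analyticAt_integral_inv_sub (k := fun θ => deriv (circleMap y₀ ρ) θ *
        n (circleMap y₀ ρ θ)) (c := fun θ => I * circleMap y₀ ρ θ) ?_ (by fun_prop) hρ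
        (Eventually.of_forall fun θ => ?_)
      · refine (ContinuousOn.integrableOn_Icc ?_).mono_set Set.Ioc_subset_Icc_self
        rw [show deriv (circleMap (y₀ : ℂ) ρ) = fun θ => circleMap 0 ρ θ * I from
          funext fun θ => deriv_circleMap _ ρ θ]
        refine ContinuousOn.mul (by fun_prop) (hnc.comp (by fun_prop) fun θ _ => ?_)
        refine Metric.closedBall_subset_ball (by linarith)
          (Metric.sphere_subset_closedBall (circleMap_mem_sphere _ hρ.le θ))
      · rw [← mul_sub, norm_mul, norm_I, one_mul, norm_sub_rev]
        have := circleMap_mem_sphere (y₀ : ℂ) hρ.le θ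
        rw [mem_sphere_iff_norm] at this
        exact this.ge
  · filter_upwards [Metric.ball_mem_nhds (I * (y₀ : ℂ)) hρ] with z hz
    rw [Metric.mem_ball, dist_eq_norm] at hz
    obtain ⟨h1, h2⟩ := cauchyTransform_local_aux hρ hball' hz
    rw [intervalIntegral.integral_of_le (by linarith), intervalIntegral.integral_of_le
      Real.pi_pos.le] at h1 h2
    have hsplit : z.re ≠ 0 → cauchyTransform n z = (∫ ω in s, (z - I * (ω : ℝ))⁻¹ * n ω) +
        ∫ ω in sᶜ, (z - I * (ω : ℝ))⁻¹ * n ω := by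
      intro hre
      refine (integral_add_compl measurableSet_Ioc ?_).symm
      refine Integrable.bdd_mul (c := |z.re|⁻¹) hInt ?_ (Eventually.of_forall fun ω => ?_)
      · exact (Measurable.inv (by fun_prop)).aestronglyMeasurable
      · rw [norm_inv]
        exact inv_anti₀ (abs_pos.2 hre) (abs_re_le_norm_sub_I_mul z ω)
    refine ⟨fun hre => ?_, fun hre => ?_⟩
    · rw [hsplit hre.ne', h1 hre]
      ring
    · rw [hsplit hre.ne]
      have := h2 hre
      linear_combination -this

/-- The continuation of the Cauchy transform from the right half-plane to the plane. -/
def cauchyExt (n : ℂ → ℂ) (z : ℂ) : ℂ :=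
  if 0 < z.re then cauchyTransform n z
  else if z.re < 0 then cauchyTransform n z + 2 * Real.pi * n (-I * z)
  else limUnder (𝓝[{w | 0 < w.re}] z) (cauchyTransform n)

theorem cauchyExt_of_pos (n : ℂ → ℂ) {z : ℂ} (hz : 0 < z.re) :
    cauchyExt n z = cauchyTransform n z := if_pos hz

theorem cauchyExt_of_neg (n : ℂ → ℂ) {z : ℂ} (hz : z.re < 0) :
    cauchyExt n z = cauchyTransform n z + 2 * Real.pi * n (-I * z) := by
  rw [cauchyExt, if_neg (not_lt.2 hz.le), if_pos hz]

theorem nhdsWithin_re_pos_neBot {z : ℂ} (hz : z.re = 0) : (𝓝[{w : ℂ | 0 < w.re}] z).NeBot := by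
  rw [← mem_closure_iff_nhdsWithin_neBot, closure_setOfPred_lt_re]
  exact hz.ge

/-- The local continuation E agrees with `cauchyExt` on both sides by construction. It also does so
at nearby points of the axis, where E is continuous and `cauchyExt` is the limit from the right. -/
theorem analyticAt_cauchyExt_axis {n : ℂ → ℂ} (hInt : Integrable fun ω : ℝ => n ω)
    {y₀ : ℝ} (hn : AnalyticAt ℂ n y₀) : AnalyticAt ℂ (cauchyExt n) (I * y₀) := by
  obtain ⟨E, hE, hev⟩ := exists_cauchyTransform_continuation hInt hn
  refine hE.congr ?_
  filter_upwards [hev.eventually_nhds, hE.eventually_analyticAt] with z hz hEz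
  rcases lt_trichotomy z.re 0 with h | h | h
  · rw [cauchyExt_of_neg n h]; exact hz.self_of_nhds.2 h
  · rw [cauchyExt, if_neg h.not_gt, if_neg h.symm.not_gt]
    have := nhdsWithin_re_pos_neBot h
    symm
    apply Tendsto.limUnder_eq
    refine (hEz.continuousAt.tendsto.mono_left nhdsWithin_le_nhds).congr' ?_
    filter_upwards [nhdsWithin_le_nhds hz, self_mem_nhdsWithin] with w hw hwre
    exact hw.1 hwre
  · rw [cauchyExt_of_pos n h]; exact hz.self_of_nhds.1 h

theorem analyticAt_cauchyExt {n : ℂ → ℂ} (hInt : Integrable fun ω : ℝ => n ω)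
    (hn : ∀ y : ℝ, AnalyticAt ℂ n y) {z : ℂ} (hz : 0 ≤ z.re) : AnalyticAt ℂ (cauchyExt n) z := by
  rcases hz.eq_or_lt with h | h
  · have : z = I * (z.im : ℂ) := by apply Complex.ext <;> simp [← h]
    rw [this]
    exact analyticAt_cauchyExt_axis hInt (hn _)
  · refine (analyticAt_cauchyTransform hInt h.ne').congr ?_
    filter_upwards [(isOpen_lt continuous_const continuous_re).mem_nhds h] with w hw
    exact (cauchyExt_of_pos n hw).symm

theorem meromorphicAt_cauchyExt {n : ℂ → ℂ} (hInt : Integrable fun ω : ℝ => n ω)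
    (hn : ∀ y : ℝ, AnalyticAt ℂ n y) (hm : MeromorphicOn n {z | 0 < z.im}) (z : ℂ) :
    MeromorphicAt (cauchyExt n) z := by
  rcases le_or_gt 0 z.re with h | h
  · exact (analyticAt_cauchyExt hInt hn h).meromorphicAt
  · have h1 : MeromorphicAt (fun z => n (-I * z)) z :=
      MeromorphicAt.comp_analyticAt (hm _ (by simpa using h)) (by fun_prop)
    refine MeromorphicAt.congr (((analyticAt_cauchyTransform hInt h.ne).meromorphicAt).add
      ((MeromorphicAt.const (2 * Real.pi : ℂ) z).mul h1)) ?_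
    filter_upwards [nhdsWithin_le_nhds
      ((isOpen_lt continuous_re continuous_const).mem_nhds h)] with w hw
    exact (cauchyExt_of_neg n hw).symm

/-- The boundary value of the Cauchy transform. -/
theorem tendsto_cauchyTransform_axis {n : ℂ → ℂ} (hInt : Integrable fun ω : ℝ => n ω)
    {y : ℝ} (hn : AnalyticAt ℂ n y) :
    Tendsto (fun x : ℝ => cauchyTransform n (x + I * y)) (𝓝[>] 0) (𝓝 (cauchyExt n (I * y))) := by
  have h1 : Tendsto (fun x : ℝ => (x : ℂ) + I * y) (𝓝[>] 0) (𝓝 (I * y)) := by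
    have : Continuous fun x : ℝ => (x : ℂ) + I * y := by fun_prop
    have h2 := this.tendsto 0
    simp only [ofReal_zero, zero_add] at h2
    exact h2.mono_left nhdsWithin_le_nhds
  refine ((analyticAt_cauchyExt_axis hInt hn).continuousAt.tendsto.comp h1).congr' ?_
  filter_upwards [self_mem_nhdsWithin] with x hx
  exact cauchyExt_of_pos n (by simpa using hx)

/-! ### A weak-type bound for Poisson integrals -/

/-- A Poisson integral is controlled by the maximal function of the measure. -/
theorem lintegral_poisson_le {μ : Measure ℝ} {x y c : ℝ} (hx : 0 < x) (hc : 0 ≤ c)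
    (h : ∀ ρ > 0, μ (Metric.closedBall y ρ) ≤ ENNReal.ofReal (c * ρ)) :
    ∫⁻ ω, ENNReal.ofReal (x / (x ^ 2 + (ω - y) ^ 2)) ∂μ ≤ ENNReal.ofReal (8 * c) := by
  -- Dyadic decomposition: with k least such that |ω - y| ≤ 2^k x, the kernel is at most 4/(4^k x).
  -- The hypothesis bounds the k-th term by 4c/2^k, and these sum to 8c.
  have hpt : ∀ ω : ℝ, ENNReal.ofReal (x / (x ^ 2 + (ω - y) ^ 2)) ≤
      ∑' k : ℕ, (Metric.closedBall y (2 ^ k * x)).indicator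
        (fun _ => ENNReal.ofReal (4 / (4 ^ k * x))) ω := by
    intro ω
    have hex : ∃ k : ℕ, |ω - y| ≤ 2 ^ k * x := by
      obtain ⟨k, hk⟩ := pow_unbounded_of_one_lt (|ω - y| / x) (one_lt_two)
      exact ⟨k, ((div_lt_iff₀ hx).1 hk).le⟩
    classical
    set k := Nat.find hex with hk
    have hkin : ω ∈ Metric.closedBall y (2 ^ k * x) := by
      rw [Metric.mem_closedBall, Real.dist_eq]; exact Nat.find_spec hex
    refine le_trans ?_ (ENNReal.le_tsum k)
    rw [Set.indicator_of_mem hkin]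
    apply ENNReal.ofReal_le_ofReal
    rcases hk0 : k with _ | m
    · rw [pow_zero, one_mul, div_le_div_iff₀ (by positivity) hx]
      nlinarith [sq_nonneg (ω - y)]
    · have hm : ¬(|ω - y| ≤ 2 ^ m * x) := Nat.find_min hex (by rw [← hk, hk0]; exact Nat.lt_succ_self m)
      rw [not_le] at hm
      have h1 : (2 ^ m * x) ^ 2 ≤ (ω - y) ^ 2 := by
        rw [← sq_abs (ω - y)]
        gcongr
      have h2 : (2 ^ m * x) ^ 2 = 4 ^ m * x ^ 2 := by
        rw [mul_pow, ← pow_mul, mul_comm m 2, pow_mul]; norm_num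
      rw [h2] at h1
      rw [div_le_div_iff₀ (by positivity) (by positivity), pow_succ]
      nlinarith [sq_nonneg x]
  calc ∫⁻ ω, ENNReal.ofReal (x / (x ^ 2 + (ω - y) ^ 2)) ∂μ
      ≤ ∫⁻ ω, ∑' k : ℕ, (Metric.closedBall y (2 ^ k * x)).indicator
        (fun _ => ENNReal.ofReal (4 / (4 ^ k * x))) ω ∂μ := lintegral_mono hpt
    _ = ∑' k : ℕ, ENNReal.ofReal (4 / (4 ^ k * x)) * μ (Metric.closedBall y (2 ^ k * x)) := by
      rw [lintegral_tsum fun k =>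
        (measurable_const.indicator Metric.isClosed_closedBall.measurableSet).aemeasurable]
      simp_rw [lintegral_indicator_const Metric.isClosed_closedBall.measurableSet]
    _ ≤ ∑' k : ℕ, ENNReal.ofReal (4 * c * (1 / 2) ^ k) := by
      refine ENNReal.tsum_le_tsum fun k => ?_
      refine (mul_le_mul_right (h (2 ^ k * x) (by positivity)) _).trans ?_
      rw [← ENNReal.ofReal_mul (by positivity)]
      apply ENNReal.ofReal_le_ofReal
      apply le_of_eq
      have h4 : (4 : ℝ) ^ k = 2 ^ k * 2 ^ k := by rw [← mul_pow]; norm_num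
      rw [h4, one_div, inv_pow]
      field_simp
    _ = ENNReal.ofReal (8 * c) := by
      rw [← ENNReal.ofReal_tsum_of_nonneg (fun k => by positivity)
        (summable_geometric_two.mul_left _), tsum_mul_left, tsum_geometric_two]
      congr 1; ring

/-- The set where a Poisson integral is somewhere large has finite measure. -/
theorem volume_poisson_large_lt_top {μ : Measure ℝ} [IsProbabilityMeasure μ] {c : ℝ} (hc : 0 < c) :
    volume {y : ℝ | ∃ x > 0,
      ENNReal.ofReal c ≤ ∫⁻ ω, ENNReal.ofReal (x / (x ^ 2 + (ω - y) ^ 2)) ∂μ} < ⊤ := by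
  set t : Set ℝ := {y : ℝ | ∃ x > 0,
      ENNReal.ofReal c ≤ ∫⁻ ω, ENNReal.ofReal (x / (x ^ 2 + (ω - y) ^ 2)) ∂μ} with ht
  -- Then 8c' = c/2 < c, so a point with a large Poisson integral must have a ball of mass greater
  -- than c'ρ.
  set c' : ℝ := c / 16 with hc'
  have hc'0 : 0 < c' := by positivity
  have hrad : ∀ y ∈ t, ∃ ρ > 0, ENNReal.ofReal (c' * ρ) < μ (Metric.closedBall y ρ) := by
    rintro y ⟨x, hx, hxy⟩
    by_contra hn
    push Not at hn
    have h1 := hxy.trans (lintegral_poisson_le hx hc'0.le hn)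
    rw [ENNReal.ofReal_le_ofReal_iff (by positivity)] at h1
    linarith
  choose! ρ hρ0 hρ using hrad
  have hρb : ∀ y ∈ t, ρ y ≤ 1 / c' := by
    intro y hy
    have h1 := ((hρ y hy).trans_le prob_le_one).le
    rw [ENNReal.ofReal_le_one] at h1
    rw [le_div_iff₀ hc'0]; linarith
  -- Radii are at most 1/c' because the total mass is 1. For the disjoint Vitali subfamily the
  -- fivefold balls have length 10ρ ≤ (10/c')μ(ball), which sums to at most 10/c'.
  obtain ⟨u, hut, hdisj, hcov⟩ := Vitali.exists_disjoint_subfamily_covering_enlargement_closedBall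
    t id ρ (1 / c') hρb 5 (by norm_num)
  have hucount : u.Countable := by
    refine hdisj.countable_of_nonempty_interior fun a ha => ?_
    exact ⟨a, Metric.ball_subset_interior_closedBall (Metric.mem_ball_self (hρ0 a (hut ha)))⟩
  have hsub : t ⊆ ⋃ b ∈ u, Metric.closedBall b (5 * ρ b) := by
    intro y hy
    obtain ⟨b, hb, hsub⟩ := hcov y hy
    exact Set.mem_biUnion hb (hsub (Metric.mem_closedBall_self (hρ0 y hy).le))
  have hterm : ∀ b ∈ u, volume (Metric.closedBall b (5 * ρ b)) ≤
      ENNReal.ofReal (10 / c') * μ (Metric.closedBall b (ρ b)) := by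
    intro b hb
    rw [Real.volume_closedBall]
    calc ENNReal.ofReal (2 * (5 * ρ b)) = ENNReal.ofReal (10 / c') * ENNReal.ofReal (c' * ρ b) := by
          rw [← ENNReal.ofReal_mul (by positivity)]
          congr 1; field_simp; ring
      _ ≤ _ := mul_le_mul_right (hρ b (hut hb)).le _
  have := hucount.to_subtype
  calc volume t ≤ volume (⋃ b ∈ u, Metric.closedBall b (5 * ρ b)) := measure_mono hsub
    _ ≤ ∑' b : u, volume (Metric.closedBall (b : ℝ) (5 * ρ b)) := by
      rw [Set.biUnion_eq_iUnion]; exact measure_iUnion_le _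
    _ ≤ ∑' b : u, ENNReal.ofReal (10 / c') * μ (Metric.closedBall (b : ℝ) (ρ b)) :=
      ENNReal.tsum_le_tsum fun b => hterm b b.2
    _ = ENNReal.ofReal (10 / c') * μ (⋃ b : u, Metric.closedBall (b : ℝ) (ρ b)) := by
      rw [ENNReal.tsum_mul_left, measure_iUnion]
      · intro a b hab
        exact hdisj a.2 b.2 (fun h => hab (Subtype.ext h))
      · exact fun b => Metric.isClosed_closedBall.measurableSet
    _ ≤ ENNReal.ofReal (10 / c') * 1 := mul_le_mul_right prob_le_one _
    _ < ⊤ := by simp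

/-! ### The dispersion function in the closed right half-plane -/

theorem FrequencyDensity.integral_measure (g : FrequencyDensity) (F : ℝ → ℂ) :
    ∫ ω, F ω ∂g.measure = ∫ ω, F ω * (g.dens ω : ℂ) := by
  rw [FrequencyDensity.measure, integral_withDensity_eq_integral_toReal_smul₀
    g.integrable.aemeasurable.ennreal_ofReal (Eventually.of_forall fun _ => ENNReal.ofReal_lt_top)]
  refine integral_congr_ae (Eventually.of_forall fun ω => ?_)
  simp only [ENNReal.toReal_ofReal (g.nonneg ω), real_smul]
  ring

theorem integrable_inv_sub_I_mul {μ : Measure ℝ} [IsFiniteMeasure μ] {z : ℂ} (hz : z.re ≠ 0) :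
    Integrable (fun ω : ℝ => (z - I * ω)⁻¹) μ := by
  refine Integrable.of_bound (C := |z.re|⁻¹) ?_ (Eventually.of_forall fun ω => ?_)
  · exact (Measurable.inv (by fun_prop)).aestronglyMeasurable
  · rw [norm_inv]
    exact inv_anti₀ (abs_pos.2 hz) (abs_re_le_norm_sub_I_mul z ω)

theorem inv_sub_I_mul_re (z : ℂ) (ω : ℝ) :
    ((z - I * ω)⁻¹).re = z.re / (z.re ^ 2 + (ω - z.im) ^ 2) := by
  rw [inv_re, normSq_apply]
  simp only [sub_re, mul_re, I_re, ofReal_re, zero_mul, I_im, ofReal_im, mul_zero, sub_zero,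
    sub_im, mul_im, one_mul, zero_add]
  congr 1; ring

theorem inv_sub_I_mul_im (z : ℂ) (ω : ℝ) :
    ((z - I * ω)⁻¹).im = (ω - z.im) / (z.re ^ 2 + (ω - z.im) ^ 2) := by
  rw [inv_im, normSq_apply]
  simp only [sub_re, mul_re, I_re, ofReal_re, zero_mul, I_im, ofReal_im, mul_zero, sub_zero,
    sub_im, mul_im, one_mul, zero_add]
  congr 1 <;> ring

theorem dispersion_eq_integral (g : FrequencyDensity) (z : ℂ) :
    dispersion g z = ∫ ω, (z - I * (ω : ℝ))⁻¹ ∂g.measure := by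
  rw [g.integral_measure, dispersion, resolventM]
  simp only [one_div, mul_one]

theorem dispersion_re (g : FrequencyDensity) {z : ℂ} (hz : z.re ≠ 0) :
    (dispersion g z).re = ∫ ω, z.re / (z.re ^ 2 + (ω - z.im) ^ 2) ∂g.measure := by
  rw [dispersion_eq_integral, ← reCLM_apply, ← reCLM.integral_comp_comm (integrable_inv_sub_I_mul hz)]
  simp only [reCLM_apply, inv_sub_I_mul_re]

theorem dispersion_im (g : FrequencyDensity) {z : ℂ} (hz : z.re ≠ 0) :
    (dispersion g z).im = ∫ ω, (ω - z.im) / (z.re ^ 2 + (ω - z.im) ^ 2) * g.dens ω := by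
  have h1 : (dispersion g z).im = ∫ ω, (ω - z.im) / (z.re ^ 2 + (ω - z.im) ^ 2) ∂g.measure := by
    rw [dispersion_eq_integral, ← imCLM_apply,
      ← imCLM.integral_comp_comm (integrable_inv_sub_I_mul hz)]
    simp only [imCLM_apply, inv_sub_I_mul_im]
  rw [h1, FrequencyDensity.measure, integral_withDensity_eq_integral_toReal_smul₀
    g.integrable.aemeasurable.ennreal_ofReal (Eventually.of_forall fun _ => ENNReal.ofReal_lt_top)]
  refine integral_congr_ae (Eventually.of_forall fun ω => ?_)
  simp only [ENNReal.toReal_ofReal (g.nonneg ω), smul_eq_mul]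
  ring

theorem norm_dispersion_le (g : FrequencyDensity) {z : ℂ} (hz : z.re ≠ 0) :
    ‖dispersion g z‖ ≤ |z.re|⁻¹ := by
  rw [dispersion_eq_integral]
  have := norm_integral_le_of_norm_le_const (μ := g.measure) (f := fun ω : ℝ => (z - I * ω)⁻¹)
    (C := |z.re|⁻¹) (Eventually.of_forall fun ω => by
      rw [norm_inv]
      exact inv_anti₀ (abs_pos.2 hz) (abs_re_le_norm_sub_I_mul z ω))
  simpa using this

/-- There are horizontal lines, arbitrarily far up and down, on which the real part of the
dispersion function is small throughout the right half-plane. -/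
theorem exists_dispersion_re_lt (g : FrequencyDensity) {c : ℝ} (hc : 0 < c) {s : Set ℝ}
    (hs : volume s = ⊤) : ∃ y ∈ s, ∀ z : ℂ, z.im = y → 0 < z.re → (dispersion g z).re < c := by
  have hfin := volume_poisson_large_lt_top (μ := g.measure) hc
  obtain ⟨y, hys, hy⟩ : (s \ {y : ℝ | ∃ x > 0,
      ENNReal.ofReal c ≤ ∫⁻ ω, ENNReal.ofReal (x / (x ^ 2 + (ω - y) ^ 2)) ∂g.measure}).Nonempty := by
    by_contra hemp
    rw [Set.not_nonempty_iff_eq_empty, Set.sdiff_eq_empty] at hemp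
    exact absurd ((measure_mono hemp).trans_lt hfin) (by rw [hs]; exact lt_irrefl _)
  refine ⟨y, hys, fun z hzy hz => ?_⟩
  by_contra hn
  rw [not_lt, dispersion_re g hz.ne', integral_eq_lintegral_of_nonneg_ae
    (Eventually.of_forall fun ω => by positivity)
    (Measurable.aestronglyMeasurable (by fun_prop))] at hn
  refine hy ⟨z.re, hz, ?_⟩
  rw [← hzy]
  exact ENNReal.ofReal_le_of_le_toReal hn

/-! ### Boundary values of the dispersion function and the transition point -/

theorem IsMeromorphicContinuation.integrable {g : FrequencyDensity} {gs : ℂ → ℂ}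
    (h : IsMeromorphicContinuation g.dens gs) : Integrable fun ω : ℝ => gs ω := by
  simp only [h.eq_on_real]
  exact g.integrable.ofReal

theorem dispersion_eq_cauchyTransform {g : FrequencyDensity} {gs : ℂ → ℂ}
    (h : IsMeromorphicContinuation g.dens gs) (z : ℂ) :
    dispersion g z = cauchyTransform gs z := by
  simp only [dispersion, resolventM, cauchyTransform, one_div, mul_one, h.eq_on_real]

/-- The boundary value of the real part of the dispersion function is `π g`. -/
theorem cauchyExt_axis_re {g : FrequencyDensity} {gs : ℂ → ℂ}
    (h : IsMeromorphicContinuation g.dens gs) (y : ℝ) :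
    (cauchyExt gs (I * y)).re = Real.pi * g.dens y := by
  have hcont := (analyticAt_cauchyExt_axis h.integrable (h.analyticAt_real y)).continuousAt
  have h1 := (continuous_re.tendsto _).comp
    (tendsto_cauchyTransform_axis h.integrable (h.analyticAt_real y))
  -- approach from the left
  have hpath : Tendsto (fun x : ℝ => -(x : ℂ) + I * y) (𝓝[>] 0) (𝓝 (I * y)) := by
    have : Continuous fun x : ℝ => -(x : ℂ) + I * y := by fun_prop
    have h2 := this.tendsto 0
    simp only [ofReal_zero, neg_zero, zero_add] at h2
    exact h2.mono_left nhdsWithin_le_nhds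
  have h2 := (continuous_re.tendsto _).comp (hcont.tendsto.comp hpath)
  have hgs : Tendsto (fun x : ℝ => gs (-I * (-(x : ℂ) + I * y))) (𝓝[>] 0) (𝓝 (gs y)) := by
    have e : -I * (I * (y : ℂ)) = y := by linear_combination (-(y : ℂ)) * I_sq
    have h3 : Tendsto (fun x : ℝ => -I * (-(x : ℂ) + I * y)) (𝓝[>] 0) (𝓝 (y : ℂ)) := by
      have := hpath.const_mul (-I)
      rwa [e] at this
    exact (h.analyticAt_real y).continuousAt.tendsto.comp h3
  have h4 := (continuous_re.tendsto _).comp (hgs.const_mul (2 * Real.pi : ℂ))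
  -- Re D changes sign under x ↦ -x, so the approaches from left and right add up to 2π Re g* alone.
  -- In the limit twice the real part of the boundary value is 2πg(y).
  have hsum : ∀ᶠ x : ℝ in 𝓝[>] 0, (cauchyExt gs (-(x : ℂ) + I * y)).re +
      (cauchyTransform gs (x + I * y)).re = (2 * Real.pi * gs (-I * (-(x : ℂ) + I * y))).re := by
    filter_upwards [self_mem_nhdsWithin] with x hx
    have hx : 0 < x := hx
    rw [cauchyExt_of_neg gs (by simpa using hx), add_re, ← dispersion_eq_cauchyTransform h,
      ← dispersion_eq_cauchyTransform h, dispersion_re g (by simpa using hx.ne'),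
      dispersion_re g (by simpa using hx.ne')]
    have : ∫ ω, (-(x : ℂ) + I * y).re / ((-(x : ℂ) + I * y).re ^ 2 +
        (ω - (-(x : ℂ) + I * y).im) ^ 2) ∂g.measure =
        -∫ ω, ((x : ℂ) + I * y).re / (((x : ℂ) + I * y).re ^ 2 +
        (ω - ((x : ℂ) + I * y).im) ^ 2) ∂g.measure := by
      rw [← integral_neg]
      refine integral_congr_ae (Eventually.of_forall fun ω => ?_)
      simp [neg_div]
    rw [this]
    ring
  have h5 := tendsto_nhds_unique ((h2.add h1).congr' hsum) h4
  rw [h.eq_on_real] at h5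
  have h6 : ((2 * Real.pi : ℂ) * (g.dens y : ℂ)).re = 2 * Real.pi * g.dens y := by
    rw [← ofReal_ofNat, ← ofReal_mul, ← ofReal_mul, ofReal_re]
  rw [h6] at h5
  linarith

/-- The value `1 / (i K f₁)` in Cartesian form. -/
theorem one_div_coupling (K : ℝ) (f₁ : ℂ) :
    1 / (I * K * f₁) = ((-f₁.im / (K * ‖f₁‖ ^ 2) : ℝ) : ℂ) + ((-f₁.re / (K * ‖f₁‖ ^ 2) : ℝ) : ℂ) * I := by
  rcases eq_or_ne K 0 with rfl | hK
  · simp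
  rcases eq_or_ne f₁ 0 with rfl | hf
  · simp
  have hn : (‖f₁‖ : ℂ) ≠ 0 := by exact_mod_cast norm_ne_zero_iff.2 hf
  have hKc : (K : ℂ) ≠ 0 := by exact_mod_cast hK
  have hconj : f₁ * (f₁.re - f₁.im * I) = (‖f₁‖ : ℂ) ^ 2 := by
    rw [← mul_conj' f₁]
    congr 1
    apply Complex.ext <;> simp
  push_cast
  rw [one_div, inv_eq_of_mul_eq_one_right]
  field_simp
  rw [← hconj]
  linear_combination (-f₁ * f₁.re) * I_sq

/-- Below the transition point the boundary values of the dispersion function avoid the ray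
`[1, ∞) / (i K f₁)`. -/
theorem cauchyExt_axis_ne {g : FrequencyDensity} {gs : ℂ → ℂ}
    (h : IsMeromorphicContinuation g.dens gs) {K : ℝ} {f₁ : ℂ} (hf : f₁.im < 0) (hK : 0 < K)
    (hKc : ENNReal.ofReal K < transitionPoint g f₁) (y τ : ℝ) (hτ : 1 ≤ τ) :
    cauchyExt gs (I * y) ≠ τ * (1 / (I * K * f₁)) := by
  intro heq
  have hfn : 0 < ‖f₁‖ := norm_pos_iff.2 (by rintro rfl; simp at hf)
  have hre := cauchyExt_axis_re h y
  have htend := (continuous_im.tendsto _).comp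
    (tendsto_cauchyTransform_axis h.integrable (h.analyticAt_real y))
  rw [heq, one_div_coupling] at hre htend
  have e1 : ((τ : ℂ) * (((-f₁.im / (K * ‖f₁‖ ^ 2) : ℝ) : ℂ) +
      ((-f₁.re / (K * ‖f₁‖ ^ 2) : ℝ) : ℂ) * I)).re = τ * (-f₁.im / (K * ‖f₁‖ ^ 2)) := by
    rw [re_ofReal_mul, add_re, ofReal_re, re_ofReal_mul, I_re, mul_zero, add_zero]
  have e2 : ((τ : ℂ) * (((-f₁.im / (K * ‖f₁‖ ^ 2) : ℝ) : ℂ) +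
      ((-f₁.re / (K * ‖f₁‖ ^ 2) : ℝ) : ℂ) * I)).im = τ * (-f₁.re / (K * ‖f₁‖ ^ 2)) := by
    rw [im_ofReal_mul, add_im, ofReal_im, im_ofReal_mul, I_im, mul_one, zero_add]
  rw [e1] at hre
  rw [e2] at htend
  have hgy : 0 < Real.pi * g.dens y := by
    rw [← hre]
    have : 0 < -f₁.im := by linarith
    positivity
  -- The equation D = τw splits: its real part gives πg(y) = -τ Im f₁/(K|f₁|²), its imaginary part
  -- is the critical-frequency condition. The value attached to y is then K/τ.
  have hcrit : IsCriticalFrequency g f₁ y := by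
    have e3 : Real.pi * f₁.re / f₁.im * g.dens y = τ * (-f₁.re / (K * ‖f₁‖ ^ 2)) := by
      have : Real.pi * f₁.re / f₁.im * g.dens y = f₁.re / f₁.im * (Real.pi * g.dens y) := by ring
      rw [this, ← hre]
      have := hf.ne
      field_simp
    rw [IsCriticalFrequency, e3]
    refine htend.congr' ?_
    filter_upwards [self_mem_nhdsWithin] with x hx
    have hx : 0 < x := hx
    simp only [Function.comp_apply]
    rw [← dispersion_eq_cauchyTransform h, dispersion_im g (by simpa using hx.ne')]
    simp
  have hle : transitionPoint g f₁ ≤ ENNReal.ofReal K := by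
    refine (iInf₂_le y hcrit).trans ?_
    have hpos : 0 < Real.pi * ‖f₁‖ ^ 2 * g.dens y := by
      have : Real.pi * ‖f₁‖ ^ 2 * g.dens y = ‖f₁‖ ^ 2 * (Real.pi * g.dens y) := by ring
      rw [this]; positivity
    rw [← ENNReal.ofReal_div_of_pos hpos]
    apply ENNReal.ofReal_le_ofReal
    rw [div_le_iff₀ hpos]
    have : Real.pi * ‖f₁‖ ^ 2 * g.dens y = ‖f₁‖ ^ 2 * (Real.pi * g.dens y) := by ring
    rw [this, ← hre]
    have e4 : K * (‖f₁‖ ^ 2 * (τ * (-f₁.im / (K * ‖f₁‖ ^ 2)))) = τ * (-f₁.im) := by field_simp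
    rw [e4]
    nlinarith
  exact absurd hKc (not_lt.2 hle)

/-- Below the transition point the dispersion function avoids the ray `[1, ∞) / (i K f₁)` in the
closed right half-plane. -/
theorem cauchyExt_ne {g : FrequencyDensity} {gs : ℂ → ℂ}
    (h : IsMeromorphicContinuation g.dens gs) {K : ℝ} {f₁ : ℂ} (hf : f₁.im < 0) (hK : 0 < K)
    (hKc : ENNReal.ofReal K < transitionPoint g f₁) {z₀ : ℂ} (hz₀ : 0 ≤ z₀.re) :
    cauchyExt gs z₀ ≠ 1 / (I * K * f₁) := by
  intro heq
  set w : ℂ := 1 / (I * K * f₁) with hw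
  have hfn : 0 < ‖f₁‖ := norm_pos_iff.2 (by rintro rfl; simp at hf)
  set c : ℝ := w.re with hc
  have hc0 : 0 < c := by
    rw [hc, hw, one_div_coupling, add_re, ofReal_re, re_ofReal_mul, I_re, mul_zero, add_zero]
    have : 0 < -f₁.im := by linarith
    positivity
  have hw0 : w ≠ 0 := by
    intro h0
    rw [hc, h0, zero_re] at hc0
    exact lt_irrefl _ hc0
  have haxis : ∀ y τ : ℝ, 1 ≤ τ → cauchyExt gs (I * y) ≠ τ * w :=
    cauchyExt_axis_ne h hf hK hKc
  have hDpos : ∀ z : ℂ, 0 < z.re → cauchyExt gs z = dispersion g z := fun z hz => by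
    rw [cauchyExt_of_pos gs hz, dispersion_eq_cauchyTransform h]
  -- The whole ray H ∈ [1, ∞) is considered instead of the single value 1, so that a point with H
  -- maximal on the ray can be pushed further along it.
  set H : ℂ → ℂ := fun z => cauchyExt gs z / w with hH
  have hHan : ∀ z : ℂ, 0 ≤ z.re → AnalyticAt ℂ H z := fun z hz =>
    (analyticAt_cauchyExt h.integrable h.analyticAt_real hz).div_const
  have hform : ∀ z, (H z).im = 0 → cauchyExt gs z = ((H z).re : ℂ) * w := by
    intro z hz
    have h1 : ((H z).re : ℂ) = H z := by apply Complex.ext <;> simp [hz]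
    rw [h1, hH]
    simp only
    field_simp
  -- on the ray the real part of the dispersion function is at least `c`
  have hlarge : ∀ z : ℂ, 0 < z.re → (H z).im = 0 → 1 ≤ (H z).re → c ≤ (dispersion g z).re := by
    intro z hz him hre
    rw [← hDpos z hz, hform z him, re_ofReal_mul]
    nlinarith
  have hsmall : ∀ z : ℂ, 1 / c < z.re → (dispersion g z).re < c := by
    intro z hz
    have hz0 : 0 < z.re := (one_div_pos.2 hc0).trans hz
    refine (re_le_norm _).trans_lt ((norm_dispersion_le g hz0.ne').trans_lt ?_)
    rw [abs_of_pos hz0, inv_lt_comm₀ hz0 hc0]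
    simpa using hz
  -- On the ray Re D ≥ c, so the horizontal lines at the heights y₁ and y₂, and the vertical line Re
  -- z = X, contain no point of it in the open right half-plane.
  obtain ⟨y₁, hy₁, hy₁'⟩ := exists_dispersion_re_lt g hc0 (Real.volume_Iio (a := z₀.im))
  obtain ⟨y₂, hy₂, hy₂'⟩ := exists_dispersion_re_lt g hc0 (Real.volume_Ioi (a := z₀.im))
  have hy₁ : y₁ < z₀.im := hy₁
  have hy₂ : z₀.im < y₂ := hy₂
  set X : ℝ := max (1 / c) z₀.re + 1 with hX
  have hXc : 1 / c < X := by linarith [le_max_left (1 / c) z₀.re]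
  have hXz : z₀.re < X := by linarith [le_max_right (1 / c) z₀.re]
  set rect : Set ℂ := Set.Icc 0 X ×ℂ Set.Icc y₁ y₂ with hrect
  have hrectc : IsCompact rect := isCompact_Icc.reProdIm isCompact_Icc
  have hHcont : ContinuousOn H rect := fun z hz =>
    (hHan z hz.1.1).continuousAt.continuousWithinAt
  set T : Set ℂ := rect ∩ H ⁻¹' {v | v.im = 0 ∧ 1 ≤ v.re} with hT
  have hTc : IsCompact T := by
    refine hrectc.of_isClosed_subset ?_ Set.inter_subset_left
    refine hHcont.preimage_isClosed_of_isClosed hrectc.isClosed ?_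
    exact (isClosed_eq continuous_im continuous_const).inter
      (isClosed_le continuous_const continuous_re)
  have hz₀T : z₀ ∈ T := by
    have hH1 : H z₀ = 1 := by rw [hH]; simp only; rw [heq, div_self hw0]
    refine ⟨⟨⟨hz₀, hXz.le⟩, ⟨hy₁.le, hy₂.le⟩⟩, ?_⟩
    simp [hH1]
  obtain ⟨z, hzT, hzmax⟩ := hTc.exists_isMaxOn ⟨z₀, hz₀T⟩
    (continuous_re.comp_continuousOn (hHcont.mono Set.inter_subset_left))
  obtain ⟨⟨⟨hzre0, hzreX⟩, ⟨hzim1, hzim2⟩⟩, hzim, hzre⟩ := hzT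
  -- A maximiser on the imaginary axis is excluded by `cauchyExt_axis_ne`.
  have hzpos : 0 < z.re := by
    refine lt_of_le_of_ne hzre0 fun h0 => ?_
    have : z = I * (z.im : ℂ) := by apply Complex.ext <;> simp [← h0]
    have h1 := hform z hzim
    rw [this] at h1
    refine haxis z.im _ ?_ h1
    rw [← this]; exact hzre
  have hzc := hlarge z hzpos hzim hzre
  have hInt : rect ∈ 𝓝 z := by
    have hne1 : z.im ≠ y₁ := fun h0 => absurd (hy₁' z h0 hzpos) (not_lt.2 hzc)
    have hne2 : z.im ≠ y₂ := fun h0 => absurd (hy₂' z h0 hzpos) (not_lt.2 hzc)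
    have hne3 : z.re ≠ X := fun h0 => absurd (hsmall z (h0 ▸ hXc)) (not_lt.2 hzc)
    have hopen : IsOpen (Set.Ioo 0 X ×ℂ Set.Ioo y₁ y₂) := isOpen_Ioo.reProdIm isOpen_Ioo
    refine mem_of_superset (hopen.mem_nhds ⟨⟨hzpos, lt_of_le_of_ne hzreX hne3⟩,
      ⟨lt_of_le_of_ne hzim1 hne1.symm, lt_of_le_of_ne hzim2 hne2⟩⟩) fun v hv => ?_
    exact ⟨Set.Ioo_subset_Icc_self hv.1, Set.Ioo_subset_Icc_self hv.2⟩
  -- If H is constant it stays on the ray throughout the right half-plane, which is false at X.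
  -- Otherwise H is open at z, so H z + ε is attained in the rectangle for small ε > 0, against
  -- maximality.
  rcases (hHan z hzre0).eventually_constant_or_nhds_le_map_nhds with hconst | hopen
  · have han : AnalyticOnNhd ℂ H {v : ℂ | 0 < v.re} := fun v hv => hHan v (le_of_lt hv)
    have heqon := han.eqOn_of_preconnected_of_eventuallyEq
      (g := fun _ => H z) analyticOnNhd_const (convex_halfSpace_re_gt 0).isPreconnected
      (show z ∈ {v : ℂ | 0 < v.re} from hzpos) hconst
    have hXpos : 0 < X := (one_div_pos.2 hc0).trans hXc
    have hX0 : (X : ℂ) ∈ {v : ℂ | 0 < v.re} := by simpa using hXpos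
    have hHX : H X = H z := heqon hX0
    have := hlarge (X : ℂ) (by simpa using hXpos) (by rw [hHX]; exact hzim)
      (by rw [hHX]; exact hzre)
    exact absurd (hsmall X (by simpa using hXc)) (not_lt.2 this)
  · have himg : H '' rect ∈ 𝓝 (H z) := hopen (image_mem_map hInt)
    have hseq : Tendsto (fun ε : ℝ => H z + ε) (𝓝[>] 0) (𝓝 (H z)) := by
      have : Continuous fun ε : ℝ => H z + ε := by fun_prop
      have h2 := this.tendsto 0
      simp only [ofReal_zero, add_zero] at h2
      exact h2.mono_left nhdsWithin_le_nhds
    obtain ⟨ε, ⟨v, hv, hvε⟩, hε⟩ := ((hseq.eventually himg).and self_mem_nhdsWithin).exists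
    have hε : 0 < ε := hε
    have hvre : (H v).re = (H z).re + ε := by rw [hvε]; simp
    have hvim : (H v).im = 0 := by rw [hvε]; simpa using hzim
    have hzre' : 1 ≤ (H z).re := hzre
    have hvT : v ∈ T := ⟨hv, hvim, by linarith⟩
    have : (H v).re ≤ (H z).re := hzmax hvT
    linarith

/-! ### Linear differential equations in Banach algebras -/

section Dyson

variable {𝔸 : Type*} [NormedRing 𝔸] [NormedAlgebra ℝ 𝔸]

/-- The terms of the Dyson series for `V' = B V`. -/
def dysonTerm (B : ℝ → 𝔸) : ℕ → ℝ → 𝔸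
  | 0 => fun _ => 1
  | n + 1 => fun t => ∫ s in (0 : ℝ)..t, B s * dysonTerm B n s

theorem continuous_dysonTerm {B : ℝ → 𝔸} (hB : Continuous B) (n : ℕ) :
    Continuous (dysonTerm B n) := by
  induction n with
  | zero => exact continuous_const
  | succ n ih =>
    exact intervalIntegral.continuous_primitive (fun a b => (hB.mul ih).intervalIntegrable a b) 0

theorem hasDerivAt_dysonTerm [CompleteSpace 𝔸] {B : ℝ → 𝔸} (hB : Continuous B) (n : ℕ) (t : ℝ) :
    HasDerivAt (dysonTerm B (n + 1)) (B t * dysonTerm B n t) t := by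
  have hc := hB.mul (continuous_dysonTerm hB n)
  exact intervalIntegral.integral_hasDerivAt_right (hc.intervalIntegrable 0 t)
    (hc.stronglyMeasurableAtFilter _ _) hc.continuousAt

/-- Rescaling the integral to [0, 1] treats both signs of t at once; integrating sⁿ supplies the new
factor 1/(n + 1). -/
theorem norm_dysonTerm_le {B : ℝ → 𝔸} {b : ℝ} (hb : ∀ t, ‖B t‖ ≤ b) (n : ℕ) :
    ∀ t, ‖dysonTerm B n t‖ ≤ ‖(1 : 𝔸)‖ * ((b * |t|) ^ n / n.factorial) := by
  have hb0 : 0 ≤ b := (norm_nonneg _).trans (hb 0)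
  induction n with
  | zero => intro t; simp [dysonTerm]
  | succ n ih =>
    intro t
    have h1 : dysonTerm B (n + 1) t =
        t • ∫ s in (0 : ℝ)..1, B (t * s) * dysonTerm B n (t * s) := by
      rw [intervalIntegral.smul_integral_comp_mul_left (fun s => B s * dysonTerm B n s), mul_zero,
        mul_one]
      rfl
    have h2 : ‖∫ s in (0 : ℝ)..1, B (t * s) * dysonTerm B n (t * s)‖ ≤
        ∫ s in (0 : ℝ)..1, (b * (‖(1 : 𝔸)‖ * ((b * |t|) ^ n / n.factorial))) * s ^ n := by
      refine intervalIntegral.norm_integral_le_of_norm_le zero_le_one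
        (Eventually.of_forall fun s hs => ?_) ?_
      · refine (norm_mul_le _ _).trans ?_
        calc _ ≤ b * (‖(1 : 𝔸)‖ * ((b * |t * s|) ^ n / n.factorial)) :=
              mul_le_mul (hb _) (ih _) (norm_nonneg _) hb0
          _ = _ := by
            rw [abs_mul, abs_of_pos hs.1]
            ring
      · exact (by fun_prop : Continuous fun s : ℝ =>
          (b * (‖(1 : 𝔸)‖ * ((b * |t|) ^ n / n.factorial))) * s ^ n).intervalIntegrable _ _
    rw [intervalIntegral.integral_const_mul, integral_pow] at h2
    rw [h1, norm_smul, Real.norm_eq_abs]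
    refine (mul_le_mul_of_nonneg_left h2 (abs_nonneg t)).trans (le_of_eq ?_)
    rw [Nat.factorial_succ]
    push_cast
    have : (n.factorial : ℝ) ≠ 0 := by exact_mod_cast n.factorial_ne_zero
    have h3 : ((n : ℝ) + 1) ≠ 0 := by positivity
    field_simp
    simp
    ring

/-- Global solvability of `V' = B V`, `V(0) = 1`. -/
theorem exists_linear_ODE [CompleteSpace 𝔸] {B : ℝ → 𝔸} (hB : Continuous B) {b : ℝ} (hb : ∀ t, ‖B t‖ ≤ b) :
    ∃ V : ℝ → 𝔸, V 0 = 1 ∧ (∀ t, HasDerivAt V (B t * V t) t) ∧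
      ∀ t, ‖V t‖ ≤ ‖(1 : 𝔸)‖ * Real.exp (b * |t|) := by
  have hb0 : 0 ≤ b := (norm_nonneg _).trans (hb 0)
  have hsumR : ∀ x : ℝ, Summable fun n : ℕ => ‖(1 : 𝔸)‖ * (x ^ n / n.factorial) := fun x =>
    (Real.summable_pow_div_factorial x).mul_left _
  have hsum : ∀ t, Summable fun n => dysonTerm B n t := fun t =>
    Summable.of_norm_bounded (hsumR (b * |t|)) fun n => norm_dysonTerm_le hb n t
  refine ⟨fun t => ∑' n, dysonTerm B n t, ?_, fun t => ?_, fun t => ?_⟩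
  · change ∑' n, dysonTerm B n 0 = 1
    rw [tsum_eq_single 0]
    · rfl
    · intro n hn
      obtain ⟨m, rfl⟩ := Nat.exists_eq_succ_of_ne_zero hn
      simp [dysonTerm]
  · set T : ℝ := |t| + 1 with hT
    -- The derivative of the term n + 1 is B times the term n, and the constant term contributes 0.
    -- Shifting the index turns the differentiated series into B V.
    set g' : ℕ → ℝ → 𝔸 := fun n s => match n with
      | 0 => 0
      | n + 1 => B s * dysonTerm B n s with hg'
    have hu : Summable fun n : ℕ => match n with
        | 0 => (0 : ℝ)
        | n + 1 => b * (‖(1 : 𝔸)‖ * ((b * T) ^ n / n.factorial)) :=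
      (summable_nat_add_iff 1).1 ((hsumR (b * T)).mul_left b)
    have key := hasDerivAt_tsum_of_isPreconnected (g := fun n s => dysonTerm B n s) (g' := g')
      (t := Set.Ioo (-T) T) (y₀ := t) (y := t) hu isOpen_Ioo isPreconnected_Ioo
      (fun n s _ => by
        rcases n with _ | n
        · exact hasDerivAt_const s (1 : 𝔸)
        · exact hasDerivAt_dysonTerm hB n s)
      (fun n s hs => by
        rcases n with _ | n
        · simp [hg']
        · refine (norm_mul_le _ _).trans (mul_le_mul (hb s) ?_ (norm_nonneg _) hb0)
          refine (norm_dysonTerm_le hb n s).trans ?_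
          gcongr
          exact abs_le.2 ⟨hs.1.le, hs.2.le⟩)
      (by constructor <;> linarith [neg_abs_le t, le_abs_self t]) (hsum t)
      (by constructor <;> linarith [neg_abs_le t, le_abs_self t])
    refine key.congr_deriv ?_
    have hs' : Summable fun n => g' n t :=
      (summable_nat_add_iff 1).1 ((hsum t).mul_left (B t))
    rw [hs'.tsum_eq_zero_add]
    simp only [hg', zero_add]
    exact (hsum t).tsum_mul_left (B t)
  · calc ‖∑' n, dysonTerm B n t‖ ≤ ∑' n : ℕ, ‖(1 : 𝔸)‖ * ((b * |t|) ^ n / n.factorial) :=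
        tsum_of_norm_bounded (hsumR _).hasSum fun n => norm_dysonTerm_le hb n t
      _ = _ := by
        rw [tsum_mul_left, Real.exp_eq_exp_ℝ, NormedSpace.exp_eq_tsum_div]

end Dyson

/-! ### Rank one perturbations of unitary groups -/

/-- The group generated by a rank one perturbation of the generator of a unitary group. -/
theorem exists_perturbed_group {H : Type*} [NormedAddCommGroup H] [InnerProductSpace ℂ H]
    [CompleteSpace H] {U : ℝ → H →L[ℂ] H} (hU0 : U 0 = 1) (hUadd : ∀ s t, U (s + t) = U s * U t)
    (hUcont : ∀ u, Continuous fun t => U t u) (hUnorm : ∀ t u, ‖U t u‖ ≤ ‖u‖)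
    (hUadj : ∀ t u v, inner ℂ u (U t v) = inner ℂ (U (-t) u) v) (p : H) (κ : ℂ) :
    ∃ S : ℝ → H →L[ℂ] H, S 0 = 1 ∧ (∀ s t, S (s + t) = S s * S t) ∧
      (∀ u, Continuous fun t => S t u) ∧
      (∃ C b : ℝ, ∀ t, ‖S t‖ ≤ C * Real.exp (b * |t|)) ∧
      ∀ u, Tendsto (fun h : ℝ => ((h⁻¹ : ℝ) : ℂ) • (S h u - U h u)) (𝓝[≠] 0)
        (𝓝 ((κ * inner ℂ p u) • p)) := by
  have hUinv : ∀ t, U (-t) * U t = 1 := fun t => by rw [← hUadd, neg_add_cancel, hU0]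
  have hUinv' : ∀ t, U t * U (-t) = 1 := fun t => by rw [← hUadd, add_neg_cancel, hU0]
  have hUn : ∀ t, ‖U t‖ ≤ 1 := fun t =>
    ContinuousLinearMap.opNorm_le_bound _ zero_le_one fun u => by simpa using hUnorm t u
  set B₀ : H →L[ℂ] H := κ • (innerSL ℂ p).smulRight p with hB₀
  -- Interaction picture: writing S = U V, the perturbed equation becomes V' = B V with a bounded
  -- coefficient, and the unbounded generator no longer appears.
  set B : ℝ → H →L[ℂ] H := fun t => U (-t) * B₀ * U t with hB
  -- B t has rank one and depends only on the vector U(-t)p. Hence strong continuity of U already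
  -- makes B continuous in operator norm, as the differential equation requires.
  have hBform : ∀ t, B t = κ • ContinuousLinearMap.smulRightL ℂ H H (innerSL ℂ (U (-t) p)) (U (-t) p) := by
    intro t
    ext v
    simp [hB, hB₀, hUadj]
  have hBcont : Continuous B := by
    rw [funext hBform]
    have h1 : Continuous fun t : ℝ => U (-t) p := (hUcont p).comp continuous_neg
    have h2 : Continuous fun t : ℝ => innerSL ℂ (U (-t) p) := (innerSL ℂ).continuous.comp h1
    have h3 : Continuous fun t : ℝ => ContinuousLinearMap.smulRightL ℂ H H (innerSL ℂ (U (-t) p)) :=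
      (ContinuousLinearMap.smulRightL ℂ H H).continuous.comp h2
    exact (h3.clm_apply h1).const_smul κ
  have hBb : ∀ t, ‖B t‖ ≤ ‖B₀‖ := by
    intro t
    calc ‖B t‖ ≤ ‖U (-t)‖ * ‖B₀‖ * ‖U t‖ :=
          (norm_mul_le _ _).trans (mul_le_mul_of_nonneg_right (norm_mul_le _ _) (norm_nonneg _))
      _ ≤ 1 * ‖B₀‖ * 1 := by
        gcongr
        · exact hUn _
        · exact hUn _
      _ = ‖B₀‖ := by ring
  obtain ⟨V, hV0, hVd, hVn⟩ := exists_linear_ODE hBcont hBb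
  have hVc : Continuous V := continuous_iff_continuousAt.2 fun t => (hVd t).continuousAt
  have hBadd : ∀ s t, U (-s) * B t = B (t + s) * U (-s) := by
    intro s t
    simp only [hB]
    rw [neg_add, hUadd t s, add_comm (-t), hUadd (-s) (-t)]
    calc U (-s) * (U (-t) * B₀ * U t) = U (-s) * U (-t) * B₀ * U t * 1 := by
          simp only [mul_assoc, mul_one]
      _ = U (-s) * U (-t) * B₀ * (U t * U s) * U (-s) := by
          rw [← hUinv' s]; simp only [mul_assoc]
  -- As functions of t both sides solve X' = B(t + s)X with value V s at 0. Uniqueness gives the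
  -- cocycle identity, which is the group law of S.
  have hVadd : ∀ s t, V (t + s) = U (-s) * V t * U s * V s := by
    intro s
    have h1 : (fun t => V (t + s)) = fun t => U (-s) * V t * U s * V s := by
      refine ODE_solution_unique_univ (v := fun t X => B (t + s) * X) (s := fun _ => Set.univ)
        (K := ‖B₀‖.toNNReal) (t₀ := 0) (fun t => ?_) (fun t => ⟨?_, trivial⟩)
        (fun t => ⟨?_, trivial⟩) ?_
      · refine LipschitzWith.lipschitzOnWith (LipschitzWith.of_dist_le_mul fun X Y => ?_)
        rw [dist_eq_norm, dist_eq_norm, ← mul_sub, Real.coe_toNNReal _ (norm_nonneg _)]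
        exact (norm_mul_le _ _).trans (mul_le_mul_of_nonneg_right (hBb _) (norm_nonneg _))
      · exact (hVd (t + s)).comp_add_const t s
      · have h2 := (((hVd t).const_mul (U (-s))).mul_const (U s)).mul_const (V s)
        refine h2.congr_deriv ?_
        rw [← mul_assoc (U (-s)), hBadd]
        simp only [mul_assoc]
      · simp only [zero_add, hV0, mul_one]
        rw [hUinv, one_mul]
    exact fun t => congrFun h1 t
  refine ⟨fun t => U t * V t, ?_, fun s t => ?_, fun u => ?_, ⟨‖(1 : H →L[ℂ] H)‖, ‖B₀‖, fun t => ?_⟩,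
    fun u => ?_⟩
  · simp only [hU0, hV0, mul_one]
  · simp only
    rw [hVadd t s, hUadd]
    calc U s * U t * (U (-t) * V s * U t * V t) = U s * (U t * U (-t)) * V s * U t * V t := by
          simp only [mul_assoc]
      _ = _ := by rw [hUinv']; simp only [mul_assoc, mul_one]
  · rw [continuous_iff_continuousAt]
    intro t
    have h1 : ContinuousAt (fun t => V t u) t := (hVc.clm_apply continuous_const).continuousAt
    -- U is only strongly continuous, so the change of V is controlled by the contraction property
    -- and the change of U on the fixed vector V t u.
    have h2 : Tendsto (fun s => U s (V s u - V t u)) (𝓝 t) (𝓝 0) := by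
      refine squeeze_zero_norm (fun s => hUnorm s _) ?_
      have := (h1.tendsto.sub_const (V t u)).norm
      simpa using this
    have h3 : Tendsto (fun s => U s (V t u)) (𝓝 t) (𝓝 (U t (V t u))) := (hUcont _).tendsto t
    have h4 := h2.add h3
    rw [zero_add] at h4
    refine h4.congr fun s => ?_
    rw [← map_add, sub_add_cancel]
    rfl
  · refine (norm_mul_le _ _).trans ?_
    calc _ ≤ 1 * ‖V t‖ := by gcongr; exact hUn t
      _ ≤ _ := by rw [one_mul]; exact hVn t
  -- The quotient (S h u - U h u)/h equals U h applied to (V h u - u)/h, whose limit is V'(0)u =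
  -- B₀u. No condition on u is needed since the perturbation is bounded.
  · have h1 : HasDerivAt (fun t => V t u) (B₀ u) 0 := by
      have h2 := ((ContinuousLinearMap.apply ℂ H u).restrictScalars ℝ).hasFDerivAt.comp_hasDerivAt 0
        (hVd 0)
      refine h2.congr_deriv ?_
      simp [hV0, hB, hU0]
    have h2 : Tendsto (fun h : ℝ => h⁻¹ • (V h u - u)) (𝓝[≠] 0) (𝓝 (B₀ u)) := by
      have := hasDerivAt_iff_tendsto_slope_zero.1 h1
      simpa [hV0] using this
    have h3 : Tendsto (fun h : ℝ => U h (h⁻¹ • (V h u - u) - B₀ u)) (𝓝[≠] 0) (𝓝 0) := by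
      refine squeeze_zero_norm (fun s => hUnorm s _) ?_
      have := (h2.sub_const (B₀ u)).norm
      simpa using this
    have h4 : Tendsto (fun h : ℝ => U h (B₀ u)) (𝓝[≠] 0) (𝓝 (B₀ u)) := by
      have := (hUcont (B₀ u)).tendsto 0
      rw [hU0] at this
      exact this.mono_left nhdsWithin_le_nhds
    have h5 := h3.add h4
    rw [zero_add] at h5
    have h6 : B₀ u = (κ * inner ℂ p u) • p := by simp [hB₀, smul_smul]
    rw [← h6]
    refine h5.congr fun h => ?_
    rw [← map_add, sub_add_cancel, ← coe_smul, map_smul, map_sub]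
    rfl

/-! ### Multiplication operators on `L²` -/

section Multiplication

variable {X : Type*} [MeasurableSpace X] {μ : Measure X}

/-- Dominated convergence in `L²`. -/
theorem tendsto_L2_of_dominated {ι : Type*} {l : Filter ι} [l.IsCountablyGenerated]
    {F : ι → Lp ℂ 2 μ} {φ : ι → X → ℂ} (hF : ∀ i, F i =ᵐ[μ] φ i) {f : Lp ℂ 2 μ} {b : X → ℝ}
    (hb : MemLp b 2 μ) (hbound : ∀ᶠ i in l, ∀ᵐ x ∂μ, ‖φ i x - f x‖ ≤ b x)
    (hlim : ∀ᵐ x ∂μ, Tendsto (fun i => φ i x) l (𝓝 (f x))) : Tendsto F l (𝓝 f) := by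
  have hsq : ∀ w : Lp ℂ 2 μ, ‖w‖ ^ 2 = ∫ x, ‖w x‖ ^ 2 ∂μ := by
    intro w
    have h1 : ((‖w‖ ^ 2 : ℝ) : ℂ) = ∫ x, ((‖w x‖ ^ 2 : ℝ) : ℂ) ∂μ := by
      rw [ofReal_pow]
      refine (inner_self_eq_norm_sq_to_K (𝕜 := ℂ) w).symm.trans ?_
      rw [L2.inner_def]
      refine integral_congr_ae (Eventually.of_forall fun x => ?_)
      simp only [inner_self_eq_norm_sq_to_K, ofReal_pow]
      rfl
    exact ofReal_injective (h1.trans integral_ofReal)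
  have h1 : Tendsto (fun i => ∫ x, ‖(F i - f) x‖ ^ 2 ∂μ) l (𝓝 0) := by
    have h2 : Tendsto (fun i => ∫ x, ‖φ i x - f x‖ ^ 2 ∂μ) l (𝓝 (∫ _, (0 : ℝ) ∂μ)) := by
      refine tendsto_integral_filter_of_dominated_convergence (fun x => b x ^ 2) ?_ ?_ ?_ ?_
      · refine Eventually.of_forall fun i => ?_
        exact ((((Lp.aestronglyMeasurable (F i)).congr (hF i)).sub
          (Lp.aestronglyMeasurable f)).norm).pow 2
      · filter_upwards [hbound] with i hi
        filter_upwards [hi] with x hx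
        rw [Real.norm_of_nonneg (by positivity)]
        gcongr
      · exact hb.integrable_sq
      · filter_upwards [hlim] with x hx
        have := ((hx.sub_const (f x)).norm).pow 2
        simpa using this
    rw [integral_zero] at h2
    refine h2.congr fun i => integral_congr_ae ?_
    filter_upwards [hF i, Lp.coeFn_sub (F i) f] with x h3 h4
    rw [h4, Pi.sub_apply, h3]
  rw [tendsto_iff_norm_sub_tendsto_zero]
  have h3 := h1.congr fun i => (hsq (F i - f)).symm
  have h4 := h3.sqrt
  simpa [Real.sqrt_sq (norm_nonneg _)] using h4

theorem memLp_bounded_mul {m : X → ℂ} (hm : AEStronglyMeasurable m μ) {c : ℝ}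
    (hc : ∀ x, ‖m x‖ ≤ c) (u : Lp ℂ 2 μ) : MemLp (fun x => m x * u x) 2 μ :=
  MemLp.of_le_mul (c := c) (Lp.memLp u) (hm.mul (Lp.aestronglyMeasurable u))
    (Eventually.of_forall fun x => by
      rw [norm_mul]
      exact mul_le_mul_of_nonneg_right (hc x) (norm_nonneg _))

/-- Multiplication by a bounded function. -/
def mulCLM (m : X → ℂ) (hm : AEStronglyMeasurable m μ) (c : ℝ) (hc : ∀ x, ‖m x‖ ≤ c) :
    Lp ℂ 2 μ →L[ℂ] Lp ℂ 2 μ :=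
  LinearMap.mkContinuous
    { toFun := fun u => (memLp_bounded_mul hm hc u).toLp _
      map_add' := fun u v => by
        refine Eq.trans ?_ (MemLp.toLp_add (memLp_bounded_mul hm hc u) (memLp_bounded_mul hm hc v))
        refine (MemLp.toLp_eq_toLp_iff _ _).2 ?_
        filter_upwards [Lp.coeFn_add u v] with ω h
        rw [h]
        simp [mul_add]
      map_smul' := fun a u => by
        refine Eq.trans ?_ (MemLp.toLp_const_smul a (memLp_bounded_mul hm hc u))
        refine (MemLp.toLp_eq_toLp_iff _ _).2 ?_
        filter_upwards [Lp.coeFn_smul a u] with ω h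
        rw [h]
        simp only [Pi.smul_apply, smul_eq_mul]
        ring } c fun u => by
      refine Lp.norm_le_mul_norm_of_ae_le_mul ?_
      filter_upwards [(memLp_bounded_mul hm hc u).coeFn_toLp] with x hx
      refine (congrArg norm hx).trans_le ?_
      rw [norm_mul]
      exact mul_le_mul_of_nonneg_right (hc x) (norm_nonneg _)

theorem coeFn_mulCLM (m : X → ℂ) (hm : AEStronglyMeasurable m μ) (c : ℝ) (hc : ∀ x, ‖m x‖ ≤ c)
    (u : Lp ℂ 2 μ) : mulCLM m hm c hc u =ᵐ[μ] fun x => m x * u x :=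
  (memLp_bounded_mul hm hc u).coeFn_toLp

theorem norm_mulCLM_apply_le (m : X → ℂ) (hm : AEStronglyMeasurable m μ) (c : ℝ)
    (hc : ∀ x, ‖m x‖ ≤ c) (u : Lp ℂ 2 μ) : ‖mulCLM m hm c hc u‖ ≤ c * ‖u‖ := by
  refine Lp.norm_le_mul_norm_of_ae_le_mul ?_
  filter_upwards [coeFn_mulCLM m hm c hc u] with x hx
  rw [hx, norm_mul]
  exact mul_le_mul_of_nonneg_right (hc x) (norm_nonneg _)

end Multiplication

/-! ### The unitary group `e^{iωt}` -/

section UnitaryGroup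

variable {μ : Measure ℝ}

/-- Multiplication by `e^{iωt}`. -/
def phaseGroup (μ : Measure ℝ) (t : ℝ) : Lp ℂ 2 μ →L[ℂ] Lp ℂ 2 μ :=
  mulCLM (fun ω : ℝ => exp (I * ((t * ω : ℝ) : ℂ)))
    (by fun_prop : Continuous fun ω : ℝ => exp (I * ((t * ω : ℝ) : ℂ))).aestronglyMeasurable 1
    fun ω => (norm_exp_I_mul_ofReal _).le

theorem coeFn_phaseGroup (t : ℝ) (u : Lp ℂ 2 μ) :
    phaseGroup μ t u =ᵐ[μ] fun ω => exp (I * ((t * ω : ℝ) : ℂ)) * u ω :=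
  coeFn_mulCLM _ _ _ _ u

theorem phaseGroup_zero : phaseGroup μ 0 = 1 := by
  ext1 u
  refine Lp.ext ?_
  filter_upwards [coeFn_phaseGroup 0 u] with x hx
  rw [hx]
  simp

theorem phaseGroup_add (s t : ℝ) : phaseGroup μ (s + t) = phaseGroup μ s * phaseGroup μ t := by
  ext1 u
  refine Lp.ext ?_
  rw [mul_apply_eq_comp]
  filter_upwards [coeFn_phaseGroup (s + t) u, coeFn_phaseGroup s (phaseGroup μ t u),
    coeFn_phaseGroup t u] with x h1 h2 h3
  rw [h1, h2, h3, ← mul_assoc, ← exp_add]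
  push_cast
  ring_nf

theorem norm_phaseGroup_apply_le (t : ℝ) (u : Lp ℂ 2 μ) : ‖phaseGroup μ t u‖ ≤ ‖u‖ := by
  refine (norm_mulCLM_apply_le _ _ _ _ u).trans_eq (one_mul _)

theorem continuous_phaseGroup (u : Lp ℂ 2 μ) : Continuous fun t => phaseGroup μ t u := by
  rw [continuous_iff_continuousAt]
  intro t
  refine tendsto_L2_of_dominated (fun s => coeFn_phaseGroup s u) (b := fun x => 2 * ‖u x‖)
    ((Lp.memLp u).norm.const_mul 2) (Eventually.of_forall fun s => ?_) ?_
  · filter_upwards [coeFn_phaseGroup t u] with x hx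
    rw [hx, ← sub_mul, norm_mul]
    refine mul_le_mul_of_nonneg_right ((norm_sub_le _ _).trans ?_) (norm_nonneg _)
    rw [norm_exp_I_mul_ofReal, norm_exp_I_mul_ofReal]
    norm_num
  · filter_upwards [coeFn_phaseGroup t u] with x hx
    rw [hx]
    exact (by fun_prop : Continuous fun s : ℝ => exp (I * ((s * x : ℝ) : ℂ)) * u x).tendsto t

theorem inner_phaseGroup (t : ℝ) (u v : Lp ℂ 2 μ) :
    inner ℂ u (phaseGroup μ t v) = inner ℂ (phaseGroup μ (-t) u) v := by
  rw [L2.inner_def, L2.inner_def]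
  refine integral_congr_ae ?_
  filter_upwards [coeFn_phaseGroup t v, coeFn_phaseGroup (-t) u] with x h1 h2
  rw [h1, h2]
  simp only [RCLike.inner_apply, map_mul]
  rw [← exp_conj]
  simp only [map_mul, conj_I, conj_ofReal]
  push_cast
  ring_nf

/-- The functions on which `e^{iωt}` is differentiable, with their derivative. -/
theorem tendsto_phaseGroup {u v : Lp ℂ 2 μ} (h : (fun ω : ℝ => I * ω * u ω) =ᵐ[μ] v) :
    Tendsto (fun t : ℝ => ((t⁻¹ : ℝ) : ℂ) • (phaseGroup μ t u - u)) (𝓝[≠] 0) (𝓝 v) := by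
  refine tendsto_L2_of_dominated
    (φ := fun t ω => ((t⁻¹ : ℝ) : ℂ) * (exp (I * ((t * ω : ℝ) : ℂ)) * u ω - u ω))
    (b := fun x => 2 * ‖v x‖) (fun t => ?_) ((Lp.memLp v).norm.const_mul 2) ?_ ?_
  · filter_upwards [coeFn_phaseGroup t u, Lp.coeFn_sub (phaseGroup μ t u) u,
      Lp.coeFn_smul ((t⁻¹ : ℝ) : ℂ) (phaseGroup μ t u - u)] with x h1 h2 h3
    rw [h3, Pi.smul_apply, h2, Pi.sub_apply, h1, smul_eq_mul]
  · filter_upwards [self_mem_nhdsWithin] with t (ht : t ≠ 0)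
    filter_upwards [h] with x hx
    rw [two_mul]
    refine (norm_sub_le _ _).trans (add_le_add_left ?_ _)
    rw [← hx, ← sub_one_mul, ← mul_assoc, norm_mul, norm_mul (I * (x : ℂ))]
    refine mul_le_mul_of_nonneg_right ?_ (norm_nonneg _)
    rw [norm_mul, norm_mul, norm_I, one_mul, norm_real, norm_real]
    calc ‖t⁻¹‖ * ‖exp (I * ((t * x : ℝ) : ℂ)) - 1‖ ≤ ‖t⁻¹‖ * ‖t * x‖ := by
          gcongr
          exact Real.norm_exp_I_mul_ofReal_sub_one_le
      _ = ‖x‖ := by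
        rw [← norm_mul, inv_mul_cancel_left₀ ht]
  · filter_upwards [h] with x hx
    rw [← hx]
    have h1 : HasDerivAt (fun t : ℝ => exp (I * ((t * x : ℝ) : ℂ)) * u x) (I * x * u x) 0 := by
      have h2 : HasDerivAt (fun t : ℝ => I * ((t * x : ℝ) : ℂ)) (I * x) 0 := by
        have := (((hasDerivAt_id (0 : ℝ)).mul_const x).ofReal_comp).const_mul I
        simpa using this
      have h3 := h2.cexp.mul_const (u x)
      simpa using h3
    have := hasDerivAt_iff_tendsto_slope_zero.1 h1
    simpa using this

/-- L² convergence of the quotients along t = 1/(n + 1) gives almost everywhere convergence on a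
subsequence, while pointwise they tend to iωu(ω). This shows that the generator is no larger than iM
on its maximal domain. -/
theorem eq_of_tendsto_phaseGroup {u v : Lp ℂ 2 μ}
    (h : Tendsto (fun t : ℝ => ((t⁻¹ : ℝ) : ℂ) • (phaseGroup μ t u - u)) (𝓝[>] 0) (𝓝 v)) :
    (fun ω : ℝ => I * ω * u ω) =ᵐ[μ] v := by
  have hs : Tendsto (fun n : ℕ => (1 / ((n : ℝ) + 1))) atTop (𝓝[>] 0) :=
    tendsto_nhdsWithin_iff.2 ⟨tendsto_one_div_add_atTop_nhds_zero_nat,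
      Eventually.of_forall fun n => by simp only [Set.mem_Ioi]; positivity⟩
  obtain ⟨ns, hns, hlim⟩ := (tendstoInMeasure_of_tendsto_Lp (h.comp hs)).exists_seq_tendsto_ae
  have hae : ∀ᵐ ω ∂μ, ∀ n : ℕ, ((fun t : ℝ => ((t⁻¹ : ℝ) : ℂ) • (phaseGroup μ t u - u)) ∘
      fun n : ℕ => (1 / ((n : ℝ) + 1))) n ω =
      (((1 / ((n : ℝ) + 1))⁻¹ : ℝ) : ℂ) *
        (exp (I * (((1 / ((n : ℝ) + 1)) * ω : ℝ) : ℂ)) * u ω - u ω) := by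
    refine ae_all_iff.2 fun n => ?_
    filter_upwards [coeFn_phaseGroup (1 / ((n : ℝ) + 1)) u,
      Lp.coeFn_sub (phaseGroup μ (1 / ((n : ℝ) + 1)) u) u,
      Lp.coeFn_smul (((1 / ((n : ℝ) + 1))⁻¹ : ℝ) : ℂ) (phaseGroup μ (1 / ((n : ℝ) + 1)) u - u)]
      with x h1 h2 h3
    rw [Function.comp_apply, h3, Pi.smul_apply, h2, Pi.sub_apply, h1, smul_eq_mul]
  filter_upwards [hlim, hae] with x hx hx'
  refine tendsto_nhds_unique ?_ hx
  simp only [hx']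
  have h1 : HasDerivAt (fun t : ℝ => exp (I * ((t * x : ℝ) : ℂ)) * u x) (I * x * u x) 0 := by
    have h2 : HasDerivAt (fun t : ℝ => I * ((t * x : ℝ) : ℂ)) (I * x) 0 := by
      have := (((hasDerivAt_id (0 : ℝ)).mul_const x).ofReal_comp).const_mul I
      simpa using this
    have h3 := h2.cexp.mul_const (u x)
    simpa using h3
  have h4 := ((hasDerivAt_iff_tendsto_slope_zero.1 h1).mono_left
    (nhdsWithin_mono 0 fun x (hx : 0 < x) => hx.ne')).comp (hs.comp hns.tendsto_atTop)
  refine h4.congr fun n => ?_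
  simp

end UnitaryGroup

/-! ### Laplace transforms of groups -/

/-- Here r plays the role of (l - T)⁻¹u: differentiating e^{-lt}(S t r, p) gives -e^{-lt}(S t u, p).
The function decays at infinity since Re l exceeds the growth bound, so the integral is its value at
0. The two-sided quotient and the group law make the derivative two-sided at every time. -/
theorem laplace_group {H : Type*} [NormedAddCommGroup H] [InnerProductSpace ℂ H]
    {S : ℝ → H →L[ℂ] H} (hS0 : S 0 = 1) (hSadd : ∀ s t, S (s + t) = S s * S t)
    (hScont : ∀ u, Continuous fun t => S t u) {C b : ℝ}
    (hSnorm : ∀ t, ‖S t‖ ≤ C * Real.exp (b * |t|)) {l : ℂ} (hl : b < l.re) {r u : H}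
    (hr : Tendsto (fun h : ℝ => ((h⁻¹ : ℝ) : ℂ) • (S h r - r)) (𝓝[≠] 0) (𝓝 (l • r - u))) (p : H) :
    IntegrableOn (fun t : ℝ => exp (-l * t) * inner ℂ p (S t u)) (Set.Ioi 0) ∧
      ∫ t in Set.Ioi (0 : ℝ), exp (-l * t) * inner ℂ p (S t u) = inner ℂ p r := by
  have hbound : ∀ (w : H) (t : ℝ), 0 ≤ t →
      ‖exp (-l * t) * inner ℂ p (S t w)‖ ≤ ‖p‖ * C * ‖w‖ * Real.exp (-(l.re - b) * t) := by
    intro w t ht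
    have h1 : ‖inner ℂ p (S t w)‖ ≤ ‖p‖ * (C * Real.exp (b * t) * ‖w‖) := by
      refine (norm_inner_le_norm _ _).trans ?_
      gcongr
      refine ((S t).le_opNorm w).trans ?_
      gcongr
      simpa [abs_of_nonneg ht] using hSnorm t
    rw [norm_mul, norm_exp]
    have h2 : (-l * (t : ℂ)).re = -l.re * t := by simp
    rw [h2]
    calc _ ≤ Real.exp (-l.re * t) * (‖p‖ * (C * Real.exp (b * t) * ‖w‖)) := by gcongr
      _ = ‖p‖ * C * ‖w‖ * (Real.exp (-l.re * t) * Real.exp (b * t)) := by ring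
      _ = _ := by rw [← Real.exp_add]; ring_nf
  have hcont : ∀ w : H, Continuous fun t : ℝ => exp (-l * t) * inner ℂ p (S t w) := fun w =>
    (by fun_prop : Continuous fun t : ℝ => exp (-l * (t : ℂ))).mul
      (continuous_const.inner (hScont w))
  have hInt : IntegrableOn (fun t : ℝ => exp (-l * t) * inner ℂ p (S t u)) (Set.Ioi 0) := by
    refine Integrable.mono' (((integrableOn_exp_mul_Ioi (a := -(l.re - b)) (by linarith) 0)).const_mul
      (‖p‖ * C * ‖u‖)) (hcont u).aestronglyMeasurable ?_
    filter_upwards [ae_restrict_mem measurableSet_Ioi] with t ht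
    exact hbound u t (le_of_lt ht)
  refine ⟨hInt, ?_⟩
  have hSd : ∀ t, HasDerivAt (fun t => S t r) (S t (l • r - u)) t := by
    intro t
    rw [hasDerivAt_iff_tendsto_slope_zero]
    refine (((S t).continuous.tendsto _).comp hr).congr fun h => ?_
    rw [Function.comp_apply, map_smul, map_sub, hSadd, coe_smul]
    rfl
  have hd : ∀ t : ℝ, HasDerivAt (fun t : ℝ => exp (-l * t) * inner ℂ p (S t r))
      (-(exp (-l * t) * inner ℂ p (S t u))) t := by
    intro t
    have h1 : HasDerivAt (fun t : ℝ => exp (-l * (t : ℂ))) (exp (-l * t) * (-l)) t := by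
      have h2 : HasDerivAt (fun t : ℝ => -l * (t : ℂ)) (-l) t := by
        simpa using (hasDerivAt_id t).ofReal_comp.const_mul (-l)
      exact h2.cexp
    have h3 : HasDerivAt (fun t => inner ℂ p (S t r)) (inner ℂ p (S t (l • r - u))) t := by
      have := (hasDerivAt_const t p).inner ℂ (hSd t)
      simpa [-map_sub, -map_smul] using this
    refine (h1.mul h3).congr_deriv ?_
    rw [map_sub, map_smul, inner_sub_right, inner_smul_right]
    ring
  have hlim : Tendsto (fun t : ℝ => exp (-l * t) * inner ℂ p (S t r)) atTop (𝓝 0) := by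
    have h1 : Tendsto (fun t : ℝ => ‖p‖ * C * ‖r‖ * Real.exp (-(l.re - b) * t)) atTop (𝓝 0) := by
      have h2 : Tendsto (fun t : ℝ => -(l.re - b) * t) atTop atBot :=
        tendsto_id.const_mul_atTop_of_neg (by linarith)
      simpa using (Real.tendsto_exp_atBot.comp h2).const_mul (‖p‖ * C * ‖r‖)
    refine squeeze_zero_norm' ?_ h1
    filter_upwards [eventually_ge_atTop 0] with t ht using hbound r t ht
  have key := integral_Ioi_of_hasDerivAt_of_tendsto' (fun t _ => hd t) hInt.neg hlim
  rw [integral_neg] at key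
  simp only [ofReal_zero, mul_zero, exp_zero, one_mul, zero_sub, neg_inj, hS0] at key
  simpa using key

section Operator

variable {g : FrequencyDensity} {K : ℝ} {f₁ : ℂ}

/-! ### The operator `T₁` -/

theorem coeFn_P0 (g : FrequencyDensity) : P0 g =ᵐ[g.measure] fun _ => (1 : ℂ) :=
  Lp.coeFn_const 2 g.measure (1 : ℂ)

theorem inner_P0 (u : g.L2) : inner ℂ (P0 g) u = ∫ ω, u ω ∂g.measure := by
  rw [L2.inner_def]
  refine integral_congr_ae ?_
  filter_upwards [coeFn_P0 g] with ω h
  rw [h]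
  simp

/-- Reduces statements about T₁ to identities almost everywhere. The domain condition comes for
free, because the right-hand side belongs to L². -/
theorem mem_graph_T1 {u v : g.L2} :
    (u, v) ∈ (T1 g K f₁).graph ↔
      (fun ω : ℝ => I * ω * u ω) =ᵐ[g.measure]
        (v - (I * K * f₁ * inner ℂ (P0 g) u) • P0 g : g.L2) := by
  have hval : ∀ x : (T1 g K f₁).domain, T1 g K f₁ x =
      I • MemLp.toLp (fun ω : ℝ => (ω : ℂ) * (x : g.L2) ω) x.2 +
        (I * K * f₁ * inner ℂ (P0 g) (x : g.L2)) • P0 g := by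
    intro x
    rw [mul_smul]
    rfl
  have hcoe : ∀ h : MemLp (fun ω : ℝ => (ω : ℂ) * u ω) 2 g.measure,
      (I • h.toLp _ : g.L2) =ᵐ[g.measure] fun ω : ℝ => I * ω * u ω := by
    intro h
    filter_upwards [Lp.coeFn_smul I (h.toLp _), h.coeFn_toLp] with ω h1 h2
    rw [h1, Pi.smul_apply, h2, smul_eq_mul, mul_assoc]
  rw [LinearPMap.mem_graph_iff]
  constructor
  · rintro ⟨x, hx, hv⟩
    obtain ⟨x, hxd⟩ := x
    simp only at hx hv
    subst hx
    rw [← hv, hval, add_sub_cancel_right]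
    exact (hcoe hxd).symm
  · intro h
    have hmem : MemLp (fun ω : ℝ => (ω : ℂ) * u ω) 2 g.measure := by
      refine ((Lp.memLp (v - (I * K * f₁ * inner ℂ (P0 g) u) • P0 g : g.L2)).const_smul
        (-I)).ae_eq ?_
      filter_upwards [h] with ω hω
      rw [Pi.smul_apply, ← hω, smul_eq_mul, ← mul_assoc, ← mul_assoc, neg_mul, I_mul_I]
      ring
    refine ⟨⟨u, hmem⟩, rfl, ?_⟩
    rw [hval, ← eq_sub_iff_add_eq]
    exact Lp.ext ((hcoe hmem).trans h)

/-- `T₁` generates a strongly continuous group. -/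
theorem exists_group (g : FrequencyDensity) (K : ℝ) (f₁ : ℂ) :
    ∃ S : ℝ → g.L2 →L[ℂ] g.L2, S 0 = 1 ∧ (∀ s t, S (s + t) = S s * S t) ∧
      (∀ u, Continuous fun t => S t u) ∧
      (∃ C b : ℝ, ∀ t, ‖S t‖ ≤ C * Real.exp (b * |t|)) ∧
      (∀ u v, (u, v) ∈ (T1 g K f₁).graph →
        Tendsto (fun t : ℝ => ((t⁻¹ : ℝ) : ℂ) • (S t u - u)) (𝓝[≠] 0) (𝓝 v)) ∧
      IsSemigroupGeneratedBy S (T1 g K f₁) := by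
  obtain ⟨S, hS0, hSadd, hScont, hSnorm, hSU⟩ := exists_perturbed_group (phaseGroup_zero)
    phaseGroup_add continuous_phaseGroup norm_phaseGroup_apply_le inner_phaseGroup (P0 g)
    (I * K * f₁)
  have hgen : ∀ u v, (u, v) ∈ (T1 g K f₁).graph →
      Tendsto (fun t : ℝ => ((t⁻¹ : ℝ) : ℂ) • (S t u - u)) (𝓝[≠] 0) (𝓝 v) := by
    intro u v huv
    have h1 := (hSU u).add (tendsto_phaseGroup (mem_graph_T1.1 huv))
    rw [add_sub_cancel] at h1
    refine h1.congr fun t => ?_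
    rw [← smul_add, sub_add_sub_cancel]
  refine ⟨S, hS0, hSadd, hScont, hSnorm, hgen, hS0, fun s t _ _ => hSadd s t,
    fun u => (hScont u).continuousOn, fun u v => ⟨fun h => (hgen u v h).mono_left
      (nhdsWithin_mono 0 fun x (hx : 0 < x) => hx.ne'), fun h => ?_⟩⟩
  have hsub : Set.Ioi (0 : ℝ) ⊆ {0}ᶜ := fun x (hx : 0 < x) => hx.ne'
  -- For the converse, subtracting the limit of the rank-one part leaves convergent quotients of the
  -- unitary group, which identify iωu.
  refine mem_graph_T1.2 (eq_of_tendsto_phaseGroup ?_)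
  refine (h.sub ((hSU u).mono_left (nhdsWithin_mono 0 hsub))).congr fun t => ?_
  rw [← smul_sub, sub_sub_sub_cancel_left]

/-! ### The resolvent and the spectrum of T₁ -/

/-- Multiplication by `1 / (z - iω)`. -/
def freeResolvent (g : FrequencyDensity) (z : ℂ) (hz : z.re ≠ 0) : g.L2 →L[ℂ] g.L2 :=
  mulCLM (fun ω : ℝ => (z - I * ω)⁻¹)
    (by fun_prop : Measurable fun ω : ℝ => (z - I * (ω : ℂ))⁻¹).aestronglyMeasurable |z.re|⁻¹
    fun ω => by
      rw [norm_inv]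
      exact inv_anti₀ (abs_pos.2 hz) (abs_re_le_norm_sub_I_mul z ω)

theorem sub_I_mul_ne_zero {z : ℂ} (hz : z.re ≠ 0) (ω : ℝ) : z - I * ω ≠ 0 := by
  intro h
  apply hz
  simpa using congrArg re h

theorem coeFn_freeResolvent {z : ℂ} (hz : z.re ≠ 0) (u : g.L2) :
    freeResolvent g z hz u =ᵐ[g.measure] fun ω => (z - I * ω)⁻¹ * u ω :=
  coeFn_mulCLM _ _ _ _ u

theorem inner_freeResolvent_toLp {z : ℂ} (hz : z.re ≠ 0) {q : ℝ → ℂ} (hq : MemLp q 2 g.measure) :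
    inner ℂ (P0 g) (freeResolvent g z hz (hq.toLp q)) = resolventM g q z := by
  rw [inner_P0, resolventM, ← g.integral_measure]
  refine integral_congr_ae ?_
  filter_upwards [coeFn_freeResolvent hz (hq.toLp q), hq.coeFn_toLp] with ω h1 h2
  rw [h1, h2, one_div]

theorem inner_freeResolvent_P0 {z : ℂ} (hz : z.re ≠ 0) :
    inner ℂ (P0 g) (freeResolvent g z hz (P0 g)) = dispersion g z := by
  rw [dispersion, ← inner_freeResolvent_toLp hz (memLp_const 1)]
  rfl

/-- Away from the zeros of `1 - iKf₁D` the resolvent of `T₁` exists and has the matrix element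
`Q / (1 - iKf₁D)`. -/
theorem exists_resolvent {z : ℂ} (hz : z.re ≠ 0) (hne : 1 - I * K * f₁ * dispersion g z ≠ 0) :
    ∃ R : g.L2 →L[ℂ] g.L2,
      (∀ u, (R u, z • R u - u) ∈ (T1 g K f₁).graph) ∧
      (∀ u v, (u, v) ∈ (T1 g K f₁).graph → R (z • u - v) = u) ∧
      ∀ q (hq : MemLp q 2 g.measure), inner ℂ (P0 g) (R (hq.toLp q)) =
        resolventM g q z / (1 - I * K * f₁ * dispersion g z) := by
  set κ : ℂ := I * K * f₁ with hκ
  set D := dispersion g z with hD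
  set R₀ := freeResolvent g z hz with hR₀
  have hD' : inner ℂ (P0 g) (R₀ (P0 g)) = D := inner_freeResolvent_P0 hz
  -- The rank-one perturbation formula for (z - iM - κP)⁻¹, obtained by solving for the unknown
  -- scalar (R u, P₀); D is the matrix element (R₀P₀, P₀).
  refine ⟨R₀ + ((κ / (1 - κ * D)) • (innerSL ℂ (P0 g) ∘L R₀)).smulRight (R₀ (P0 g)), fun u => ?_,
    fun u v huv => ?_, fun q hq => ?_⟩
  · set c := κ / (1 - κ * D) * inner ℂ (P0 g) (R₀ u) with hc
    have hR : (R₀ + ((κ / (1 - κ * D)) • (innerSL ℂ (P0 g) ∘L R₀)).smulRight (R₀ (P0 g))) u =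
        R₀ u + c • R₀ (P0 g) := by simp [hc]
    rw [hR, mem_graph_T1, ← hκ]
    have h1 : κ * inner ℂ (P0 g) (R₀ u + c • R₀ (P0 g)) = c := by
      rw [inner_add_right, inner_smul_right, hD', hc]
      field_simp
      ring
    rw [h1]
    have h2 : (z • (R₀ u + c • R₀ (P0 g)) - u - c • P0 g : g.L2) =
        (z • R₀ u - u) + c • (z • R₀ (P0 g) - P0 g) := by
      rw [smul_add, smul_sub, smul_comm z c]
      abel
    rw [h2]
    have h3 : ∀ w : g.L2, (z • R₀ w - w : g.L2) =ᵐ[g.measure] fun ω : ℝ => I * ω * R₀ w ω := by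
      intro w
      filter_upwards [coeFn_freeResolvent hz w, Lp.coeFn_smul z (R₀ w),
        Lp.coeFn_sub (z • R₀ w) w] with ω h4 h5 h6
      rw [h6, Pi.sub_apply, h5, Pi.smul_apply, smul_eq_mul, h4]
      have := sub_I_mul_ne_zero hz ω
      field_simp
      ring
    filter_upwards [Lp.coeFn_add (R₀ u) (c • R₀ (P0 g)), Lp.coeFn_smul c (R₀ (P0 g)),
      Lp.coeFn_add (z • R₀ u - u) (c • (z • R₀ (P0 g) - P0 g)),
      Lp.coeFn_smul c (z • R₀ (P0 g) - P0 g), h3 u, h3 (P0 g)] with ω h4 h5 h6 h7 h8 h9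
    rw [h6, Pi.add_apply, h7, Pi.smul_apply, h8, h9, h4, Pi.add_apply, h5, Pi.smul_apply,
      smul_eq_mul, smul_eq_mul]
    ring
  · rw [mem_graph_T1, ← hκ] at huv
    have h1 : R₀ (z • u - v) = u - (κ * inner ℂ (P0 g) u) • R₀ (P0 g) := by
      set k := κ * inner ℂ (P0 g) u with hk
      refine Lp.ext ?_
      filter_upwards [coeFn_freeResolvent hz (z • u - v), coeFn_freeResolvent hz (P0 g),
        coeFn_P0 g, Lp.coeFn_sub (z • u) v, Lp.coeFn_smul z u, Lp.coeFn_sub u (k • R₀ (P0 g)),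
        Lp.coeFn_smul k (R₀ (P0 g)), Lp.coeFn_sub v (k • P0 g), Lp.coeFn_smul k (P0 g), huv]
        with ω h1 h2 h3 h4 h5 h6 h7 h8 h9 h10
      rw [h8, Pi.sub_apply, h9, Pi.smul_apply, h3, smul_eq_mul] at h10
      rw [h1, h4, Pi.sub_apply, h5, Pi.smul_apply, h6, Pi.sub_apply, h7, Pi.smul_apply, h2, h3,
        smul_eq_mul, smul_eq_mul]
      have := sub_I_mul_ne_zero hz ω
      field_simp
      linear_combination h10
    simp only [add_apply, ContinuousLinearMap.smulRight_apply,
      smul_apply, ContinuousLinearMap.comp_apply, innerSL_apply_apply]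
    rw [h1, inner_sub_right, inner_smul_right, hD']
    have h2 : (κ / (1 - κ * D)) • (inner ℂ (P0 g) u - κ * inner ℂ (P0 g) u * D) =
        κ * inner ℂ (P0 g) u := by
      rw [smul_eq_mul]
      field_simp
    rw [h2, sub_add_cancel]
  · simp only [add_apply, ContinuousLinearMap.smulRight_apply,
      smul_apply, ContinuousLinearMap.comp_apply, innerSL_apply_apply]
    rw [inner_add_right, inner_smul_right, hD', inner_freeResolvent_toLp hz hq, smul_eq_mul]
    field_simp
    ring

/-- The semigroup generated by `T₁`, with the Laplace transforms of its matrix elements. -/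
theorem exists_semigroup (g : FrequencyDensity) (K : ℝ) (f₁ : ℂ) :
    ∃ S : ℝ → g.L2 →L[ℂ] g.L2, IsSemigroupGeneratedBy S (T1 g K f₁) ∧
      ∃ c₀ : ℝ, 0 ≤ c₀ ∧ ∀ l : ℂ, c₀ < l.re → 1 - I * K * f₁ * dispersion g l ≠ 0 →
        ∀ q (hq : MemLp q 2 g.measure),
          IntegrableOn (fun t : ℝ => exp (-l * t) * orderParameter g S (hq.toLp q) t)
            (Set.Ioi 0) ∧
          ∫ t in Set.Ioi (0 : ℝ), exp (-l * t) * orderParameter g S (hq.toLp q) t =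
            resolventM g q l / (1 - I * K * f₁ * dispersion g l) := by
  obtain ⟨S, hS0, hSadd, hScont, ⟨C, b, hSnorm⟩, hgen, hS⟩ := exists_group g K f₁
  refine ⟨S, hS, max b 0, le_max_right _ _, fun l hl hne q hq => ?_⟩
  have hl0 : l.re ≠ 0 := ((le_max_right _ _).trans_lt hl).ne'
  obtain ⟨R, hR1, -, hR3⟩ := exists_resolvent hl0 hne
  rw [← hR3 q hq]
  exact laplace_group hS0 hSadd hScont hSnorm ((le_max_left _ _).trans_lt hl)
    (hgen _ _ (hR1 (hq.toLp q))) (P0 g)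

theorem mem_resolventSet_T1 {z : ℂ} (hz : z.re ≠ 0) (hne : 1 - I * K * f₁ * dispersion g z ≠ 0) :
    z ∈ resolventSet (T1 g K f₁) := by
  obtain ⟨R, hR1, hR2, -⟩ := exists_resolvent hz hne
  refine ⟨R, fun u => ?_, fun u => hR2 _ _ ((T1 g K f₁).mem_graph u)⟩
  obtain ⟨x, hx, hv⟩ := (T1 g K f₁).mem_graph_iff.1 (hR1 u)
  simp only at hx hv
  have hmem : R u ∈ (T1 g K f₁).domain := hx ▸ x.2
  refine ⟨hmem, ?_⟩
  have : (⟨R u, hmem⟩ : (T1 g K f₁).domain) = x := Subtype.ext hx.symm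
  rw [this, hv, sub_sub_cancel]

theorem one_sub_coupling_mul_ne_zero (hf : f₁.im < 0) (hK : 0 < K) {d : ℂ}
    (hd : d ≠ 1 / (I * K * f₁)) : 1 - I * K * f₁ * d ≠ 0 := by
  have hf0 : f₁ ≠ 0 := by rintro rfl; simp at hf
  have hK0 : (K : ℂ) ≠ 0 := ofReal_ne_zero.2 hK.ne'
  intro h
  apply hd
  rw [eq_div_iff (mul_ne_zero (mul_ne_zero I_ne_zero hK0) hf0), mul_comm]
  linear_combination -h

/-- In the left half-plane D itself, unlike its continuation, has nonpositive real part, whereas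
Re(1/(iKf₁)) = -Im f₁/(K|f₁|²) > 0. So resonance poles are not spectrum. -/
theorem dispersion_ne_of_neg (hf : f₁.im < 0) (hK : 0 < K) {z : ℂ} (hz : z.re < 0) :
    dispersion g z ≠ 1 / (I * K * f₁) := by
  intro h
  have hf0 : f₁ ≠ 0 := by rintro rfl; simp at hf
  have h1 : (dispersion g z).re ≤ 0 := by
    rw [dispersion_re g hz.ne]
    refine integral_nonpos fun ω => ?_
    exact div_nonpos_of_nonpos_of_nonneg hz.le (by positivity)
  rw [h, one_div_coupling] at h1
  have h2 : 0 < -f₁.im / (K * ‖f₁‖ ^ 2) := by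
    have := norm_pos_iff.2 hf0
    have : 0 < -f₁.im := by linarith
    positivity
  rw [add_re, ofReal_re, re_ofReal_mul, I_re, mul_zero, add_zero] at h1
  exact absurd h1 (not_le.2 h2)

theorem spectrum_T1 {gs : ℂ → ℂ} (h : IsMeromorphicContinuation g.dens gs) (hf : f₁.im < 0)
    (hK : 0 < K) (hKc : ENNReal.ofReal K < transitionPoint g f₁) {z : ℂ}
    (hz : z ∈ opSpectrum (T1 g K f₁)) : z.re = 0 := by
  by_contra hne
  refine hz (mem_resolventSet_T1 hne (one_sub_coupling_mul_ne_zero hf hK ?_))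
  rcases lt_or_gt_of_ne hne with hneg | hpos
  · exact dispersion_ne_of_neg hf hK hneg
  · rw [dispersion_eq_cauchyTransform h, ← cauchyExt_of_pos _ hpos]
    exact cauchyExt_ne h hf hK hKc hpos.le

end Operator

section Continuation

variable {g : FrequencyDensity} {gs qs : ℂ → ℂ} {q : ℝ → ℂ} {K : ℝ} {f₁ : ℂ}

/-! ### Meromorphic continuation of `F₁` to the whole plane -/

theorem integrable_continuation_mul (hgs : IsMeromorphicContinuation g.dens gs)
    (hqs : IsAnalyticContinuation q qs) (hq : MemLp q 2 g.measure) :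
    Integrable fun ω : ℝ => qs ω * gs ω := by
  have h1 : Integrable q g.measure := hq.integrable one_le_two
  rw [FrequencyDensity.measure, integrable_withDensity_iff_integrable_smul₀'
    g.integrable.aemeasurable.ennreal_ofReal
    (Eventually.of_forall fun _ => ENNReal.ofReal_lt_top)] at h1
  refine h1.congr (Eventually.of_forall fun ω => ?_)
  simp only [ENNReal.toReal_ofReal (g.nonneg ω), real_smul, hqs.eq_on_real, hgs.eq_on_real]
  ring

theorem resolventM_eq_cauchyTransform (hgs : IsMeromorphicContinuation g.dens gs)
    (hqs : IsAnalyticContinuation q qs) (z : ℂ) :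
    resolventM g q z = cauchyTransform (fun w => qs w * gs w) z := by
  simp only [resolventM, cauchyTransform, hqs.eq_on_real, hgs.eq_on_real, one_div, mul_assoc]

theorem norm_cauchyTransform_le {n : ℂ → ℂ} (hInt : Integrable fun ω : ℝ => n ω) {z : ℂ}
    (hz : z.re ≠ 0) : ‖cauchyTransform n z‖ ≤ |z.re|⁻¹ * ∫ ω : ℝ, ‖n ω‖ := by
  rw [← integral_const_mul]
  refine norm_integral_le_of_norm_le (hInt.norm.const_mul _) (Eventually.of_forall fun ω => ?_)
  rw [norm_mul, norm_inv]
  exact mul_le_mul_of_nonneg_right (inv_anti₀ (abs_pos.2 hz) (abs_re_le_norm_sub_I_mul z ω))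
    (norm_nonneg _)

/-- The meromorphic continuation of `F₁`, up to a discrete set. -/
def F1Ext (gs qs : ℂ → ℂ) (K : ℝ) (f₁ z : ℂ) : ℂ :=
  cauchyExt (fun w => qs w * gs w) z / (1 - I * K * f₁ * cauchyExt gs z)

theorem F1Ext_eq (hgs : IsMeromorphicContinuation g.dens gs) (hqs : IsAnalyticContinuation q qs)
    {z : ℂ} (hz : z.re ≠ 0) : F1Ext gs qs K f₁ z = F1 g gs q qs K f₁ z := by
  rw [F1Ext, F1, resolventM_eq_cauchyTransform hgs hqs, dispersion_eq_cauchyTransform hgs]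
  rcases lt_or_gt_of_ne hz with h | h
  · rw [if_neg (not_lt.2 h.le), cauchyExt_of_neg _ h, cauchyExt_of_neg _ h]
    ring_nf
  · rw [if_pos h, cauchyExt_of_pos _ h, cauchyExt_of_pos _ h]

theorem analyticAt_mul_real (hgs : IsMeromorphicContinuation g.dens gs)
    (hqs : IsAnalyticContinuation q qs) (y : ℝ) : AnalyticAt ℂ (fun w => qs w * gs w) y :=
  (hqs.analytic y (by simp)).mul (hgs.analyticAt_real y)

theorem meromorphicAt_F1Ext (hgs : IsMeromorphicContinuation g.dens gs)
    (hqs : IsAnalyticContinuation q qs) (hq : MemLp q 2 g.measure) (z : ℂ) :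
    MeromorphicAt (F1Ext gs qs K f₁) z := by
  have h1 := meromorphicAt_cauchyExt (integrable_continuation_mul hgs hqs hq)
    (analyticAt_mul_real hgs hqs)
    (fun w (hw : 0 < w.im) => ((hqs.analytic w hw.le).meromorphicAt).mul (hgs.meromorphic w hw)) z
  have h2 := meromorphicAt_cauchyExt hgs.integrable hgs.analyticAt_real hgs.meromorphic z
  exact h1.div ((MeromorphicAt.const 1 z).sub ((MeromorphicAt.const (I * K * f₁) z).mul h2))

theorem analyticAt_F1Ext (hgs : IsMeromorphicContinuation g.dens gs)
    (hqs : IsAnalyticContinuation q qs) (hq : MemLp q 2 g.measure) (hf : f₁.im < 0) (hK : 0 < K)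
    (hKc : ENNReal.ofReal K < transitionPoint g f₁) {z : ℂ} (hz : 0 ≤ z.re) :
    AnalyticAt ℂ (F1Ext gs qs K f₁) z := by
  have h1 := analyticAt_cauchyExt (integrable_continuation_mul hgs hqs hq)
    (analyticAt_mul_real hgs hqs) hz
  have h2 := analyticAt_cauchyExt hgs.integrable hgs.analyticAt_real hz
  exact h1.div (analyticAt_const.sub (analyticAt_const.mul h2))
    (one_sub_coupling_mul_ne_zero hf hK (cauchyExt_ne hgs hf hK hKc hz))

/-- The continuation of `F₁`, in normal form. -/
def F1NF (gs qs : ℂ → ℂ) (K : ℝ) (f₁ : ℂ) : ℂ → ℂ :=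
  toMeromorphicNFOn (F1Ext gs qs K f₁) Set.univ

theorem meromorphicNFAt_F1NF (z : ℂ) : MeromorphicNFAt (F1NF gs qs K f₁) z :=
  meromorphicNFOn_toMeromorphicNFOn _ _ (Set.mem_univ z)

/-- The quotient formula may give meaningless values where g* has a pole or the denominator
vanishes. The normal form differs from it only on a discrete set, so pole orders are unchanged. -/
theorem F1NF_eventuallyEq (hgs : IsMeromorphicContinuation g.dens gs)
    (hqs : IsAnalyticContinuation q qs) (hq : MemLp q 2 g.measure) (z : ℂ) :
    F1NF gs qs K f₁ =ᶠ[𝓝[≠] z] F1Ext gs qs K f₁ :=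
  MeromorphicOn.toMeromorphicNFOn_eq_self_on_nhdsNE
    (fun w _ => meromorphicAt_F1Ext hgs hqs hq w) (Set.mem_univ z)

theorem analyticAt_F1NF (hgs : IsMeromorphicContinuation g.dens gs)
    (hqs : IsAnalyticContinuation q qs) (hq : MemLp q 2 g.measure) (hf : f₁.im < 0) (hK : 0 < K)
    (hKc : ENNReal.ofReal K < transitionPoint g f₁) {z : ℂ} (hz : 0 ≤ z.re) :
    AnalyticAt ℂ (F1NF gs qs K f₁) z := by
  rw [← (meromorphicNFAt_F1NF z).meromorphicOrderAt_nonneg_iff_analyticAt,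
    meromorphicOrderAt_congr (F1NF_eventuallyEq hgs hqs hq z)]
  exact (analyticAt_F1Ext hgs hqs hq hf hK hKc hz).meromorphicOrderAt_nonneg

theorem F1NF_eq_of_pos (hgs : IsMeromorphicContinuation g.dens gs)
    (hqs : IsAnalyticContinuation q qs) (hq : MemLp q 2 g.measure) (hf : f₁.im < 0) (hK : 0 < K)
    (hKc : ENNReal.ofReal K < transitionPoint g f₁) {z : ℂ} (hz : 0 < z.re) :
    F1NF gs qs K f₁ z = resolventM g q z / (1 - I * K * f₁ * dispersion g z) := by
  have h1 := ((analyticAt_F1NF hgs hqs hq hf hK hKc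
    hz.le).continuousAt.eventuallyEq_nhds_iff_eventuallyEq_nhdsNE
    (analyticAt_F1Ext hgs hqs hq hf hK hKc hz.le).continuousAt).1 (F1NF_eventuallyEq hgs hqs hq z)
  rw [h1.eq_of_nhds, F1Ext_eq hgs hqs hz.ne', F1, if_pos hz]

theorem resonancePoles_eq (hgs : IsMeromorphicContinuation g.dens gs)
    (hqs : IsAnalyticContinuation q qs) (hq : MemLp q 2 g.measure) :
    resonancePoles g gs q qs K f₁ =
      {α | α.re < 0 ∧ meromorphicOrderAt (F1NF gs qs K f₁) α < 0} := by
  ext α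
  simp only [resonancePoles, Set.mem_ofPred_eq]
  refine and_congr_right fun hα => ?_
  rw [meromorphicOrderAt_congr (F1NF_eventuallyEq hgs hqs hq α)]
  have : F1Ext gs qs K f₁ =ᶠ[𝓝[≠] α] F1 g gs q qs K f₁ := by
    filter_upwards [nhdsWithin_le_nhds
      ((isOpen_lt continuous_re continuous_const).mem_nhds hα)] with w hw
    exact F1Ext_eq hgs hqs (ne_of_lt hw)
  rw [meromorphicOrderAt_congr this]

/-! ### Bounds for the continuation -/

/-- Singular points of g* are isolated, so the bounds assumed at regular points are available
throughout a punctured neighbourhood, apart from the imaginary axis. -/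
theorem eventually_isRegularPoint (hgs : IsMeromorphicContinuation g.dens gs) (z : ℂ) :
    ∀ᶠ w in 𝓝[≠] z, w.re ≠ 0 → IsRegularPoint gs w := by
  have hrot : Tendsto (fun w => -I * w) (𝓝[≠] z) (𝓝[≠] (-I * z)) := by
    refine tendsto_nhdsWithin_iff.2 ⟨((continuous_const.mul continuous_id).tendsto z).mono_left
      nhdsWithin_le_nhds, ?_⟩
    filter_upwards [self_mem_nhdsWithin] with w hw h
    exact hw (mul_left_cancel₀ (neg_ne_zero.2 I_ne_zero) h)
  have hmain : z.re ≤ 0 → ∀ᶠ w in 𝓝[≠] z, w.re ≠ 0 → IsRegularPoint gs w := by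
    intro hz
    have h1 : MeromorphicAt gs (-I * z) := by
      rcases hz.eq_or_lt with h | h
      · have : -I * z = ((z.im : ℝ) : ℂ) := by
          apply Complex.ext <;> simp [h]
        rw [this]
        exact (hgs.analyticAt_real _).meromorphicAt
      · exact hgs.meromorphic _ (by simpa using h)
    filter_upwards [hrot.eventually h1.eventually_analyticAt] with w hw hne
    rcases lt_or_gt_of_ne hne with h | h
    · exact Or.inr ⟨h, hw⟩
    · exact Or.inl h
  rcases le_or_gt z.re 0 with h | h
  · exact hmain h
  · filter_upwards [nhdsWithin_le_nhds
      ((isOpen_lt continuous_const continuous_re).mem_nhds h)] with w hw _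
    exact Or.inl hw

/-- At a pole |f| tends to infinity along every approach, so boundedness on any set accumulating at
z excludes it; the bound then passes to z by continuity. An arc is enough, and no full neighbourhood
is required. -/
theorem analyticAt_of_frequently_norm_le {f : ℂ → ℂ} {z : ℂ}
    (hf : MeromorphicNFAt f z) {C : ℝ} (h : ∃ᶠ w in 𝓝[≠] z, ‖f w‖ ≤ C) :
    AnalyticAt ℂ f z ∧ ‖f z‖ ≤ C := by
  have han : AnalyticAt ℂ f z := by
    rw [← hf.meromorphicOrderAt_nonneg_iff_analyticAt, ← not_lt]
    intro hneg
    have h1 := tendsto_norm_cobounded_atTop.comp (tendsto_cobounded_of_meromorphicOrderAt_neg hneg)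
    obtain ⟨w, hw1, hw2⟩ := (h.and_eventually (h1.eventually_gt_atTop C)).exists
    exact absurd hw1 (not_le.2 hw2)
  refine ⟨han, ?_⟩
  exact isClosed_Iic.mem_of_frequently_of_tendsto (s := Set.Iic C) (f := fun w => ‖f w‖) h
    (han.continuousAt.norm.tendsto.mono_left nhdsWithin_le_nhds)

/-- A bound for `F₁` at the regular points of an arc near one of its points passes to the
continuation at that point. -/
theorem F1NF_bound_of_arc (hgs : IsMeromorphicContinuation g.dens gs)
    (hqs : IsAnalyticContinuation q qs) (hq : MemLp q 2 g.measure) {ρ θ C : ℝ} (hρ : 0 < ρ)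
    {s : Set ℝ} (hs : (𝓝[s \ {θ}] θ).NeBot)
    (hb : ∀ θ' ∈ s, IsRegularPoint gs (ρ * exp (I * θ')) →
      ‖F1 g gs q qs K f₁ (ρ * exp (I * θ'))‖ ≤ C) :
    AnalyticAt ℂ (F1NF gs qs K f₁) (ρ * exp (I * θ)) ∧
      ‖F1NF gs qs K f₁ (ρ * exp (I * θ))‖ ≤ C := by
  set w : ℝ → ℂ := fun t => ρ * exp (I * t) with hw
  have hd : HasDerivAt w (ρ * (exp (I * θ) * I)) θ := by
    have h1 : HasDerivAt (fun t : ℝ => I * (t : ℂ)) I θ := by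
      simpa using (hasDerivAt_id θ).ofReal_comp.const_mul I
    exact h1.cexp.const_mul (ρ : ℂ)
  have hd0 : (ρ : ℂ) * (exp (I * θ) * I) ≠ 0 :=
    mul_ne_zero (ofReal_ne_zero.2 hρ.ne') (mul_ne_zero (exp_ne_zero _) I_ne_zero)
  have hle : 𝓝[s \ {θ}] θ ≤ 𝓝[≠] θ := nhdsWithin_mono _ fun t ht => ht.2
  have hwt : Tendsto w (𝓝[s \ {θ}] θ) (𝓝[≠] (w θ)) := (hd.tendsto_nhdsNE hd0).mono_left hle
  have hre : ∀ t, (w t).re = ρ * Real.cos t := by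
    intro t
    rw [hw, re_ofReal_mul, mul_comm I, exp_ofReal_mul_I_re]
  -- The arc crosses the imaginary axis only at isolated parameters, so the points where `F1`
  -- carries no meaning can be avoided.
  have hcos : ∀ᶠ t in 𝓝[≠] θ, Real.cos t ≠ 0 := by
    by_cases h : Real.cos θ = 0
    · refine (Real.hasDerivAt_cos θ).eventually_ne ?_
      intro h2
      have := Real.sin_sq_add_cos_sq θ
      rw [h, neg_eq_zero.1 h2] at this
      norm_num at this
    · exact (Real.continuous_cos.continuousAt.eventually_ne h).filter_mono nhdsWithin_le_nhds
  refine analyticAt_of_frequently_norm_le (meromorphicNFAt_F1NF (w θ)) (hwt.frequently ?_)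
  refine Eventually.frequently ?_
  filter_upwards [self_mem_nhdsWithin, hle hcos, hwt.eventually (F1NF_eventuallyEq hgs hqs hq (w θ)),
    hwt.eventually (eventually_isRegularPoint hgs (w θ))] with t ht h1 h2 h3
  have h4 : (w t).re ≠ 0 := by
    rw [hre]
    exact mul_ne_zero hρ.ne' h1
  rw [h2, F1Ext_eq hgs hqs h4]
  exact hb t ht.1 (h3 h4)

/-- Every point of `Icc a b` is an accumulation point of it. -/
theorem neBot_nhdsWithin_Icc_diff {a b θ : ℝ} (hab : a < b) (hθ : θ ∈ Set.Icc a b) :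
    (𝓝[Set.Icc a b \ {θ}] θ).NeBot := by
  rcases hθ.2.lt_or_eq with h | h
  · refine NeBot.mono (inferInstance : (𝓝[>] θ).NeBot) ?_
    rw [← nhdsWithin_Ioo_eq_nhdsGT h]
    exact nhdsWithin_mono _ fun t ht => ⟨⟨hθ.1.trans ht.1.le, ht.2.le⟩, ht.1.ne'⟩
  · subst h
    refine NeBot.mono (inferInstance : (𝓝[<] θ).NeBot) ?_
    rw [← nhdsWithin_Ioo_eq_nhdsLT hab]
    exact nhdsWithin_mono _ fun t ht => ⟨⟨ht.1.le, ht.2.le⟩, ht.2.ne⟩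

/-- Boundedness is all that the contour argument needs, so ε = 1 suffices. -/
theorem exists_sector_bound (hgs : IsMeromorphicContinuation g.dens gs)
    (hqs : IsAnalyticContinuation q qs) (hq : MemLp q 2 g.measure) {δ : ℝ} (hδ : 0 < δ)
    (hdecay : DecaysNearImaginaryAxis (F1 g gs q qs K f₁) gs δ) :
    ∃ R > 0, ∀ ρ θ : ℝ, R ≤ ρ → (|θ - Real.pi / 2| ≤ δ ∨ |θ - 3 * Real.pi / 2| ≤ δ) →
      AnalyticAt ℂ (F1NF gs qs K f₁) (ρ * exp (I * θ)) ∧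
        ‖F1NF gs qs K f₁ (ρ * exp (I * θ))‖ ≤ 1 := by
  obtain ⟨R, hR, hdec⟩ := hdecay 1 one_pos
  refine ⟨R, hR, fun ρ θ hρ hθ => ?_⟩
  have hmem : ∀ c t : ℝ, |t - c| ≤ δ ↔ t ∈ Set.Icc (c - δ) (c + δ) := by
    intro c t
    rw [abs_le, Set.mem_Icc]
    constructor <;> rintro ⟨h1, h2⟩ <;> constructor <;> linarith
  rcases hθ with h | h
  · exact F1NF_bound_of_arc hgs hqs hq (hR.trans_le hρ)
      (neBot_nhdsWithin_Icc_diff (by linarith) ((hmem _ _).1 h))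
      fun t ht hreg => (hdec ρ t hρ (Or.inl ((hmem _ _).2 ht)) hreg).le
  · exact F1NF_bound_of_arc hgs hqs hq (hR.trans_le hρ)
      (neBot_nhdsWithin_Icc_diff (by linarith) ((hmem _ _).1 h))
      fun t ht hreg => (hdec ρ t hρ (Or.inr ((hmem _ _).2 ht)) hreg).le

theorem abs_arg_le_of_abs_im_le {w : ℂ} {η : ℝ} (hη : 0 < η) (hη' : η < Real.pi / 2)
    (hre : 0 ≤ w.re) (him : |w.im| ≤ Real.sin η * ‖w‖) : |arg w| ≤ η := by
  have hs : 0 < Real.sin η := Real.sin_pos_of_pos_of_lt_pi hη (by linarith [Real.pi_pos])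
  have h1 : |w.im / ‖w‖| ≤ Real.sin η := by
    rw [abs_div, abs_norm]
    exact div_le_of_le_mul₀ (norm_nonneg _) hs.le him
  rw [arg_of_re_nonneg hre, abs_le]
  constructor
  · rw [Real.le_arcsin_iff_sin_le' ⟨by linarith, by linarith⟩, Real.sin_neg]
    exact (abs_le.1 h1).1
  · rw [Real.arcsin_le_iff_le_sin' ⟨by linarith, by linarith⟩]
    exact (abs_le.1 h1).2

/-- Points close to the imaginary axis in polar coordinates. -/
theorem exists_polar_of_abs_re_le {z : ℂ} {η : ℝ} (hη : 0 < η) (hη' : η < Real.pi / 2)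
    (h : |z.re| ≤ Real.sin η * ‖z‖) :
    ∃ θ : ℝ, (|θ - Real.pi / 2| ≤ η ∨ |θ - 3 * Real.pi / 2| ≤ η) ∧ z = ‖z‖ * exp (I * θ) := by
  have hrot : exp (I * ((Real.pi / 2 : ℝ) : ℂ)) = I := by
    push_cast
    rw [mul_comm, exp_pi_div_two_mul_I]
  rcases le_or_gt 0 z.im with him | him
  · refine ⟨arg (-I * z) + Real.pi / 2, Or.inl ?_, ?_⟩
    · rw [add_sub_cancel_right]
      exact abs_arg_le_of_abs_im_le hη hη' (by simpa using him) (by simpa using h)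
    · have h1 := norm_mul_exp_arg_mul_I (-I * z)
      rw [ofReal_add, mul_add, exp_add, hrot, ← mul_assoc, mul_comm I (arg (-I * z) : ℂ)]
      have h2 : ‖-I * z‖ = ‖z‖ := by simp
      rw [h2] at h1
      rw [h1]
      linear_combination z * I_mul_I
  · refine ⟨arg (I * z) + 3 * Real.pi / 2, Or.inr ?_, ?_⟩
    · rw [add_sub_cancel_right]
      exact abs_arg_le_of_abs_im_le hη hη' (by simpa using him.le) (by simpa using h)
    · have h1 := norm_mul_exp_arg_mul_I (I * z)
      have h3 : I * ((arg (I * z) + 3 * Real.pi / 2 : ℝ) : ℂ) =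
          (arg (I * z) : ℂ) * I + (Real.pi * I + I * ((Real.pi / 2 : ℝ) : ℂ)) := by
        push_cast
        ring
      rw [h3, exp_add, exp_add, hrot, exp_pi_mul_I, ← mul_assoc]
      have h2 : ‖I * z‖ = ‖z‖ := by simp
      rw [h2] at h1
      rw [h1]
      linear_combination z * I_mul_I

theorem exists_polar_of_re_nonpos {z : ℂ} (hz : z.re ≤ 0) :
    ∃ θ : ℝ, Real.pi / 2 ≤ θ ∧ θ ≤ 3 * Real.pi / 2 ∧ z = ‖z‖ * exp (I * θ) := by
  have h := abs_le.1 (abs_arg_le_pi_div_two_iff.2 (by simpa using hz : 0 ≤ (-z).re))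
  refine ⟨arg (-z) + Real.pi, by linarith [h.1], by linarith [h.2], ?_⟩
  have h1 := norm_mul_exp_arg_mul_I (-z)
  rw [norm_neg] at h1
  rw [ofReal_add, mul_add, exp_add, mul_comm I, mul_comm I, exp_pi_mul_I, ← mul_assoc, h1]
  ring

/-! ### The equation for the resonance poles -/

/-- If g*(-iz) has no pole at α, the denominator has a limit, and F₁ would stay bounded unless this
limit is 0. If it has a pole, dividing numerator and denominator by g*(-iz) shows F₁ →
-q*(-iα)/(iKf₁), again finite because q* is analytic. The root is stated as a limit since g* may
carry an arbitrary value at a removable singularity. -/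
theorem tendsto_dispersion_of_resonancePole (hgs : IsMeromorphicContinuation g.dens gs)
    (hqs : IsAnalyticContinuation q qs) (hq : MemLp q 2 g.measure) (hf : f₁.im < 0) (hK : 0 < K)
    {α : ℂ} (hα : α ∈ resonancePoles g gs q qs K f₁) :
    Tendsto (fun z => dispersion g z + 2 * Real.pi * gs (-I * z)) (𝓝[≠] α)
      (𝓝 (1 / (I * K * f₁))) := by
  obtain ⟨hre, hord⟩ := hα
  have hF := tendsto_norm_cobounded_atTop.comp (tendsto_cobounded_of_meromorphicOrderAt_neg hord)
  have hfin : ∀ c, ¬Tendsto (F1 g gs q qs K f₁) (𝓝[≠] α) (𝓝 c) := fun c hc =>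
    not_tendsto_atTop_of_tendsto_nhds hc.norm hF
  set κ : ℂ := I * K * f₁ with hκ
  have hκ0 : κ ≠ 0 := mul_ne_zero (mul_ne_zero I_ne_zero (ofReal_ne_zero.2 hK.ne'))
    (by rintro rfl; simp at hf)
  have hD : Tendsto (dispersion g) (𝓝[≠] α) (𝓝 (dispersion g α)) := by
    rw [funext (dispersion_eq_cauchyTransform hgs)]
    exact (analyticAt_cauchyTransform hgs.integrable hre.ne).continuousAt.tendsto.mono_left
      nhdsWithin_le_nhds
  have hQ : Tendsto (resolventM g q) (𝓝[≠] α) (𝓝 (resolventM g q α)) := by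
    rw [funext (resolventM_eq_cauchyTransform hgs hqs)]
    exact (analyticAt_cauchyTransform (integrable_continuation_mul hgs hqs hq)
      hre.ne).continuousAt.tendsto.mono_left nhdsWithin_le_nhds
  have hqsα : Tendsto (fun z => qs (-I * z)) (𝓝[≠] α) (𝓝 (qs (-I * α))) := by
    have h1 : AnalyticAt ℂ (fun z => qs (-I * z)) α :=
      AnalyticAt.fun_comp (hqs.analytic _ (by simpa using hre.le)) (by fun_prop)
    exact h1.continuousAt.tendsto.mono_left nhdsWithin_le_nhds
  have hneg : ∀ᶠ z in 𝓝[≠] α, z.re < 0 := nhdsWithin_le_nhds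
    ((isOpen_lt continuous_re continuous_const).mem_nhds hre)
  have hgm : MeromorphicAt (fun z => gs (-I * z)) α :=
    MeromorphicAt.comp_analyticAt (hgs.meromorphic _ (by simpa using hre)) (by fun_prop)
  rcases le_or_gt 0 (meromorphicOrderAt (fun z => gs (-I * z)) α) with ho | ho
  · obtain ⟨c, hc⟩ := tendsto_nhds_of_meromorphicOrderAt_nonneg hgm ho
    have hlim := hD.add (hc.const_mul (2 * Real.pi : ℂ))
    by_cases heq : dispersion g α + 2 * Real.pi * c = 1 / κ
    · rwa [heq] at hlim
    · exfalso
      have hden := (hlim.const_mul κ).const_sub 1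
      have hne := one_sub_coupling_mul_ne_zero hf hK heq
      refine hfin _ (((hQ.add ((hqsα.const_mul (2 * Real.pi : ℂ)).mul hc)).div hden hne).congr' ?_)
      filter_upwards [hneg] with z hz
      rw [F1, if_neg (not_lt.2 hz.le), Pi.div_apply]
      congr 1
      rw [hκ]
      ring
  · exfalso
    have hgi := tendsto_inv₀_cobounded.comp (tendsto_cobounded_of_meromorphicOrderAt_neg ho)
    have hne : ∀ᶠ z in 𝓝[≠] α, gs (-I * z) ≠ 0 := by
      filter_upwards [(tendsto_norm_cobounded_atTop.comp
        (tendsto_cobounded_of_meromorphicOrderAt_neg ho)).eventually_gt_atTop 0] with z hz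
      exact norm_pos_iff.1 hz
    have hnum := (hQ.mul hgi).add (hqsα.const_mul (2 * Real.pi : ℂ))
    have hden := (((hD.const_mul κ).const_sub 1).mul hgi).sub_const (2 * Real.pi * κ)
    have hπ : (2 * Real.pi * κ : ℂ) ≠ 0 :=
      mul_ne_zero (mul_ne_zero two_ne_zero (ofReal_ne_zero.2 Real.pi_ne_zero)) hκ0
    rw [mul_zero, zero_sub] at hden
    refine hfin _ ((hnum.div hden (neg_ne_zero.2 hπ)).congr' ?_)
    filter_upwards [hneg, hne] with z hz hz'
    rw [F1, if_neg (not_lt.2 hz.le), Pi.div_apply, Function.comp_apply,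
      ← mul_div_mul_right _ _ hz']
    congr 1
    · rw [add_mul, mul_assoc, inv_mul_cancel₀ hz', mul_one]
    · rw [sub_mul, mul_assoc, inv_mul_cancel₀ hz', hκ]
      ring

end Continuation

section Bounds

variable {g : FrequencyDensity} {gs qs : ℂ → ℂ} {q : ℝ → ℂ} {K : ℝ} {f₁ : ℂ}

/-! ### Global bounds and the expansion -/

/-- The continuation is bounded far out in a wedge that contains the closed right half-plane. -/
theorem exists_wedge_bound (hgs : IsMeromorphicContinuation g.dens gs)
    (hqs : IsAnalyticContinuation q qs) (hq : MemLp q 2 g.measure) (hf : f₁.im < 0) (hK : 0 < K)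
    (hKc : ENNReal.ofReal K < transitionPoint g f₁) {δ : ℝ} (hδ : 0 < δ)
    (hdecay : DecaysNearImaginaryAxis (F1 g gs q qs K f₁) gs δ) :
    ∃ m R₀ M : ℝ, 0 < m ∧ 0 < R₀ ∧ ∀ z : ℂ, R₀ ≤ ‖z‖ → -(m * |z.im|) ≤ z.re →
      AnalyticAt ℂ (F1NF gs qs K f₁) z ∧ ‖F1NF gs qs K f₁ z‖ ≤ M := by
  obtain ⟨R, hR, hsect⟩ := exists_sector_bound hgs hqs hq hδ hdecay
  set η := min δ (Real.pi / 4) with hη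
  have hη0 : 0 < η := lt_min hδ (by positivity)
  have hη1 : η < Real.pi / 2 := (min_le_right _ _).trans_lt (by linarith [Real.pi_pos])
  have hm : 0 < Real.sin η := Real.sin_pos_of_pos_of_lt_pi hη0 (by linarith [Real.pi_pos])
  set m := Real.sin η with hm'
  set κ : ℂ := I * K * f₁ with hκ
  set J : ℝ := ∫ ω : ℝ, ‖qs ω * gs ω‖ with hJ
  have hJ0 : 0 ≤ J := integral_nonneg fun _ => norm_nonneg _
  -- Where Re z > m|z|, this radius gives |κD| ≤ |κ|/Re z ≤ 1/2, so the denominator is at least 1/2;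
  -- with |Q| ≤ J/m the quotient is at most 2J/m.
  refine ⟨m, max (max R 1) (2 * ‖κ‖ / m), max 1 (2 * J / m), hm,
    lt_max_of_lt_left (lt_max_of_lt_left hR), fun z hz hwedge => ?_⟩
  have hzR : R ≤ ‖z‖ := (le_max_left _ _).trans ((le_max_left _ _).trans hz)
  have hz1 : 1 ≤ ‖z‖ := (le_max_right _ _).trans ((le_max_left _ _).trans hz)
  have hzκ : 2 * ‖κ‖ ≤ m * ‖z‖ := by
    rw [mul_comm m]
    exact (div_le_iff₀ hm).1 ((le_max_right _ _).trans hz)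
  -- Near the axis the sector bound applies. Away from it, the wedge condition with slope m rules
  -- out the left side, and the resolvent bounds apply.
  by_cases hre : |z.re| ≤ m * ‖z‖
  · obtain ⟨θ, hθ, hzθ⟩ := exists_polar_of_abs_re_le hη0 hη1 hre
    have h1 := hsect ‖z‖ θ hzR (hθ.imp (fun h => h.trans (min_le_left _ _))
      fun h => h.trans (min_le_left _ _))
    rw [← hzθ] at h1
    exact ⟨h1.1, h1.2.trans (le_max_left _ _)⟩
  · rw [not_le] at hre
    have hpos : m * ‖z‖ < z.re := by
      rcases lt_abs.1 hre with h | h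
      · exact h
      · have : m * |z.im| ≤ m * ‖z‖ := mul_le_mul_of_nonneg_left (abs_im_le_norm z) hm.le
        linarith
    have hx : 0 < z.re := lt_of_le_of_lt (by positivity) hpos
    refine ⟨analyticAt_F1NF hgs hqs hq hf hK hKc hx.le, le_max_of_le_right ?_⟩
    rw [F1NF_eq_of_pos hgs hqs hq hf hK hKc hx]
    have hD : ‖κ * dispersion g z‖ ≤ 1 / 2 := by
      have h1 := norm_dispersion_le g hx.ne'
      rw [abs_of_pos hx] at h1
      rw [norm_mul]
      calc ‖κ‖ * ‖dispersion g z‖ ≤ ‖κ‖ * z.re⁻¹ := by gcongr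
        _ ≤ 1 / 2 := by
          rw [← div_eq_mul_inv, div_le_iff₀ hx]
          linarith
    have hden : 1 / 2 ≤ ‖1 - κ * dispersion g z‖ := by
      have := norm_sub_norm_le (1 : ℂ) (κ * dispersion g z)
      rw [norm_one] at this
      linarith
    have hnum : ‖resolventM g q z‖ ≤ J / m := by
      rw [resolventM_eq_cauchyTransform hgs hqs]
      refine (norm_cauchyTransform_le (integrable_continuation_mul hgs hqs hq) hx.ne').trans ?_
      rw [abs_of_pos hx, mul_comm, ← div_eq_mul_inv]
      refine div_le_div_of_nonneg_left hJ0 hm ?_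
      nlinarith
    rw [norm_div]
    calc _ ≤ J / m / (1 / 2) := by gcongr
      _ = 2 * J / m := by ring

/-- The left half-circle consists of two pieces in the decay sectors, where the bound is 1, and the
arc between them, where it is A e^{βr_k}; hence the constant `max A 1`. -/
theorem F1NF_bound_on_arcs (hgs : IsMeromorphicContinuation g.dens gs)
    (hqs : IsAnalyticContinuation q qs) (hq : MemLp q 2 g.measure) {δ : ℝ} (hδ : 0 < δ)
    (hdecay : DecaysNearImaginaryAxis (F1 g gs q qs K f₁) gs δ) {A β : ℝ} (hβ : 0 < β)
    {r : ℕ → ℝ} (hr : Tendsto r atTop atTop)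
    (hgrowth : ExpBoundOnArcs (F1 g gs q qs K f₁) gs δ A β r) :
    ∀ᶠ k in atTop, ∀ z : ℂ, ‖z‖ = r k → z.re ≤ 0 →
      AnalyticAt ℂ (F1NF gs qs K f₁) z ∧
        ‖F1NF gs qs K f₁ z‖ ≤ max A 1 * Real.exp (β * r k) := by
  obtain ⟨R, hR, hsect⟩ := exists_sector_bound hgs hqs hq hδ hdecay
  filter_upwards [hr.eventually_ge_atTop R] with k hk z hz hre
  have hrk : 0 < r k := hR.trans_le hk
  obtain ⟨θ, hθ1, hθ2, hzθ⟩ := exists_polar_of_re_nonpos hre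
  rw [hz] at hzθ
  by_cases hθ : |θ - Real.pi / 2| ≤ δ ∨ |θ - 3 * Real.pi / 2| ≤ δ
  · have h1 := hsect (r k) θ hk hθ
    rw [← hzθ] at h1
    refine ⟨h1.1, h1.2.trans ?_⟩
    have h2 : 1 ≤ Real.exp (β * r k) := Real.one_le_exp (by positivity)
    calc (1 : ℝ) = 1 * 1 := (one_mul 1).symm
      _ ≤ _ := mul_le_mul (le_max_right _ _) h2 zero_le_one (by positivity)
  · rw [not_or, not_le, not_le, abs_of_nonneg (by linarith), abs_of_nonpos (by linarith)] at hθ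
    have h1 := F1NF_bound_of_arc hgs hqs hq (K := K) (f₁ := f₁) (C := A * Real.exp (β * r k)) hrk
      (neBot_nhdsWithin_Icc_diff (a := Real.pi / 2 + δ) (b := 3 * Real.pi / 2 - δ) (θ := θ)
        (by linarith [hθ.1, hθ.2]) ⟨by linarith [hθ.1], by linarith [hθ.2]⟩)
      fun t ht hreg => hgrowth k t ht.1 ht.2 hreg
    rw [← hzθ] at h1
    exact ⟨h1.1, h1.2.trans (mul_le_mul_of_nonneg_right (le_max_left _ _) (Real.exp_pos _).le)⟩

end Bounds

end Kuramoto

end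

/-! ### Assembly of the theorem -/

theorem theorem3p9 (g : Kuramoto.FrequencyDensity) (gs : ℂ → ℂ) (q : ℝ → ℂ) (qs : ℂ → ℂ)
    (K : ℝ) (f₁ : ℂ)
    (hf : f₁.im < 0) (hK : 0 < K) (hKc : ENNReal.ofReal K < Kuramoto.transitionPoint g f₁)
    (hg : AnalyticOnNhd ℝ g.dens Set.univ)
    (hgs : Kuramoto.IsMeromorphicContinuation g.dens gs)
    (hqL2 : MemLp q 2 g.measure)
    (hq : AnalyticOnNhd ℝ q Set.univ)
    (hqs : Kuramoto.IsAnalyticContinuation q qs)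
    (δ : ℝ) (hδ : 0 < δ)
    (hdecay : Kuramoto.DecaysNearImaginaryAxis (Kuramoto.F1 g gs q qs K f₁) gs δ)
    (A β : ℝ) (hA : 0 < A) (hβ : 0 < β)
    (r : ℕ → ℝ) (hr_pos : ∀ k, 0 < r k) (hr : Tendsto r atTop atTop)
    (hgrowth : Kuramoto.ExpBoundOnArcs (Kuramoto.F1 g gs q qs K f₁) gs δ A β r) :
    -- the spectrum of `T₁` lies on the imaginary axis
    (∀ z ∈ Kuramoto.opSpectrum (Kuramoto.T1 g K f₁), z.re = 0) ∧
    -- every resonance pole is a root of `D(z) + 2π g*(-iz) = 1 / (i K f₁)`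
    (∀ α ∈ Kuramoto.resonancePoles g gs q qs K f₁,
      Tendsto (fun z => Kuramoto.dispersion g z + 2 * Real.pi * gs (-I * z)) (𝓝[≠] α)
        (𝓝 (1 / (I * K * f₁)))) ∧
    -- `T₁` generates a semigroup `S t = e^{T₁t}`
    ∃ S : ℝ → g.L2 →L[ℂ] g.L2,
      Kuramoto.IsSemigroupGeneratedBy S (Kuramoto.T1 g K f₁) ∧
      -- resonance poles exist, unless the order parameter vanishes identically
      ((∃ t : ℝ, 0 ≤ t ∧ Kuramoto.orderParameter g S (hqL2.toLp q) t ≠ 0) →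
        (Kuramoto.resonancePoles g gs q qs K f₁).Nonempty) ∧
      -- the order parameter is the sum of the contributions of the resonance poles
      (∃ hfin : ∀ R : ℝ, (Kuramoto.resonancePoles g gs q qs K f₁ ∩ {α | ‖α‖ < R}).Finite,
        ∃ t₀ : ℝ, 0 < t₀ ∧ ∃ p : ℂ → Polynomial ℂ, ∀ t : ℝ, t₀ < t →
          Tendsto (fun k => ∑ α ∈ (hfin (r k)).toFinset, (p α).eval (t : ℂ) * exp (α * t)) atTop
            (𝓝 (Kuramoto.orderParameter g S (hqL2.toLp q) t))) ∧
      -- the order parameter decays exponentially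
      (∃ C γ : ℝ, 0 < γ ∧ ∀ t : ℝ, 0 ≤ t →
        ‖Kuramoto.orderParameter g S (hqL2.toLp q) t‖ ≤ C * Real.exp (-γ * t)) := by
  obtain ⟨S, hS, c₀, hc₀, hLap⟩ := Kuramoto.exists_semigroup g K f₁
  refine ⟨fun z hz => Kuramoto.spectrum_T1 hgs hf hK hKc hz,
    fun α hα => Kuramoto.tendsto_dispersion_of_resonancePole hgs hqs hqL2 hf hK hα, S, hS, ?_⟩
  obtain ⟨m, R₀, M, hm, hR₀, hwedge⟩ :=
    Kuramoto.exists_wedge_bound hgs hqs hqL2 hf hK hKc hδ hdecay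
  refine Kuramoto.resonance_expansion (fun z => Kuramoto.meromorphicNFAt_F1NF z)
    (fun z hz => Kuramoto.analyticAt_F1NF hgs hqs hqL2 hf hK hKc hz) hm hR₀ hwedge hr hβ
    ((Kuramoto.F1NF_bound_on_arcs hgs hqs hqL2 hδ hdecay hβ hr hgrowth).mono
      fun k hk z hz hre => hk z hz (hre.trans (neg_nonpos.2 (by positivity))))
    (continuousOn_const.inner (𝕜 := ℂ) (hS.continuousOn (hqL2.toLp q))) (c₀ := c₀)
    (fun l hl => ?_) (Kuramoto.resonancePoles_eq hgs hqs hqL2)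
  have hl0 : 0 < l.re := hc₀.trans_lt hl
  have hne : 1 - I * K * f₁ * Kuramoto.dispersion g l ≠ 0 := by
    refine Kuramoto.one_sub_coupling_mul_ne_zero hf hK ?_
    rw [Kuramoto.dispersion_eq_cauchyTransform hgs, ← Kuramoto.cauchyExt_of_pos _ hl0]
    exact Kuramoto.cauchyExt_ne hgs hf hK hKc hl0.le
  rw [Kuramoto.F1NF_eq_of_pos hgs hqs hqL2 hf hK hKc hl0]
  exact hLap l hl hne q hqL2
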